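/- Let $n\ge 2$. Let $S^{m}$ be the unit sphere of $\mathbb R^{m+1}$, $\sigma_{n-1}=2\pi^{n/2}/\Gamma(n/2)$ the area of $S^{n-1}$, and let $G(n,n-1)$ be the set of all affine hyperplanes $\tau(\eta,t)=\{x\in\mathbb R^n: x\cdot\eta=t\}$, $\eta\in S^{n-1}$, $t\in\mathbb R$ (so $\tau(-\eta,-t)=\tau(\eta,t)$), equipped with the measure $d\tau$ that is the product of the rotation invariant probability measure on directions and Lebesgue measure on the line normal to $\tau$. Let $|\tau|$ be the distance of $\tau$ from the origin, and write $h(\eta,t)=h(\tau(\eta,t))$ for a (real or complex valued) measurable function $h$ on $G(n,n-1)$. For $\theta\in S^n$ write $\theta=(\theta',\theta_{n+1})$, $\theta'\in\mathbb R^n$. The dual hyperplane Radon transform is $$(R^*h)(x)=\frac1{\sigma_{n-1}}\int_{S^{n-1}}h(\eta,x\cdot\eta)\,d\eta,\qquad x\in\mathbb R^n,$$ and the Funk transform $(Ff)(\theta)$, $\theta\in S^n$, is the mean value of $f$ over $S^n\cap\theta^\perp$ with respect to the rotation invariant probability measure. Let $$(A_*f)(x)=\frac1{\sqrt{1+|x|^2}}\,f\Big(\frac{-x+e_{n+1}}{\sqrt{1+|x|^2}}\Big),\qquad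 (B_*h)(\theta)=\frac1{|\theta'|^n}\,h\Big(\frac{\theta'}{|\theta'|},\frac{\theta_{n+1}}{|\theta'|}\Big)\quad(\theta'\ne0).$$ Suppose that $$\int_{G(n,n-1)}\frac{|h(\tau)|}{\sqrt{1+|\tau|^2}}\,d\tau<\infty .$$ (1) $B_*h\in L^1_{even}(S^n)$, and $(R^*h)(x)=(A_*FB_*h)(x)$: both sides exist as Lebesgue integrals for almost every $x\in\mathbb R^n$; for every $x$ one side exists if and only if the other does, and then they are equal. (2) Put $$(A_*^{-1}g)(\theta)=\frac1{|\theta_{n+1}|}\,g\Big(-\frac{\theta'}{\theta_{n+1}}\Big)\quad(\theta_{n+1}\neq0),\qquad (B_*^{-1}f)(\tau)=(1+|\tau|^2)^{-n/2}f(\tilde\mu(-\tau)),$$ where $-\tau=\{x:-x\in\tau\}$ and, for $\tau=\tau(\eta,t)$ with $t\ge0$, $\tilde\mu(\tau)=-\eta\cos\alpha+e_{n+1}\sin\alpha$, $\tan\alpha=t$, $0\le\alpha<\pi/2$ (for $t=0$ either of the two choices of $\eta$ is made; such $\tau$ form a null set). Then $f=B_*h$ is, up to equality almost everywhere, the unique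 $f\in L^1_{even}(S^n)$ with $Ff=A_*^{-1}R^*h$ almost everywhere, and for almost every $\tau\in G(n,n-1)$ $$h(\tau)=(B_*^{-1}F^{-1}A_*^{-1}R^*h)(\tau).$$ Here $F^{-1}\varphi$, for $\varphi=A_*^{-1}R^*h$, is evaluated by the formula $$(F^{-1}\varphi)(\theta)=\lim_{t\to1^-}\Big(\frac{\partial}{\partial t}\Big)^{n-1}\Big[\frac1{(n-2)!}\int_0^t(t^2-s^2)^{(n-3)/2}\,\Phi_\theta(s)\,s\,ds\Big],$$ $$\Phi_\theta(s)=\frac1{\sigma_{n-1}}\int_{S^n\cap\theta^\perp}\varphi\big(s\sigma+\sqrt{1-s^2}\,\theta\big)\,d\sigma .$$ For almost every $\theta$, the integral defining $\Phi_\theta(s)$ exists for almost all $s\in(0,1)$, the integral in brackets exists for every $t\in(0,1)$ and is a $C^{n-2}$ function of $t\in(0,1)$, and its derivative of order $n-1$ exists for almost all $t\in(0,1)$. For almost all $t\in(0,1)$ this derivative is an integrable function of $\theta$, and the limit, as $t\to1^-$ outside a null set of values of $t$, is understood in the norm of $L^1(S^n)$. -/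

import Mathlib

open MeasureTheory Filter Topology

noncomputable section

namespace DualRadon

/-- The Euclidean space of dimension `n`. -/
abbrev E (n : ℕ) := EuclideanSpace ℝ (Fin n)

/-- The unit sphere of the Euclidean space of dimension `m`
(so the sphere usually written `S^n` is `USphere (n + 1)`). -/
abbrev USphere (m : ℕ) := Metric.sphere (0 : E m) 1

/-- The Riemannian (surface) measure on the unit sphere of `E m`. -/
def surf (m : ℕ) : Measure (USphere m) := (volume : Measure (E m)).toSphere

/-- `σ_{n-1} = 2 π^{n/2} / Γ(n/2)`, the area of the unit sphere of `E n`. -/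
def area (n : ℕ) : ℝ := 2 * Real.pi ^ ((n : ℝ) / 2) / Real.Gamma ((n : ℝ) / 2)

/-! Hyperplanes in `E n`. -/

/-- The set `G(n, n-1)` of affine hyperplanes `{x | x · η = t}`, `|η| = 1`, of `E n`. -/
def Hyperplane (n : ℕ) : Type :=
  {s : Set (E n) // ∃ (η : USphere n) (t : ℝ), s = {x | inner ℝ x (η : E n) = t}}

/-- The hyperplane `τ(η, t) = {x | x · η = t}`. -/
def hplane {n : ℕ} (η : USphere n) (t : ℝ) : Hyperplane n :=
  ⟨{x | inner ℝ x (η : E n) = t}, η, t, rfl⟩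

/-- The Borel structure of `G(n, n-1)`, a set of hyperplanes being measurable when the set of its
parameters `(η, t)` is. -/
instance (n : ℕ) : MeasurableSpace (Hyperplane n) :=
  MeasurableSpace.map (fun p : USphere n × ℝ => hplane p.1 p.2) inferInstance

/-- The measure `dτ` on `G(n, n-1)`: the direction of `τ` is distributed according to the rotation
invariant probability measure, and the position along the normal line according to Lebesgue
measure. It is the image of (normalized surface measure) ⊗ (Lebesgue measure) under the
two-to-one parametrization `(η, t) ↦ τ(η, t)`. -/
def hplaneMeasure (n : ℕ) : Measure (Hyperplane n) :=
  Measure.map (fun p : USphere n × ℝ => hplane p.1 p.2)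
    ((((surf n) Set.univ)⁻¹ • surf n).prod (volume : Measure ℝ))

/-- `|τ|`, the Euclidean distance between the hyperplane `τ` and the origin. -/
def hdist {n : ℕ} (τ : Hyperplane n) : ℝ := Metric.infDist 0 τ.1

theorem hplane_neg_neg {n : ℕ} (η : USphere n) (t : ℝ) : hplane (-η) (-t) = hplane η t := by
  apply Subtype.ext
  ext x
  simp [hplane, inner_neg_right]

/-- The reflected hyperplane `-τ = {x | -x ∈ τ}`. -/
def hneg {n : ℕ} (τ : Hyperplane n) : Hyperplane n :=
  ⟨{x | -x ∈ τ.1}, by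
    obtain ⟨s, η, t, rfl⟩ := τ
    refine ⟨-η, t, ?_⟩
    ext x
    simp [inner_neg_left, inner_neg_right]⟩

theorem exists_param {n : ℕ} (τ : Hyperplane n) :
    ∃ p : USphere n × ℝ, 0 ≤ p.2 ∧ τ = hplane p.1 p.2 := by
  obtain ⟨s, η, t, rfl⟩ := τ
  rcases le_total 0 t with ht | ht
  · exact ⟨(η, t), ht, rfl⟩
  · exact ⟨(-η, -t), by simpa using ht, (hplane_neg_neg η t).symm⟩

/-! Coordinates in `E (n + 1)`. -/

/-- `θ' = (θ_1, …, θ_n)` for `θ = (θ_1, …, θ_{n+1})`. -/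
def headPt {n : ℕ} (θ : E (n + 1)) : E n := WithLp.toLp 2 fun i => θ i.castSucc

/-- `θ_{n+1}`. -/
def lastCoord {n : ℕ} (θ : E (n + 1)) : ℝ := θ (Fin.last n)

/-- The vector `x + a e_{n+1}`. -/
def joinPt {n : ℕ} (x : E n) (a : ℝ) : E (n + 1) :=
  WithLp.toLp 2 (Fin.snoc (α := fun _ => ℝ) (fun i => x i) a)

/-- The normal vector `μ̃(τ) = -η cos α + e_{n+1} sin α`, `tan α = t`, where `τ = τ(η, t)` with
`t ≥ 0`. The pair `(η, t)` is determined by `τ` unless `t = 0`, and then `η` is determined up to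
sign. -/
def muTilde {n : ℕ} (τ : Hyperplane n) : E (n + 1) :=
  let p := Classical.choose (exists_param τ)
  joinPt (-(Real.cos (Real.arctan p.2) • (p.1 : E n))) (Real.sin (Real.arctan p.2))

section Operators

variable {𝕜 : Type*} [RCLike 𝕜] {n : ℕ}

/-- The value of a function `f` on the unit sphere at a unit vector `v`
(and `0` if `v` is not a unit vector). -/
def valAt {m : ℕ} (f : USphere m → 𝕜) (v : E m) : 𝕜 :=
  open Classical in
  if hv : v ∈ Metric.sphere (0 : E m) 1 then f ⟨v, hv⟩ else 0

/-- `h(η, t) = h(τ(η, t))` for a unit vector `η` (and `0` if `η` is not a unit vector). -/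
def hVal (h : Hyperplane n → 𝕜) (η : E n) (t : ℝ) : 𝕜 :=
  valAt (fun ζ : USphere n => h (hplane ζ t)) η

/-- The dual hyperplane Radon transform
`(R^* h)(x) = σ_{n-1}⁻¹ ∫_{S^{n-1}} h(η, x · η) dη`. -/
def Rstar (h : Hyperplane n → 𝕜) (x : E n) : 𝕜 :=
  (area n)⁻¹ • ∫ η : USphere n, h (hplane η (inner ℝ x (η : E n))) ∂(surf n)

/-- The unit sphere of the subspace `θ^⊥`, that is, `S^n ∩ θ^⊥`. -/
abbrev PerpSphere (θ : E (n + 1)) := Metric.sphere (0 : (ℝ ∙ θ)ᗮ) 1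

/-- The surface measure on `S^n ∩ θ^⊥` (`θ^⊥` carries its Euclidean volume). -/
def perpSurf (θ : E (n + 1)) : Measure (PerpSphere θ) :=
  ((stdOrthonormalBasis ℝ (ℝ ∙ θ)ᗮ).toBasis.addHaar).toSphere

/-- A point of `S^n ∩ θ^⊥` as a vector. -/
abbrev perpVec {θ : E (n + 1)} (y : PerpSphere θ) : E (n + 1) := ((y : (ℝ ∙ θ)ᗮ) : E (n + 1))

/-- The Funk transform: `(F f)(θ)` is the mean value of `f` over `S^n ∩ θ^⊥`. -/
def funk (f : USphere (n + 1) → 𝕜) (θ : USphere (n + 1)) : 𝕜 :=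
  ⨍ y : PerpSphere (θ : E (n + 1)), valAt f (perpVec y) ∂(perpSurf (θ : E (n + 1)))

/-- The integral defining `(F f)(θ)` exists in the Lebesgue sense. -/
def FunkExistsAt (f : USphere (n + 1) → 𝕜) (θ : E (n + 1)) : Prop :=
  Integrable (fun y : PerpSphere θ => valAt f (perpVec y)) (perpSurf θ)

/-- `f ∈ L^1_even(S^n)`. -/
def MemL1Even (f : USphere (n + 1) → 𝕜) : Prop :=
  Integrable f (surf (n + 1)) ∧ ∀ᵐ θ : USphere (n + 1) ∂(surf (n + 1)), f (-θ) = f θ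

/-- The point `(-x + e_{n+1}) / √(1 + |x|²)` of the sphere `S^n`. -/
def omegaPt (x : E n) : E (n + 1) := (√(1 + ‖x‖ ^ 2))⁻¹ • joinPt (-x) 1

/-- `(A_* f)(x) = (1 + |x|²)^{-1/2} f((-x + e_{n+1}) / √(1 + |x|²))`. -/
def Astar (f : USphere (n + 1) → 𝕜) (x : E n) : 𝕜 :=
  (√(1 + ‖x‖ ^ 2))⁻¹ • valAt f (omegaPt x)

/-- `(B_* h)(θ) = |θ'|^{-n} h(θ' / |θ'|, θ_{n+1} / |θ'|)` for `|θ'| ≠ 0`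
(the value at the two poles `θ' = 0` is irrelevant and equals `0`). -/
def Bstar (h : Hyperplane n → 𝕜) (θ : USphere (n + 1)) : 𝕜 :=
  (‖headPt (θ : E (n + 1))‖ ^ n)⁻¹ •
    hVal h (‖headPt (θ : E (n + 1))‖⁻¹ • headPt (θ : E (n + 1)))
      (lastCoord (θ : E (n + 1)) / ‖headPt (θ : E (n + 1))‖)

/-- `(A_*⁻¹ g)(θ) = |θ_{n+1}|⁻¹ g(-θ' / θ_{n+1})` for `θ_{n+1} ≠ 0`. -/
def AstarInv (g : E n → 𝕜) (θ : USphere (n + 1)) : 𝕜 :=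
  |lastCoord (θ : E (n + 1))|⁻¹ • g (-((lastCoord (θ : E (n + 1)))⁻¹ • headPt (θ : E (n + 1))))

/-- `(B_*⁻¹ f)(τ) = (1 + |τ|²)^{-n/2} f(μ̃(-τ))`. -/
def BstarInv (f : USphere (n + 1) → 𝕜) (τ : Hyperplane n) : 𝕜 :=
  ((1 + hdist τ ^ 2) ^ (-(n : ℝ) / 2)) • valAt f (muTilde (hneg τ))

/-! The inverse Funk transform. -/

/-- `Φ_θ(s) = σ_{n-1}⁻¹ ∫_{S^n ∩ θ^⊥} φ(s σ + √(1 - s²) θ) dσ`. -/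
def funkMean (φ : USphere (n + 1) → 𝕜) (θ : USphere (n + 1)) (s : ℝ) : 𝕜 :=
  (area n)⁻¹ • ∫ y : PerpSphere (θ : E (n + 1)),
    valAt φ (s • perpVec y + √(1 - s ^ 2) • (θ : E (n + 1))) ∂(perpSurf (θ : E (n + 1)))

/-- `(t² - s²)^{(n-3)/2} Φ_θ(s) s`. -/
def funkIntegrand (φ : USphere (n + 1) → 𝕜) (θ : USphere (n + 1)) (t s : ℝ) : 𝕜 :=
  ((t ^ 2 - s ^ 2) ^ (((n : ℝ) - 3) / 2) * s) • funkMean φ θ s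

/-- `(1 / (n-2)!) ∫_0^t (t² - s²)^{(n-3)/2} Φ_θ(s) s ds`. -/
def funkPrim (φ : USphere (n + 1) → 𝕜) (θ : USphere (n + 1)) (t : ℝ) : 𝕜 :=
  ((Nat.factorial (n - 2) : ℝ))⁻¹ • ∫ s in (0 : ℝ)..t, funkIntegrand φ θ t s

/-- `(∂/∂t)^{n-1} [ (1 / (n-2)!) ∫_0^t (t² - s²)^{(n-3)/2} Φ_θ(s) s ds ]`. -/
def funkApprox (φ : USphere (n + 1) → 𝕜) (t : ℝ) (θ : USphere (n + 1)) : 𝕜 :=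
  iteratedDeriv (n - 1) (funkPrim φ θ) t

/-- `f ∈ L^1_even(S^n)` is given by the inversion formula
`f(θ) = lim_{t → 1} (∂/∂t)^{n-1} [ (1 / (n-2)!) ∫_0^t (t² - s²)^{(n-3)/2} Φ_θ(s) s ds ]`,
where the integrals exist in the Lebesgue sense, the derivatives exist
(the one of highest order almost everywhere), and the limit is taken in the `L^1`-norm. -/
structure IsFunkInverse (φ f : USphere (n + 1) → 𝕜) : Prop where
  memL1Even : MemL1Even f
  mean_exists : ∀ᵐ θ : USphere (n + 1) ∂(surf (n + 1)), ∀ᵐ s : ℝ, s ∈ Set.Ioo (0 : ℝ) 1 →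
    Integrable (fun y : PerpSphere (θ : E (n + 1)) =>
      valAt φ (s • perpVec y + √(1 - s ^ 2) • (θ : E (n + 1)))) (perpSurf (θ : E (n + 1)))
  integral_exists : ∀ᵐ θ : USphere (n + 1) ∂(surf (n + 1)), ∀ t ∈ Set.Ioo (0 : ℝ) 1,
    IntervalIntegrable (funkIntegrand φ θ t) volume 0 t
  contDiffOn : ∀ᵐ θ : USphere (n + 1) ∂(surf (n + 1)),
    ContDiffOn ℝ ((n - 2 : ℕ) : WithTop ℕ∞) (funkPrim φ θ) (Set.Ioo 0 1)
  differentiable : ∀ᵐ θ : USphere (n + 1) ∂(surf (n + 1)), ∀ᵐ t : ℝ, t ∈ Set.Ioo (0 : ℝ) 1 →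
    DifferentiableAt ℝ (iteratedDeriv (n - 2) (funkPrim φ θ)) t
  approx_integrable : ∀ᵐ t : ℝ, t ∈ Set.Ioo (0 : ℝ) 1 →
    Integrable (funkApprox φ t) (surf (n + 1))
  limit : Tendsto (fun t => eLpNorm (fun θ => funkApprox φ t θ - f θ) 1 (surf (n + 1)))
    (𝓝[<] (1 : ℝ) ⊓ ae volume) (𝓝 0)

/-- The inverse Funk transform `F⁻¹ φ`, evaluated by the inversion formula. As a limit in `L^1` it
is determined up to a set of measure zero. (It is `0` if the limit does not exist.) -/
def funkInv (φ : USphere (n + 1) → 𝕜) : USphere (n + 1) → 𝕜 :=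
  open Classical in
  if hφ : ∃ f, IsFunkInverse φ f then Classical.choose hφ else 0

end Operators

end DualRadon

end

open DualRadon

/-! Identity `R^* = A_* F B_*`. The great subsphere orthogonal to `ω = (-x + e_{n+1}) / √(1 + |x|²)`
is the unit sphere of the graph of the linear function `y ↦ x · y`. Central projection sends `η` in
`S^{n-1}` to `(η, x · η)` divided by its length, and pulls the surface measure back to `√(1 + |x|²)
|(η, x · η)|^{-n} dη`. The factor `|θ'|^{-n}` in `B_*` cancels the second factor and the prefactor
of `A_*` cancels the first (`map_perpSurf_omegaPt`, `Rstar_eq_Astar`). In the coordinates `(η, t) ↦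
(η, t) / √(1 + t²)` the surface measure of `S^n` is `(1 + t²)^{-(n+1)/2} dη dt`, so the weighted
integrability of `h` gives the integrability of `B_* h` (`memL1Even_Bstar`).

Inversion of `F`. Let `M_θ f(u)` be the mean of `f` over `{v : v · θ = u}`. The pairs `(v, w)` of
orthonormal vectors carry an invariant measure which the swap preserves, so `F` is self-adjoint. It
is applied to a zonal weight `w_t(v · θ)` chosen so that, after slicing the sphere around `θ`, its
integral against `φ = F f` is, up to a constant, `∫_0^t (t² - s²)^{(n-3)/2} Φ_θ(s) s ds`. The Funk
transform of the weight is explicit, `½ (t - |p|)_+^{n-2} (1 - p²)^{-(n-2)/2}`, by a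
Cauchy–Schlömilch substitution (`lintegral_kernel`). Slicing the other side and using that `f` is
even gives `∫_0^t (t - p)^{n-2} M_θ f(p) dp` with the same constant (`integral_funkIntegrand`).

Up to `(n-2)!` this is a repeated integral of `M_θ f`. It is of class `C^{n-2}`, and its derivative
of order `n-1` is `M_θ f(t)` for almost every `t` by Lebesgue differentiation. The operators `f ↦
M_θ f(u)` are contractions of `L^1` (again by invariance of the measure on pairs) and converge
uniformly to the identity on uniformly continuous functions as `u → 1`. Hence `M_θ f(t) → f(θ)` in
`L^1` (`tendsto_sliceMean`).

Uniqueness. The inversion formula involves only `φ`, so two even integrable solutions of `F f = φ`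
are limits of the same functions (`isFunkInverse_of_ae_eq_funk`, `IsFunkInverse.ae_unique`). -/

noncomputable section

namespace DualRadon

open Set Module
open scoped ENNReal

/-! ### Polar coordinates and integrals over the unit sphere -/

section SphereMeasure

variable (V : Type*) [NormedAddCommGroup V] [InnerProductSpace ℝ V] [FiniteDimensional ℝ V]
  [MeasurableSpace V] [BorelSpace V]

/-- The surface measure of the unit sphere, as a measure on the ambient space. -/
def sph : Measure V := ((volume : Measure V).toSphere).map Subtype.val

instance : IsFiniteMeasure (sph V) := by unfold sph; infer_instance

/-- The radial cut-off: the indicator function of `(-∞, 1)`. -/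
def cutoff (r : ℝ) : ℝ≥0∞ := (Iio (1 : ℝ)).indicator 1 r

lemma measurable_cutoff : Measurable cutoff :=
  measurable_one.indicator measurableSet_Iio

/-- `∫_0^1 r^k dr`. -/
def radialConst (k : ℕ) : ℝ≥0∞ := ∫⁻ r in Ioi (0 : ℝ), ENNReal.ofReal (r ^ k) * cutoff r

lemma radialConst_ne_zero (k : ℕ) : radialConst k ≠ 0 := by
  unfold radialConst
  rw [← lintegral_indicator measurableSet_Ioi, ← pos_iff_ne_zero, lintegral_pos_iff_support]
  · refine lt_of_lt_of_le (b := volume (Ioo (0 : ℝ) 1)) (by simp) (measure_mono ?_)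
    intro r hr
    have : 0 < r ^ k := pow_pos hr.1 k
    simp [cutoff, indicator, hr.1, hr.2, this]
  · refine Measurable.indicator ?_ measurableSet_Ioi
    exact (by fun_prop : Measurable fun r : ℝ => ENNReal.ofReal (r ^ k)).mul measurable_cutoff

lemma radialConst_ne_top (k : ℕ) : radialConst k ≠ ∞ := by
  unfold radialConst
  refine ne_of_lt (lt_of_le_of_lt (b := ∫⁻ r in Ioi (0 : ℝ), (Ioo (0 : ℝ) 1).indicator 1 r) ?_ ?_)
  · refine setLIntegral_mono' measurableSet_Ioi fun r hr => ?_
    by_cases h1 : r < 1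
    · have h2 : r ^ k ≤ 1 := pow_le_one₀ (le_of_lt hr) h1.le
      simpa [cutoff, indicator, h1, mem_Ioi.1 hr] using h2
    · simp [cutoff, indicator, h1]
  · refine lt_of_le_of_lt (setLIntegral_le_lintegral _ _) ?_
    rw [lintegral_indicator_one measurableSet_Ioo]
    simp

lemma lintegral_comp_mul_left (f : ℝ → ℝ≥0∞) {a : ℝ} (ha : 0 < a) :
    ∫⁻ x, f x = ENNReal.ofReal a * ∫⁻ x, f (a * x) := by
  have h := Real.smul_map_volume_mul_left ha.ne'
  conv_lhs => rw [← h]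
  rw [lintegral_smul_measure, abs_of_pos ha, smul_eq_mul]
  congr 1
  exact (Homeomorph.mulLeft₀ a ha.ne').measurableEmbedding.lintegral_map f

lemma setLIntegral_Ioi_comp_mul_left (f : ℝ → ℝ≥0∞) {a : ℝ} (ha : 0 < a) :
    ∫⁻ x in Ioi 0, f x = ENNReal.ofReal a * ∫⁻ x in Ioi 0, f (a * x) := by
  rw [← lintegral_indicator measurableSet_Ioi, ← lintegral_indicator measurableSet_Ioi,
    lintegral_comp_mul_left _ ha]
  congr 2
  ext x
  simp [indicator, ha]

/-- Scaling of the radial integral. When a sphere is parametrized by points of norm `a ≠ 1`, the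
power `a^{-(k+1)}` produced here is the Jacobian of the radial projection. -/
lemma lintegral_pow_mul_cutoff (k : ℕ) {a : ℝ} (ha : 0 < a) :
    ∫⁻ r in Ioi (0 : ℝ), ENNReal.ofReal (r ^ k) * cutoff (r * a) =
      ENNReal.ofReal ((a ^ (k + 1))⁻¹) * radialConst k := by
  rw [setLIntegral_Ioi_comp_mul_left _ (inv_pos.2 ha), radialConst]
  have : ∀ x : ℝ, a⁻¹ * x * a = x := fun x => by field_simp
  simp_rw [this, mul_pow, ENNReal.ofReal_mul (pow_nonneg (inv_pos.2 ha).le k), mul_assoc]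
  rw [lintegral_const_mul' _ _ ENNReal.ofReal_ne_top, ← mul_assoc,
    ← ENNReal.ofReal_mul (inv_pos.2 ha).le, ← pow_succ', inv_pow]

variable {V}

lemma lintegral_polar [Nontrivial V] {F : V → ℝ≥0∞} (hF : Measurable F) :
    ∫⁻ v, F v = ∫⁻ y, (∫⁻ r in Ioi (0 : ℝ),
      ENNReal.ofReal (r ^ (finrank ℝ V - 1)) * F (r • y)) ∂sph V := by
  have hm : MeasurableSet ({0}ᶜ : Set V) := (measurableSet_singleton _).compl
  have key := (volume : Measure V).measurePreserving_homeomorphUnitSphereProd.lintegral_comp_emb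
    (Homeomorph.measurableEmbedding _) (fun p => F ((p.2 : ℝ) • (p.1 : V)))
  have h1 : ∀ v : ({0}ᶜ : Set V), ((homeomorphUnitSphereProd V v).2 : ℝ) •
      ((homeomorphUnitSphereProd V v).1 : V) = v := fun v => by
    have : ‖(v : V)‖ ≠ 0 := norm_ne_zero_iff.2 v.2
    simp [smul_smul, this]
  simp_rw [h1] at key
  rw [lintegral_subtype_comap hm F, restrict_compl_singleton] at key
  have hmeas : Measurable fun p : Metric.sphere (0 : V) 1 × Ioi (0 : ℝ) =>
      F ((p.2 : ℝ) • (p.1 : V)) := hF.comp (by fun_prop)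
  rw [key, lintegral_prod _ hmeas.aemeasurable, sph, lintegral_map]
  · refine lintegral_congr fun y => ?_
    rw [Measure.volumeIoiPow, lintegral_withDensity_eq_lintegral_mul]
    · exact lintegral_subtype_comap measurableSet_Ioi
        (fun r : ℝ => ENNReal.ofReal (r ^ (finrank ℝ V - 1)) * F (r • (y : V)))
    · fun_prop
    · exact hF.comp (by fun_prop)
  · refine Measurable.lintegral_prod_right' (f := fun p : V × ℝ =>
      ENNReal.ofReal (p.2 ^ (finrank ℝ V - 1)) * F (p.2 • p.1)) ?_
    exact (by fun_prop : Measurable fun p : V × ℝ =>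
      ENNReal.ofReal (p.2 ^ (finrank ℝ V - 1))).mul (hF.comp (by fun_prop))
  · exact measurable_subtype_coe

lemma ae_norm_sph : ∀ᵐ y ∂sph V, ‖y‖ = 1 := by
  rw [sph, ae_map_iff measurable_subtype_coe.aemeasurable
    (measurableSet_eq_fun measurable_norm measurable_const)]
  exact Eventually.of_forall fun y => by simp

/-- Polar coordinates applied to the extension of `g` homogeneous of degree zero, cut off to the
unit ball. Changes of variables on spheres thereby reduce to linear ones in the ambient space; the
constant cancels because it is neither zero nor infinite. -/
lemma lintegral_sph_mul_radialConst [Nontrivial V] {g : V → ℝ≥0∞} (hg : Measurable g) :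
    (∫⁻ y, g y ∂sph V) * radialConst (finrank ℝ V - 1) =
      ∫⁻ v : V, g (‖v‖⁻¹ • v) * cutoff ‖v‖ := by
  rw [lintegral_polar, ← lintegral_mul_const _ hg]
  · refine lintegral_congr_ae ?_
    filter_upwards [ae_norm_sph (V := V)] with y hy
    rw [radialConst, ← lintegral_const_mul _]
    · refine setLIntegral_congr_fun measurableSet_Ioi fun r hr => ?_
      have hr' : 0 < r := hr
      simp only [norm_smul, hy, mul_one, Real.norm_eq_abs, abs_of_pos hr', smul_smul,
        inv_mul_cancel₀ hr'.ne', one_smul]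
      ring
    · exact (by fun_prop : Measurable fun r : ℝ => ENNReal.ofReal (r ^ _)).mul measurable_cutoff
  · exact (hg.comp (by fun_prop)).mul (measurable_cutoff.comp (by fun_prop))

/-- The surface measure of a sphere in the coordinates given by the tangent cylinder. -/
lemma lintegral_sph_eq_tangent [Nontrivial V] {H : Type*} [NormedAddCommGroup H]
    [InnerProductSpace ℝ H] [FiniteDimensional ℝ H] [MeasurableSpace H] [BorelSpace H]
    [Nontrivial H] (θ : V) (j : H →ₗᵢ[ℝ] V)
    (hθ : ‖θ‖ = 1) (horth : ∀ y, inner ℝ θ (j y) = 0)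
    (hdim : finrank ℝ V = finrank ℝ H + 1)
    (hvol : MeasurePreserving (fun p : ℝ × H => p.1 • θ + j p.2))
    {g : V → ℝ≥0∞} (hg : Measurable g) :
    ∫⁻ v, g v ∂sph V = ∫⁻ y, (∫⁻ τ : ℝ, ENNReal.ofReal ((√(1 + τ ^ 2) ^ finrank ℝ V)⁻¹) *
      g ((√(1 + τ ^ 2))⁻¹ • (τ • θ + j y))) ∂sph H := by
  have hpos : 0 < finrank ℝ H := finrank_pos
  obtain ⟨k, hk⟩ : ∃ k, finrank ℝ H = k + 1 := ⟨_, (Nat.succ_pred_eq_of_pos hpos).symm⟩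
  have hnorm : ∀ (y : H), ‖y‖ = 1 → ∀ τ : ℝ, ‖τ • θ + j y‖ = √(1 + τ ^ 2) := fun y hy τ => by
    rw [← Real.sqrt_sq (norm_nonneg _)]
    congr 1
    rw [norm_add_sq_real, inner_smul_left, horth, norm_smul, hθ, j.norm_map, hy]
    simp; ring
  have hj : Measurable j := j.continuous.measurable
  have hG : Measurable fun v : V => g (‖v‖⁻¹ • v) * cutoff ‖v‖ :=
    (hg.comp (by fun_prop)).mul (measurable_cutoff.comp (by fun_prop))
  set G := fun v : V => g (‖v‖⁻¹ • v) * cutoff ‖v‖ with hGdef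
  -- After multiplication by the radial constant the left side is a volume integral over `V`. It is
  -- split along `ℝ θ` and `j H`, and polar coordinates are used in `H` alone.
  rw [← ENNReal.mul_left_inj (radialConst_ne_zero (finrank ℝ V - 1))
    (radialConst_ne_top (finrank ℝ V - 1)), lintegral_sph_mul_radialConst hg,
    ← hvol.lintegral_comp hG, Measure.volume_eq_prod,
    lintegral_prod_symm (fun p : ℝ × H => G (p.1 • θ + j p.2))
      (hG.comp hvol.measurable).aemeasurable, lintegral_polar]
  rotate_left
  · exact Measurable.lintegral_prod_left' (f := fun p : ℝ × H => G (p.1 • θ + j p.2))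
      (hG.comp hvol.measurable)
  have hinner : Measurable fun p : H × ℝ => ENNReal.ofReal ((√(1 + p.2 ^ 2) ^ finrank ℝ V)⁻¹) *
      g ((√(1 + p.2 ^ 2))⁻¹ • (p.2 • θ + j p.1)) := by
    refine Measurable.mul (by fun_prop) (hg.comp ?_)
    fun_prop
  have hinner' : ∀ y : H, Measurable fun τ : ℝ =>
      ENNReal.ofReal ((√(1 + τ ^ 2) ^ finrank ℝ V)⁻¹) *
        g ((√(1 + τ ^ 2))⁻¹ • (τ • θ + j y)) := fun y =>
    Measurable.mul (by fun_prop) (hg.comp (by fun_prop))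
  rw [← lintegral_mul_const _ (Measurable.lintegral_prod_right' hinner)]
  refine lintegral_congr_ae ?_
  filter_upwards [ae_norm_sph (V := H)] with y hy
  -- The substitution `u = r τ` makes the point `u θ + r j y` equal to `r (τ θ + j y)`; Tonelli then
  -- lets the radial integral be evaluated first.
  have e1 : ∀ r ∈ Ioi (0 : ℝ), ENNReal.ofReal (r ^ (finrank ℝ H - 1)) *
      ∫⁻ u : ℝ, G (u • θ + j (r • y)) = ∫⁻ τ : ℝ, ENNReal.ofReal (r ^ (finrank ℝ V - 1)) *
        (g ((√(1 + τ ^ 2))⁻¹ • (τ • θ + j y)) * cutoff (r * √(1 + τ ^ 2))) := fun r hr => by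
    have hr' : 0 < r := hr
    rw [lintegral_comp_mul_left _ hr', ← mul_assoc,
      ← ENNReal.ofReal_mul (pow_nonneg hr'.le _), ← pow_succ,
      show finrank ℝ H - 1 + 1 = finrank ℝ V - 1 by omega,
      ← lintegral_const_mul' _ _ ENNReal.ofReal_ne_top]
    refine lintegral_congr fun τ => ?_
    have e2 : (r * τ) • θ + j (r • y) = r • (τ • θ + j y) := by
      simp [smul_add, smul_smul]
    have e3 : ‖r • (τ • θ + j y)‖ = r * √(1 + τ ^ 2) := by
      rw [norm_smul, hnorm y hy, Real.norm_of_nonneg hr'.le]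
    simp only [hGdef, e2, e3, smul_smul]
    congr 4
    rw [mul_inv]
    field_simp
  rw [setLIntegral_congr_fun measurableSet_Ioi e1, lintegral_lintegral_swap,
    ← lintegral_mul_const _ (hinner' y)]
  · refine lintegral_congr fun τ => ?_
    have hs : 0 < √(1 + τ ^ 2) := Real.sqrt_pos.2 (by positivity)
    have e4 : ∀ r : ℝ, ENNReal.ofReal (r ^ (finrank ℝ V - 1)) *
        (g ((√(1 + τ ^ 2))⁻¹ • (τ • θ + j y)) * cutoff (r * √(1 + τ ^ 2))) =
        g ((√(1 + τ ^ 2))⁻¹ • (τ • θ + j y)) *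
        (ENNReal.ofReal (r ^ (finrank ℝ V - 1)) * cutoff (r * √(1 + τ ^ 2))) := fun r => by ring
    simp_rw [e4]
    rw [lintegral_const_mul, lintegral_pow_mul_cutoff _ hs,
      show finrank ℝ V - 1 + 1 = finrank ℝ V by omega]
    · ring
    · exact Measurable.mul (by fun_prop) (measurable_cutoff.comp (by fun_prop))
  · have hm : Measurable fun p : ℝ × ℝ => ENNReal.ofReal (p.1 ^ (finrank ℝ V - 1)) *
        (g ((√(1 + p.2 ^ 2))⁻¹ • (p.2 • θ + j y)) * cutoff (p.1 * √(1 + p.2 ^ 2))) := by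
      refine Measurable.mul (by fun_prop) (Measurable.mul (hg.comp ?_)
        (measurable_cutoff.comp (by fun_prop)))
      fun_prop
    exact hm.aemeasurable

end SphereMeasure

/-! ### The sphere in tangent-cylinder and slice coordinates -/

section Slicing

/-- The density of the surface measure in the coordinates given by the tangent cylinder. -/
def tangentMeas (d : ℕ) : Measure ℝ :=
  volume.withDensity fun τ => ENNReal.ofReal ((√(1 + τ ^ 2) ^ d)⁻¹)

/-- The density `(1 - u²)^{(d-3)/2}` of a coordinate on the unit sphere of dimension `d - 1`. -/
def sliceMeas (d : ℕ) : Measure ℝ :=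
  (volume.restrict (Ioo (-1) 1)).withDensity
    fun u => ENNReal.ofReal ((1 - u ^ 2) ^ (((d : ℝ) - 3) / 2))

instance (d : ℕ) : SFinite (tangentMeas d) := by unfold tangentMeas; infer_instance

instance (d : ℕ) : SFinite (sliceMeas d) := by unfold sliceMeas; infer_instance

lemma one_sub_sq_pos {u : ℝ} (hu : u ∈ Ioo (-1 : ℝ) 1) : 0 < 1 - u ^ 2 := by
  nlinarith [hu.1, hu.2]

lemma measurable_sliceDensity (d : ℕ) :
    Measurable fun u : ℝ => ENNReal.ofReal ((1 - u ^ 2) ^ (((d : ℝ) - 3) / 2)) := by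
  fun_prop

lemma lintegral_sliceMeas (d : ℕ) {g : ℝ → ℝ≥0∞} (hg : Measurable g) :
    ∫⁻ u, g u ∂sliceMeas d =
      ∫⁻ u in Ioo (-1) 1, ENNReal.ofReal ((1 - u ^ 2) ^ (((d : ℝ) - 3) / 2)) * g u := by
  rw [sliceMeas, lintegral_withDensity_eq_lintegral_mul _ (measurable_sliceDensity d) hg]
  rfl

lemma sqrt_one_add_div_sq {u : ℝ} (hu : u ∈ Ioo (-1 : ℝ) 1) :
    √(1 + (u / √(1 - u ^ 2)) ^ 2) = (√(1 - u ^ 2))⁻¹ := by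
  have h := one_sub_sq_pos hu
  rw [← Real.sqrt_inv, div_pow, Real.sq_sqrt h.le]
  congr 1
  field_simp
  ring

/-- The inverse substitution is `τ = u / √(1 - u²)`, for which `1 + τ² = (1 - u²)⁻¹` and `dτ = (1 -
u²)^{-3/2} du`; the exponent becomes `d/2 - 3/2`. -/
lemma map_tangentMeas (d : ℕ) :
    (tangentMeas d).map (fun τ => τ / √(1 + τ ^ 2)) = sliceMeas d := by
  refine Measure.ext_of_lintegral _ fun g hg => ?_
  have hm : Measurable fun τ : ℝ => τ / √(1 + τ ^ 2) := by fun_prop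
  rw [lintegral_map hg hm, lintegral_sliceMeas d hg, tangentMeas,
    lintegral_withDensity_eq_lintegral_mul _ (by fun_prop) (hg.fun_comp hm)]
  have himg : (fun u : ℝ => u / √(1 - u ^ 2)) '' Ioo (-1) 1 = univ := by
    refine eq_univ_of_forall fun τ => ⟨τ / √(1 + τ ^ 2), ?_, ?_⟩
    · have h1 : |τ| < √(1 + τ ^ 2) := by
        rw [← Real.sqrt_sq_eq_abs]
        exact Real.sqrt_lt_sqrt (sq_nonneg _) (by linarith)
      have h2 : |τ / √(1 + τ ^ 2)| < 1 := by
        rw [abs_div, abs_of_nonneg (Real.sqrt_nonneg _)]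
        exact (div_lt_one (lt_of_le_of_lt (abs_nonneg _) h1)).2 h1
      exact abs_lt.1 h2
    · have h0 : (0 : ℝ) < 1 + τ ^ 2 := by positivity
      have h1 : 1 - (τ / √(1 + τ ^ 2)) ^ 2 = (1 + τ ^ 2)⁻¹ := by
        rw [div_pow, Real.sq_sqrt h0.le]; field_simp; ring
      simp only [h1, Real.sqrt_inv]
      have := (Real.sqrt_pos.2 h0).ne'
      field_simp
  have hderiv : ∀ u ∈ Ioo (-1 : ℝ) 1, HasDerivWithinAt (fun u : ℝ => u / √(1 - u ^ 2))
      ((√(1 - u ^ 2) ^ 3)⁻¹) (Ioo (-1) 1) u := fun u hu => by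
    have h := one_sub_sq_pos hu
    have hs := Real.sqrt_pos.2 h
    have h1 : HasDerivAt (fun u : ℝ => 1 - u ^ 2) (-(2 * u)) u := by
      simpa using ((hasDerivAt_id u).pow 2).const_sub 1
    have h2 := (hasDerivAt_id u).div (h1.sqrt h.ne') hs.ne'
    refine h2.hasDerivWithinAt.congr_deriv ?_
    have h3 := Real.sq_sqrt h.le
    simp only [id]
    field_simp
    rw [h3]
    ring
  have hinj : InjOn (fun u : ℝ => u / √(1 - u ^ 2)) (Ioo (-1) 1) := by
    have : LeftInvOn (fun τ : ℝ => τ / √(1 + τ ^ 2)) (fun u : ℝ => u / √(1 - u ^ 2))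
        (Ioo (-1) 1) := fun u hu => by
      have := (Real.sqrt_pos.2 (one_sub_sq_pos hu)).ne'
      change u / √(1 - u ^ 2) / √(1 + (u / √(1 - u ^ 2)) ^ 2) = u
      rw [sqrt_one_add_div_sq hu]
      field_simp
    exact this.injOn
  rw [← setLIntegral_univ, ← himg, lintegral_image_eq_lintegral_abs_deriv_mul measurableSet_Ioo
    hderiv hinj]
  refine setLIntegral_congr_fun measurableSet_Ioo fun u hu => ?_
  have hs := Real.sqrt_pos.2 (one_sub_sq_pos hu)
  simp only [Pi.mul_apply, sqrt_one_add_div_sq hu]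
  rw [← mul_assoc, ← ENNReal.ofReal_mul (abs_nonneg _)]
  congr 2
  · rw [abs_of_pos (by positivity)]
    set w := √(1 - u ^ 2) with hw
    rw [← Real.sq_sqrt (one_sub_sq_pos hu).le, ← hw, ← Real.rpow_natCast w 2,
      ← Real.rpow_mul hs.le, show ((2 : ℕ) : ℝ) * (((d : ℝ) - 3) / 2) = (d : ℝ) - (3 : ℕ) by
        push_cast; ring, Real.rpow_sub hs, Real.rpow_natCast, Real.rpow_natCast, inv_pow, inv_inv]
    field_simp
  · field_simp

variable {V : Type*} [NormedAddCommGroup V] [InnerProductSpace ℝ V] [FiniteDimensional ℝ V]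
  [MeasurableSpace V] [BorelSpace V]
  {H : Type*} [NormedAddCommGroup H] [InnerProductSpace ℝ H] [FiniteDimensional ℝ H]
  [MeasurableSpace H] [BorelSpace H]

/-- The map is a linear isometry once `ℝ × H` carries the Euclidean product norm, and the passage to
that norm preserves volume. -/
lemma measurePreserving_smul_add (θ : V) (j : H →ₗᵢ[ℝ] V) (hθ : ‖θ‖ = 1)
    (horth : ∀ y, inner ℝ θ (j y) = 0) (hdim : finrank ℝ V = finrank ℝ H + 1) :
    MeasurePreserving (fun p : ℝ × H => p.1 • θ + j p.2) := by
  let L : WithLp 2 (ℝ × H) →ₗ[ℝ] V :=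
    ((LinearMap.toSpanSingleton ℝ V θ).coprod j.toLinearMap) ∘ₗ
      (WithLp.linearEquiv 2 ℝ (ℝ × H)).toLinearMap
  have hL : ∀ p, L p = p.fst • θ + j p.snd := fun p => rfl
  let I : WithLp 2 (ℝ × H) →ₗᵢ[ℝ] V := ⟨L, fun p => by
    rw [hL, ← sq_eq_sq₀ (norm_nonneg _) (norm_nonneg _), norm_add_sq_real, inner_smul_left, horth,
      norm_smul, hθ, j.norm_map, WithLp.prod_norm_sq_eq_of_L2]
    simp⟩
  have hfin : finrank ℝ (WithLp 2 (ℝ × H)) = finrank ℝ V := by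
    rw [(WithLp.linearEquiv 2 ℝ (ℝ × H)).finrank_eq, finrank_prod, hdim]
    simp [add_comm]
  exact (I.toLinearIsometryEquiv hfin).measurePreserving.comp
    (WithLp.volume_preserving_toLp ℝ H)

lemma sph_eq_map_tangent [Nontrivial V] [Nontrivial H] (θ : V) (j : H →ₗᵢ[ℝ] V) (hθ : ‖θ‖ = 1)
    (horth : ∀ y, inner ℝ θ (j y) = 0) (hdim : finrank ℝ V = finrank ℝ H + 1) :
    sph V = ((sph H).prod (tangentMeas (finrank ℝ V))).map
      fun p => (√(1 + p.2 ^ 2))⁻¹ • (p.2 • θ + j p.1) := by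
  have hj : Measurable j := j.continuous.measurable
  have hmeas : Measurable fun p : H × ℝ => (√(1 + p.2 ^ 2))⁻¹ • (p.2 • θ + j p.1) := by
    fun_prop
  refine Measure.ext_of_lintegral _ fun g hg => ?_
  rw [lintegral_sph_eq_tangent θ j hθ horth hdim (measurePreserving_smul_add θ j hθ horth hdim) hg,
    lintegral_map hg hmeas, lintegral_prod _ (hg.fun_comp hmeas).aemeasurable]
  refine lintegral_congr fun y => ?_
  rw [tangentMeas, lintegral_withDensity_eq_lintegral_mul _ (by fun_prop)]
  · rfl
  · exact hg.comp (by fun_prop)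

lemma sph_eq_map_slice [Nontrivial V] [Nontrivial H] (θ : V) (j : H →ₗᵢ[ℝ] V) (hθ : ‖θ‖ = 1)
    (horth : ∀ y, inner ℝ θ (j y) = 0) (hdim : finrank ℝ V = finrank ℝ H + 1) :
    sph V = ((sph H).prod (sliceMeas (finrank ℝ V))).map
      fun p => p.2 • θ + √(1 - p.2 ^ 2) • j p.1 := by
  have hj : Measurable j := j.continuous.measurable
  rw [sph_eq_map_tangent θ j hθ horth hdim, ← map_tangentMeas]
  nth_rw 2 [← Measure.map_id (μ := sph H)]
  rw [Measure.map_prod_map _ _ measurable_id (by fun_prop), Measure.map_map (by fun_prop)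
    (by fun_prop)]
  congr 1
  ext1 ⟨y, τ⟩
  have h0 : (0 : ℝ) < 1 + τ ^ 2 := by positivity
  have h1 : 1 - (τ / √(1 + τ ^ 2)) ^ 2 = (1 + τ ^ 2)⁻¹ := by
    rw [div_pow, Real.sq_sqrt h0.le]; field_simp; ring
  simp only [Function.comp, Prod.map, h1, Real.sqrt_inv, smul_add, smul_smul, id]
  congr 2
  ring

end Slicing

/-! ### The orthogonal complement of a unit vector -/

section Orthogonal

variable {V : Type*} [NormedAddCommGroup V] [InnerProductSpace ℝ V]

lemma finrank_orthogonal_span [FiniteDimensional ℝ V] {θ : V} (hθ : ‖θ‖ = 1) :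
    finrank ℝ V = finrank ℝ (ℝ ∙ θ)ᗮ + 1 := by
  have h0 : θ ≠ 0 := norm_ne_zero_iff.1 (by simp [hθ])
  rw [← Submodule.finrank_add_finrank_orthogonal (ℝ ∙ θ), finrank_span_singleton h0, add_comm]

lemma inner_orthogonal_span (θ : V) (y : (ℝ ∙ θ)ᗮ) : inner ℝ θ (y : V) = 0 :=
  Submodule.mem_orthogonal_singleton_iff_inner_right.1 y.2

lemma nontrivial_orthogonal_span [FiniteDimensional ℝ V] {θ : V} (hθ : ‖θ‖ = 1)
    (hV : 2 ≤ finrank ℝ V) : Nontrivial (ℝ ∙ θ)ᗮ := by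
  have := finrank_orthogonal_span hθ
  exact Module.nontrivial_of_finrank_pos (R := ℝ) (by omega)

end Orthogonal

/-! ### Normalized sphere measures and the area of the sphere -/

section Normalized

variable (V : Type*) [NormedAddCommGroup V] [InnerProductSpace ℝ V] [FiniteDimensional ℝ V]
  [MeasurableSpace V] [BorelSpace V]

/-- The invariant probability measure of the unit sphere, as a measure on the ambient space. -/
def usph : Measure V := (sph V univ)⁻¹ • sph V

variable {V}

lemma sph_univ_ne_zero [Nontrivial V] : sph V univ ≠ 0 := by
  rw [sph, Measure.map_apply measurable_subtype_coe .univ, preimage_univ,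
    Measure.measure_univ_ne_zero]
  exact Measure.toSphere_ne_zero _

instance [Nontrivial V] : IsProbabilityMeasure (usph V) :=
  ⟨by rw [usph, Measure.smul_apply, smul_eq_mul,
    ENNReal.inv_mul_cancel sph_univ_ne_zero (measure_ne_top _ _)]⟩

instance : IsFiniteMeasure (usph V) := by
  rcases subsingleton_or_nontrivial V with h | h
  · constructor
    have : sph V = 0 := by
      rw [sph, (Measure.toSphere_eq_zero_iff _).2 h, Measure.map_zero]
    simp [usph, this]
  · infer_instance

lemma ae_norm_usph : ∀ᵐ y ∂usph V, ‖y‖ = 1 :=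
  Measure.ae_smul_measure ae_norm_sph _

lemma sliceMeas_univ_ne_zero (d : ℕ) : sliceMeas d univ ≠ 0 := by
  have h := lintegral_sliceMeas d (g := 1) measurable_one
  simp only [Pi.one_apply, lintegral_one, mul_one] at h
  rw [h, ← lintegral_indicator measurableSet_Ioo, ← pos_iff_ne_zero, lintegral_pos_iff_support]
  · refine lt_of_lt_of_le (b := volume (Ioo (-1 : ℝ) 1)) (by simp) (measure_mono fun u hu => ?_)
    simpa [indicator, hu.1, hu.2] using Real.rpow_pos_of_pos (one_sub_sq_pos hu) _
  · exact (measurable_sliceDensity d).indicator measurableSet_Ioo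

lemma sph_univ_eq_mul [Nontrivial V] {H : Type*} [NormedAddCommGroup H] [InnerProductSpace ℝ H]
    [FiniteDimensional ℝ H] [MeasurableSpace H] [BorelSpace H] [Nontrivial H] (θ : V)
    (j : H →ₗᵢ[ℝ] V) (hθ : ‖θ‖ = 1) (horth : ∀ y, inner ℝ θ (j y) = 0)
    (hdim : finrank ℝ V = finrank ℝ H + 1) :
    sph V univ = sph H univ * sliceMeas (finrank ℝ V) univ := by
  have hj : Measurable j := j.continuous.measurable
  conv_lhs => rw [sph_eq_map_slice θ j hθ horth hdim]
  rw [Measure.map_apply (by fun_prop) .univ, preimage_univ, ← univ_prod_univ, Measure.prod_prod]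

/-- Read off from geometry: the total mass is a factor of the finite area of a sphere, the other
factor being nonzero. -/
lemma sliceMeas_univ_ne_top {d : ℕ} (hd : 2 ≤ d) : sliceMeas d univ ≠ ∞ := by
  have hdim : finrank ℝ (E d) = d := by simp
  have : Nontrivial (E d) := Module.nontrivial_of_finrank_pos (R := ℝ) (by omega)
  obtain ⟨θ, hθ⟩ := exists_norm_eq (E d) (zero_le_one' ℝ)
  have := nontrivial_orthogonal_span hθ (by omega)
  have h := sph_univ_eq_mul θ (ℝ ∙ θ)ᗮ.subtypeₗᵢ hθ (inner_orthogonal_span θ)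
    (finrank_orthogonal_span hθ)
  rw [hdim] at h
  intro htop
  rw [htop, ENNReal.mul_top sph_univ_ne_zero] at h
  exact measure_ne_top _ _ h

/-- The distribution of a coordinate on the unit sphere of dimension `d - 1`. -/
def sliceProb (d : ℕ) : Measure ℝ := (sliceMeas d univ)⁻¹ • sliceMeas d

instance (d : ℕ) : SFinite (sliceProb d) := by unfold sliceProb; infer_instance

lemma isProbabilityMeasure_sliceProb {d : ℕ} (hd : 2 ≤ d) : IsProbabilityMeasure (sliceProb d) :=
  ⟨by rw [sliceProb, Measure.smul_apply, smul_eq_mul,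
    ENNReal.inv_mul_cancel (sliceMeas_univ_ne_zero d) (sliceMeas_univ_ne_top hd)]⟩

lemma ae_mem_sliceProb (d : ℕ) : ∀ᵐ u ∂sliceProb d, u ∈ Ioo (-1 : ℝ) 1 := by
  refine Measure.ae_smul_measure ?_ _
  exact (withDensity_absolutelyContinuous _ _).ae_le (ae_restrict_mem measurableSet_Ioo)

/-- For a uniform point of the sphere, the coordinate along `θ` and the direction of the component
orthogonal to `θ` are independent. -/
lemma usph_eq_map_slice [Nontrivial V] {H : Type*} [NormedAddCommGroup H] [InnerProductSpace ℝ H]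
    [FiniteDimensional ℝ H] [MeasurableSpace H] [BorelSpace H] [Nontrivial H] (θ : V)
    (j : H →ₗᵢ[ℝ] V) (hθ : ‖θ‖ = 1) (horth : ∀ y, inner ℝ θ (j y) = 0)
    (hdim : finrank ℝ V = finrank ℝ H + 1) :
    usph V = ((usph H).prod (sliceProb (finrank ℝ V))).map
      fun p => p.2 • θ + √(1 - p.2 ^ 2) • j p.1 := by
  have hj : Measurable j := j.continuous.measurable
  have hpos : 0 < finrank ℝ H := finrank_pos
  rw [usph, sph_univ_eq_mul θ j hθ horth hdim, sph_eq_map_slice θ j hθ horth hdim, usph,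
    sliceProb, Measure.prod_smul_left, Measure.prod_smul_right, smul_smul, Measure.map_smul,
    ENNReal.mul_inv (Or.inl sph_univ_ne_zero) (Or.inl (measure_ne_top _ _))]

lemma map_inner_usph {V : Type*} [NormedAddCommGroup V] [InnerProductSpace ℝ V]
    [FiniteDimensional ℝ V] [MeasurableSpace V] [BorelSpace V] {θ : V} (hθ : ‖θ‖ = 1)
    (hV : 2 ≤ finrank ℝ V) :
    (usph V).map (fun v => inner ℝ v θ) = sliceProb (finrank ℝ V) := by
  have : Nontrivial V := Module.nontrivial_of_finrank_pos (R := ℝ) (by omega)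
  have := nontrivial_orthogonal_span hθ hV
  have hj : Measurable (ℝ ∙ θ)ᗮ.subtypeₗᵢ := (ℝ ∙ θ)ᗮ.subtypeₗᵢ.continuous.measurable
  rw [usph_eq_map_slice θ (ℝ ∙ θ)ᗮ.subtypeₗᵢ hθ (inner_orthogonal_span θ)
    (finrank_orthogonal_span hθ), Measure.map_map (by fun_prop) (by fun_prop)]
  have : ((fun v => inner ℝ v θ) ∘ fun p : (ℝ ∙ θ)ᗮ × ℝ =>
      p.2 • θ + √(1 - p.2 ^ 2) • (ℝ ∙ θ)ᗮ.subtypeₗᵢ p.1) = Prod.snd := by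
    ext1 ⟨y, u⟩
    have h1 : inner ℝ (y : V) θ = 0 := by rw [real_inner_comm]; exact inner_orthogonal_span θ y
    simp [inner_add_left, inner_smul_left, h1, hθ]
  rw [this, Measure.map_snd_prod]
  simp

lemma area_pos {d : ℕ} (hd : 0 < d) : 0 < area d := by
  have : 0 < Real.Gamma ((d : ℝ) / 2) := Real.Gamma_pos_of_pos (by positivity)
  unfold area
  positivity

lemma toSphere_univ_eq_area [Nontrivial V] :
    (volume : Measure V).toSphere univ = ENNReal.ofReal (area (finrank ℝ V)) := by
  have hpos : 0 < finrank ℝ V := finrank_pos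
  have hd : (0 : ℝ) < finrank ℝ V := by exact_mod_cast hpos
  rw [Measure.toSphere_apply_univ, InnerProductSpace.volume_ball, ENNReal.ofReal_one, one_pow,
    one_mul, ← ENNReal.ofReal_natCast, ← ENNReal.ofReal_mul hd.le, area,
    Real.Gamma_add_one (by positivity), Real.sqrt_eq_rpow, ← Real.rpow_natCast,
    ← Real.rpow_mul Real.pi_pos.le]
  congr 1
  have : Real.Gamma ((finrank ℝ V : ℝ) / 2) ≠ 0 := (Real.Gamma_pos_of_pos (by positivity)).ne'
  field_simp

lemma sph_univ_eq_area [Nontrivial V] : sph V univ = ENNReal.ofReal (area (finrank ℝ V)) := by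
  rw [sph, Measure.map_apply measurable_subtype_coe .univ, preimage_univ, toSphere_univ_eq_area]

end Normalized

/-! ### Orthogonal projections and rotations of pairs of vectors -/

section PerpProj

variable {V : Type*} [NormedAddCommGroup V] [InnerProductSpace ℝ V]

/-- The normalized orthogonal projection of `w` to the orthogonal complement of the unit
vector `θ`. -/
def perpProj (θ w : V) : V := ‖w - inner ℝ w θ • θ‖⁻¹ • (w - inner ℝ w θ • θ)

lemma norm_sub_inner_smul {θ w : V} (hθ : ‖θ‖ = 1) (hw : ‖w‖ = 1) :
    ‖w - inner ℝ w θ • θ‖ = √(1 - inner ℝ w θ ^ 2) := by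
  rw [← Real.sqrt_sq (norm_nonneg _), norm_sub_sq_real, inner_smul_right, norm_smul, hθ, hw]
  congr 1
  rw [mul_one, Real.norm_eq_abs, sq_abs]
  ring

lemma perpProj_smul_add {θ y : V} (hθ : ‖θ‖ = 1) (hy : ‖y‖ = 1) (hθy : inner ℝ θ y = 0) {u : ℝ}
    (hu : u ∈ Ioo (-1 : ℝ) 1) : perpProj θ (u • θ + √(1 - u ^ 2) • y) = y := by
  have hs := Real.sqrt_pos.2 (one_sub_sq_pos hu)
  have h1 : inner ℝ (u • θ + √(1 - u ^ 2) • y) θ = u := by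
    simp [inner_add_left, inner_smul_left, real_inner_comm θ y, hθy, hθ]
  rw [perpProj, h1, add_sub_cancel_left, norm_smul, hy, Real.norm_of_nonneg hs.le, smul_smul,
    mul_one, inv_mul_cancel₀ hs.ne', one_smul]

lemma inner_smul_add_left {θ y : V} (hθ : ‖θ‖ = 1) (hθy : inner ℝ θ y = 0) (u : ℝ) :
    inner ℝ (u • θ + √(1 - u ^ 2) • y) θ = u := by
  simp [inner_add_left, inner_smul_left, real_inner_comm θ y, hθy, hθ]

lemma smul_add_perpProj {θ w : V} (hθ : ‖θ‖ = 1) (hw : ‖w‖ = 1)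
    (hu : inner ℝ w θ ∈ Ioo (-1 : ℝ) 1) :
    inner ℝ w θ • θ + √(1 - inner ℝ w θ ^ 2) • perpProj θ w = w := by
  have hs := Real.sqrt_pos.2 (one_sub_sq_pos hu)
  rw [perpProj, norm_sub_inner_smul hθ hw, smul_smul, mul_inv_cancel₀ hs.ne', one_smul]
  abel

/-- Elementary geometry in the plane of `θ` and `w`. With `smul_add_perpProj` it shows that
exchanging `θ` and `w` acts on the pair `(θ, perpProj θ w)` as `pairRot` at their inner product. -/
lemma perpProj_swap {θ w : V} (hθ : ‖θ‖ = 1) (hw : ‖w‖ = 1)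
    (hu : inner ℝ w θ ∈ Ioo (-1 : ℝ) 1) :
    perpProj w θ = √(1 - inner ℝ w θ ^ 2) • θ - inner ℝ w θ • perpProj θ w := by
  have hs := Real.sqrt_pos.2 (one_sub_sq_pos hu)
  have h2 := norm_sub_inner_smul hw hθ
  rw [real_inner_comm] at h2
  rw [perpProj, perpProj, norm_sub_inner_smul hθ hw, real_inner_comm, h2]
  set u := inner ℝ w θ
  set s := √(1 - u ^ 2)
  have h3 : s ^ 2 = 1 - u ^ 2 := Real.sq_sqrt (one_sub_sq_pos hu).le
  rw [← smul_right_inj hs.ne']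
  simp only [smul_sub, smul_smul]
  have e1 : s * s⁻¹ = 1 := mul_inv_cancel₀ hs.ne'
  have e2 : s * (u * s⁻¹) = u := by field_simp
  have e3 : s * (s⁻¹ * u) = u := by field_simp
  have e4 : s * (u * (s⁻¹ * u)) = u ^ 2 := by field_simp
  have e5 : s * s = 1 - u ^ 2 := by rw [← h3]; ring
  rw [e1, e2, e3, e4, e5, sub_smul]
  abel

/-- The action of the orthogonal matrices `[[u, √(1-u²)], [√(1-u²), -u]]` on pairs of vectors. -/
def pairRot (u : ℝ) (p : V × V) : V × V :=
  (u • p.1 + √(1 - u ^ 2) • p.2, √(1 - u ^ 2) • p.1 - u • p.2)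

lemma continuous_pairRot_uncurry : Continuous fun q : (V × V) × ℝ => pairRot q.2 q.1 := by
  unfold pairRot; fun_prop

lemma continuous_pairRot (u : ℝ) : Continuous (pairRot u : V × V → V × V) := by
  unfold pairRot; fun_prop

end PerpProj

/-! ### The invariant measure on orthonormal pairs -/

section Joint

variable {V : Type*} [NormedAddCommGroup V] [InnerProductSpace ℝ V] [FiniteDimensional ℝ V]
  [MeasurableSpace V] [BorelSpace V]

lemma measurable_perpProj : Measurable fun p : V × V => perpProj p.1 p.2 := by
  unfold perpProj
  fun_prop

lemma measurable_perpProj_right (θ : V) : Measurable (perpProj θ) :=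
  measurable_perpProj.comp measurable_prodMk_left

/-- The invariant probability measure on the unit sphere of `θ^⊥`, as a measure on the ambient
space. -/
def perpMeas (θ : V) : Measure V := (usph V).map (perpProj θ)

instance (θ : V) : IsFiniteMeasure (perpMeas θ) := by unfold perpMeas; infer_instance

instance [Nontrivial V] (θ : V) : IsProbabilityMeasure (perpMeas θ) :=
  Measure.isProbabilityMeasure_map (measurable_perpProj_right θ).aemeasurable

/-- In slice coordinates `perpProj θ` just returns the component in `θ^⊥`. The definition by
projection has the advantage that its dependence on `θ` is visibly measurable. -/
lemma perpMeas_eq {θ : V} (hθ : ‖θ‖ = 1) (hV : 2 ≤ finrank ℝ V) :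
    perpMeas θ = (usph (ℝ ∙ θ)ᗮ).map Subtype.val := by
  have : Nontrivial V := Module.nontrivial_of_finrank_pos (R := ℝ) (by omega)
  have := nontrivial_orthogonal_span hθ hV
  have := isProbabilityMeasure_sliceProb hV
  rw [perpMeas, usph_eq_map_slice θ (ℝ ∙ θ)ᗮ.subtypeₗᵢ hθ (inner_orthogonal_span θ)
    (finrank_orthogonal_span hθ), Measure.map_map (measurable_perpProj_right θ)
    (by simp only [Submodule.coe_subtypeₗᵢ, Submodule.subtype_apply]; fun_prop)]
  have h1 : (perpProj θ ∘ fun p : (ℝ ∙ θ)ᗮ × ℝ =>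
      p.2 • θ + √(1 - p.2 ^ 2) • (ℝ ∙ θ)ᗮ.subtypeₗᵢ p.1)
      =ᵐ[(usph (ℝ ∙ θ)ᗮ).prod (sliceProb (finrank ℝ V))] Subtype.val ∘ Prod.fst := by
    have h2 : ∀ᵐ p ∂(usph (ℝ ∙ θ)ᗮ).prod (sliceProb (finrank ℝ V)), ‖p.1‖ = 1 :=
      Measure.quasiMeasurePreserving_fst.ae ae_norm_usph
    have h3 : ∀ᵐ p ∂(usph (ℝ ∙ θ)ᗮ).prod (sliceProb (finrank ℝ V)), p.2 ∈ Ioo (-1 : ℝ) 1 :=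
      Measure.quasiMeasurePreserving_snd.ae (ae_mem_sliceProb _)
    filter_upwards [h2, h3] with p hp1 hp2
    exact perpProj_smul_add hθ hp1 (inner_orthogonal_span θ p.1) hp2
  rw [Measure.map_congr h1, ← Measure.map_map measurable_subtype_coe measurable_fst,
    Measure.map_fst_prod]
  simp

lemma ae_perpMeas {θ : V} (hθ : ‖θ‖ = 1) (hV : 2 ≤ finrank ℝ V) :
    ∀ᵐ y ∂perpMeas θ, ‖y‖ = 1 ∧ inner ℝ θ y = 0 := by
  rw [perpMeas_eq hθ hV, ae_map_iff measurable_subtype_coe.aemeasurable]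
  · filter_upwards [ae_norm_usph (V := (ℝ ∙ θ)ᗮ)] with y hy
    exact ⟨hy, inner_orthogonal_span θ y⟩
  · exact (measurableSet_eq_fun measurable_norm measurable_const).inter
      (measurableSet_eq_fun (by fun_prop) measurable_const)

lemma usph_eq_map_perpMeas {θ : V} (hθ : ‖θ‖ = 1) (hV : 2 ≤ finrank ℝ V) :
    usph V = ((perpMeas θ).prod (sliceProb (finrank ℝ V))).map
      fun p => p.2 • θ + √(1 - p.2 ^ 2) • p.1 := by
  have : Nontrivial V := Module.nontrivial_of_finrank_pos (R := ℝ) (by omega)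
  have := nontrivial_orthogonal_span hθ hV
  rw [perpMeas_eq hθ hV]
  conv_rhs => rw [← Measure.map_id (μ := sliceProb (finrank ℝ V))]
  rw [Measure.map_prod_map _ _ measurable_subtype_coe measurable_id,
    Measure.map_map (by fun_prop) (by fun_prop),
    usph_eq_map_slice θ (ℝ ∙ θ)ᗮ.subtypeₗᵢ hθ (inner_orthogonal_span θ)
      (finrank_orthogonal_span hθ)]
  rfl

/-- Only the component of `θ` in `w^⊥` contributes. It has length `√(1 - (w · θ)²)`, and the sphere
of `w^⊥` sits in dimension one less. -/
lemma map_inner_perpMeas {w θ : V} (hw : ‖w‖ = 1) (hθ : ‖θ‖ = 1) (hV : 3 ≤ finrank ℝ V)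
    (hu : inner ℝ w θ ∈ Ioo (-1 : ℝ) 1) :
    (perpMeas w).map (fun y => inner ℝ y θ) =
      (sliceProb (finrank ℝ V - 1)).map fun c => √(1 - inner ℝ w θ ^ 2) * c := by
  have hfin := finrank_orthogonal_span hw
  have hs := Real.sqrt_pos.2 (one_sub_sq_pos hu)
  have he : perpProj w θ ∈ (ℝ ∙ w)ᗮ := by
    rw [Submodule.mem_orthogonal_singleton_iff_inner_right, perpProj, inner_smul_right,
      inner_sub_right, inner_smul_right, real_inner_self_eq_norm_sq, hw, real_inner_comm]
    simp
  have hθ' := smul_add_perpProj hw hθ (by rwa [real_inner_comm])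
  have hen : ‖perpProj w θ‖ = 1 := by
    have h := norm_sub_inner_smul hw hθ
    rw [perpProj, norm_smul, norm_inv, norm_norm, inv_mul_cancel₀]
    rw [h, real_inner_comm]; exact hs.ne'
  let e : (ℝ ∙ w)ᗮ := ⟨perpProj w θ, he⟩
  have h1 := map_inner_usph (θ := e) (by exact hen) (by omega)
  rw [show finrank ℝ V - 1 = finrank ℝ (ℝ ∙ w)ᗮ by omega, ← h1, perpMeas_eq hw (by omega),
    Measure.map_map (by fun_prop) (by fun_prop), Measure.map_map (by fun_prop) (by fun_prop)]
  congr 1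
  ext1 y
  simp only [Function.comp, Submodule.coe_inner]
  rw [real_inner_comm] at hθ'
  conv_lhs => rw [← hθ']
  rw [inner_add_right, inner_smul_right, inner_smul_right, real_inner_comm w (y : V),
    inner_orthogonal_span w y]
  simp [e]

variable (V) in
/-- The invariant probability measure on the set of orthonormal pairs. -/
def joint : Measure (V × V) := ((usph V).prod (usph V)).map fun p => (p.1, perpProj p.1 p.2)

instance : IsFiniteMeasure (joint V) := by unfold joint; infer_instance

lemma measurable_fst_perpProj : Measurable fun p : V × V => (p.1, perpProj p.1 p.2) :=
  measurable_fst.prodMk measurable_perpProj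

lemma lintegral_joint {G : V × V → ℝ≥0∞} (hG : Measurable G) :
    ∫⁻ p, G p ∂joint V = ∫⁻ θ, ∫⁻ y, G (θ, y) ∂perpMeas θ ∂usph V := by
  rw [joint, lintegral_map hG measurable_fst_perpProj,
    lintegral_prod _ (hG.fun_comp measurable_fst_perpProj).aemeasurable]
  refine lintegral_congr fun θ => ?_
  rw [perpMeas, lintegral_map (hG.fun_comp measurable_prodMk_left) (measurable_perpProj_right θ)]

/-- For two independent uniform points the orthonormal pair obtained from them is independent of
their inner product. -/
lemma map_joint_prod (hV : 2 ≤ finrank ℝ V) :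
    ((usph V).prod (usph V)).map (fun p => ((p.1, perpProj p.1 p.2), inner ℝ p.2 p.1)) =
      (joint V).prod (sliceProb (finrank ℝ V)) := by
  have hm : Measurable fun p : V × V => ((p.1, perpProj p.1 p.2), (inner ℝ p.2 p.1 : ℝ)) :=
    measurable_fst_perpProj.prodMk (by fun_prop)
  refine Measure.ext_of_lintegral _ fun G hG => ?_
  rw [lintegral_map hG hm, lintegral_prod _ (hG.fun_comp hm).aemeasurable,
    lintegral_prod _ hG.aemeasurable, lintegral_joint hG.lintegral_prod_right']
  refine lintegral_congr_ae ?_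
  filter_upwards [ae_norm_usph (V := V)] with θ hθ
  rw [usph_eq_map_perpMeas hθ hV, lintegral_map _ (by fun_prop),
    lintegral_prod]
  · refine lintegral_congr_ae ?_
    filter_upwards [ae_perpMeas hθ hV] with y hy
    refine lintegral_congr_ae ?_
    filter_upwards [ae_mem_sliceProb (finrank ℝ V)] with u hu
    rw [perpProj_smul_add hθ hy.1 hy.2 hu, inner_smul_add_left hθ hy.2]
  · have hT : Measurable fun z : V × ℝ => (θ, z.2 • θ + √(1 - z.2 ^ 2) • z.1) := by fun_prop
    exact (hG.fun_comp (hm.fun_comp hT)).aemeasurable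
  · exact hG.fun_comp (hm.fun_comp measurable_prodMk_left)

/-- The exchange of two independent uniform points preserves their law and their inner product `u`,
and by `perpProj_swap` it acts on the associated orthonormal pair as `pairRot u`. -/
lemma map_pairRot_prod (hV : 2 ≤ finrank ℝ V) :
    ((joint V).prod (sliceProb (finrank ℝ V))).map (fun q => (pairRot q.2 q.1, q.2)) =
      (joint V).prod (sliceProb (finrank ℝ V)) := by
  have hm : Measurable fun p : V × V => ((p.1, perpProj p.1 p.2), (inner ℝ p.2 p.1 : ℝ)) :=
    measurable_fst_perpProj.prodMk (by fun_prop)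
  have hr : Measurable fun q : (V × V) × ℝ => (pairRot q.2 q.1, q.2) :=
    continuous_pairRot_uncurry.measurable.prodMk measurable_snd
  conv_lhs => rw [← map_joint_prod hV, Measure.map_map hr hm]
  rw [← map_joint_prod hV]
  conv_rhs => rw [← Measure.prod_swap, Measure.map_map hm measurable_swap]
  refine Measure.map_congr ?_
  have h1 : ∀ᵐ p ∂(usph V).prod (usph V), ‖p.1‖ = 1 :=
    Measure.quasiMeasurePreserving_fst.ae ae_norm_usph
  have h2 : ∀ᵐ p ∂(usph V).prod (usph V), ‖p.2‖ = 1 :=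
    Measure.quasiMeasurePreserving_snd.ae ae_norm_usph
  have h3 : ∀ᵐ p ∂(usph V).prod (usph V), inner ℝ p.2 p.1 ∈ Ioo (-1 : ℝ) 1 := by
    have hms : MeasurableSet {p : V × V | inner ℝ p.2 p.1 ∈ Ioo (-1 : ℝ) 1} :=
      (by fun_prop : Measurable fun p : V × V => (inner ℝ p.2 p.1 : ℝ)) measurableSet_Ioo
    refine (Measure.ae_prod_iff_ae_ae hms).2 ?_
    filter_upwards [ae_norm_usph (V := V)] with θ hθ
    have := ae_mem_sliceProb (finrank ℝ V)
    rw [← map_inner_usph hθ hV] at this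
    exact ae_of_ae_map (by fun_prop) this
  filter_upwards [h1, h2, h3] with p hp1 hp2 hp3
  simp only [Function.comp, pairRot, Prod.swap]
  rw [smul_add_perpProj hp1 hp2 hp3, perpProj_swap hp1 hp2 hp3, real_inner_comm]

/-- The previous lemma gives the invariance after averaging over `u`. It is localized to almost
every `u`, then extended to every `u` by continuity. -/
lemma map_pairRot (hV : 2 ≤ finrank ℝ V) {u : ℝ} (hu : u ∈ Ioo (-1 : ℝ) 1) :
    (joint V).map (pairRot u) = joint V := by
  have := isProbabilityMeasure_sliceProb hV
  refine ext_of_forall_integral_eq_of_IsFiniteMeasure fun G => ?_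
  have hGm : Measurable G := G.continuous.measurable
  rw [integral_map (continuous_pairRot u).aemeasurable hGm.aestronglyMeasurable]
  set I : ℝ → ℝ := fun u => ∫ p, G (pairRot u p) ∂joint V with hI
  have hIc : Continuous I := by
    refine continuous_of_dominated (bound := fun _ => ‖G‖)
      (fun u => (hGm.comp (continuous_pairRot u).measurable).aestronglyMeasurable)
      (fun u => Eventually.of_forall fun p => G.norm_coe_le_norm _) (integrable_const _)
      (Eventually.of_forall fun p => ?_)
    exact G.continuous.comp (continuous_pairRot_uncurry.comp (by fun_prop : Continuous
      fun u : ℝ => (p, u)))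
  have hGint : ∀ (ν : Measure ((V × V) × ℝ)) [IsFiniteMeasure ν],
      Integrable (fun q => G (pairRot q.2 q.1)) ν := fun ν _ =>
    Integrable.of_bound ((hGm.comp continuous_pairRot_uncurry.measurable).aestronglyMeasurable)
      ‖G‖ (Eventually.of_forall fun q => G.norm_coe_le_norm _)
  -- Testing the averaged invariance on the products `1_B(u) G(p)` gives equal integrals over every
  -- measurable set `B` of values of `u`.
  have hae : I =ᵐ[sliceProb (finrank ℝ V)] fun _ => ∫ p, G p ∂joint V := by
    refine Integrable.ae_eq_of_forall_setIntegral_eq _ _ ?_ (integrable_const _) ?_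
    · exact (hGint ((joint V).prod (sliceProb (finrank ℝ V)))).integral_prod_right
    · intro B hB _
      have hr : Measurable fun q : (V × V) × ℝ => (pairRot q.2 q.1, q.2) :=
        continuous_pairRot_uncurry.measurable.prodMk measurable_snd
      have key : ∀ F : (V × V) × ℝ → ℝ, Measurable F →
          ∫ q, F (pairRot q.2 q.1, q.2) ∂(joint V).prod (sliceProb (finrank ℝ V)) =
          ∫ q, F q ∂(joint V).prod (sliceProb (finrank ℝ V)) := fun F hF => by
        conv_rhs => rw [← map_pairRot_prod hV, integral_map hr.aemeasurable
          hF.aestronglyMeasurable]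
      have hF : Measurable fun q : (V × V) × ℝ => B.indicator (fun _ => (1 : ℝ)) q.2 * G q.1 :=
        ((measurable_const.indicator hB).comp measurable_snd).mul (hGm.comp measurable_fst)
      have hk := key _ hF
      have hb : ∀ q : (V × V) × ℝ, ‖B.indicator (fun _ => (1 : ℝ)) q.2‖ ≤ 1 := fun q => by
        by_cases h : q.2 ∈ B <;> simp [h]
      rw [integral_prod_symm, integral_prod_symm] at hk
      · simp only [integral_const_mul] at hk
        have e : ∀ J : ℝ → ℝ, B.indicator J = fun y => B.indicator (fun _ => (1 : ℝ)) y * J y :=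
          fun J => by
            ext y
            by_cases h : y ∈ B <;> simp [h]
        rw [← integral_indicator hB, ← integral_indicator hB, e I, e fun _ => ∫ p, G p ∂joint V]
        exact hk
      · refine Integrable.of_bound hF.aestronglyMeasurable ‖G‖ (Eventually.of_forall fun q => ?_)
        rw [norm_mul]
        exact (mul_le_mul (hb q) (G.norm_coe_le_norm _) (norm_nonneg _) zero_le_one).trans
          (one_mul _).le
      · refine Integrable.of_bound (hF.fun_comp hr).aestronglyMeasurable ‖G‖
          (Eventually.of_forall fun q => ?_)
        rw [norm_mul]
        exact (mul_le_mul (hb _) (G.norm_coe_le_norm _) (norm_nonneg _) zero_le_one).trans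
          (one_mul _).le
  -- The slice density is positive on `(-1, 1)`, so the equality holds almost everywhere for
  -- Lebesgue measure; two continuous functions that agree almost everywhere on an open interval
  -- agree on all of it.
  have hac : volume.restrict (Ioo (-1 : ℝ) 1) ≪ sliceProb (finrank ℝ V) := by
    refine Measure.AbsolutelyContinuous.smul_right ?_ ?_
    · refine withDensity_absolutelyContinuous' (measurable_sliceDensity _).aemeasurable ?_
      filter_upwards [ae_restrict_mem measurableSet_Ioo] with u hu
      simpa using Real.rpow_pos_of_pos (one_sub_sq_pos hu) _
    · exact ENNReal.inv_ne_zero.2 (sliceMeas_univ_ne_top hV)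
  exact Measure.eqOn_open_of_ae_eq (hac.ae_le hae) isOpen_Ioo hIc.continuousOn
    continuousOn_const hu

end Joint

/-! ### A zonal function with explicit Funk transform -/

section Kernel

lemma sliceMeas_univ (d : ℕ) : sliceMeas d univ =
    ∫⁻ u in Ioo (-1 : ℝ) 1, ENNReal.ofReal ((1 - u ^ 2) ^ (((d : ℝ) - 3) / 2)) := by
  have h := lintegral_sliceMeas d (g := 1) measurable_one
  simpa only [Pi.one_apply, lintegral_one, mul_one] using h

lemma setLIntegral_eq_of_subset {f : ℝ → ℝ≥0∞} {s t : Set ℝ} (hs : MeasurableSet s)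
    (ht : MeasurableSet t) (hst : s ⊆ t) (h0 : ∀ x ∈ t \ s, f x = 0) :
    ∫⁻ x in s, f x = ∫⁻ x in t, f x := by
  rw [← lintegral_indicator hs, ← lintegral_indicator ht]
  congr 1
  ext x
  by_cases hxs : x ∈ s
  · simp [hxs, hst hxs]
  · by_cases hxt : x ∈ t
    · simp [hxs, hxt, h0 x ⟨hxt, hxs⟩]
    · simp [hxs, hxt]

variable {p t : ℝ}

lemma image_div_Ioo (hp : 0 < p) (hpt : p < t) : (fun s => t * p / s) '' Ioo p t = Ioo p t := by
  have ht : 0 < t := hp.trans hpt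
  have hmaps : ∀ s ∈ Ioo p t, t * p / s ∈ Ioo p t := fun s hs => by
    have hs0 : 0 < s := hp.trans hs.1
    constructor
    · rw [lt_div_iff₀ hs0]; nlinarith [hs.2]
    · rw [div_lt_iff₀ hs0]; nlinarith [hs.1]
  refine Subset.antisymm (image_subset_iff.2 hmaps) fun s hs => ⟨t * p / s, hmaps s hs, ?_⟩
  have hs0 : 0 < s := hp.trans hs.1
  field_simp

lemma image_sub_div_Ioo (hp : 0 < p) (hpt : p < t) :
    (fun s => (s - t * p / s) / (t - p)) '' Ioo p t = Ioo (-1) 1 := by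
  have ht : 0 < t := hp.trans hpt
  have hL : 0 < t - p := sub_pos.2 hpt
  have hcont : ContinuousOn (fun s => (s - t * p / s) / (t - p)) (Icc p t) := by
    have : ∀ s ∈ Icc p t, s ≠ 0 := fun s hs => (hp.trans_le hs.1).ne'
    fun_prop (disch := assumption)
  apply Subset.antisymm
  · rintro _ ⟨s, hs, rfl⟩
    have hs0 : 0 < s := hp.trans hs.1
    have e : s - t * p / s = (s ^ 2 - t * p) / s := by field_simp
    constructor
    · rw [lt_div_iff₀ hL, e, lt_div_iff₀ hs0]; nlinarith [hs.1, hs.2, mul_pos (sub_pos.2 hs.1) ht]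
    · rw [div_lt_iff₀ hL, e, div_lt_iff₀ hs0]; nlinarith [hs.1, hs.2, mul_pos (sub_pos.2 hs.2) hp]
  · have h := intermediate_value_Ioo hpt.le hcont
    have e1 : (p - t * p / p) / (t - p) = -1 := by field_simp; ring
    have e2 : (t - t * p / t) / (t - p) = 1 := by field_simp
    simpa only [e1, e2] using h

/-- A Cauchy–Schlömilch substitution. With `c = (s - tp/s) / (t - p)` the base of the power is `(t -
p)² (1 - c²)` and `c` runs over `(-1, 1)`. Its derivative is `(1 + tp/s²) / (t - p)`, and the two
summands contribute equally by the symmetry `s ↦ tp/s`. This accounts for the factor 2 and for the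
exponent `2 (n-3)/2 + 1 = n - 2`. -/
lemma lintegral_kernel {n : ℕ} (hn : 2 ≤ n) (hp : 0 < p) (hpt : p < t) :
    2 * ∫⁻ s in Ioo p t,
        ENNReal.ofReal (((t ^ 2 - s ^ 2) * (s ^ 2 - p ^ 2) / s ^ 2) ^ (((n : ℝ) - 3) / 2)) =
      ENNReal.ofReal ((t - p) ^ (n - 2)) * sliceMeas n univ := by
  have ht : 0 < t := hp.trans hpt
  have hL : 0 < t - p := sub_pos.2 hpt
  set α : ℝ := ((n : ℝ) - 3) / 2 with hα
  set c : ℝ → ℝ := fun s => (s - t * p / s) / (t - p) with hc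
  set g : ℝ → ℝ≥0∞ := fun u => ENNReal.ofReal ((1 - u ^ 2) ^ α) with hg
  have hgm : Measurable g := by fun_prop
  have hcm : Measurable c := by fun_prop
  have hderiv0 : ∀ s ∈ Ioo p t, HasDerivAt (fun s => t * p / s) (-(t * p / s ^ 2)) s := fun s hs => by
    have hs0 : s ≠ 0 := (hp.trans hs.1).ne'
    refine ((hasDerivAt_const s (t * p)).div (hasDerivAt_id s) hs0).congr_deriv ?_
    simp only [id]
    field_simp
    ring
  have hderiv : ∀ s ∈ Ioo p t,
      HasDerivWithinAt c ((1 + t * p / s ^ 2) / (t - p)) (Ioo p t) s := fun s hs => by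
    refine (((hasDerivAt_id s).sub (hderiv0 s hs)).div_const (t - p)).hasDerivWithinAt.congr_deriv ?_
    ring
  have hinj : InjOn c (Ioo p t) := by
    refine StrictMonoOn.injOn fun a ha b hb hab => ?_
    have ha0 : 0 < a := hp.trans ha.1
    have hb0 : 0 < b := hp.trans hb.1
    have : t * p / b < t * p / a := div_lt_div_of_pos_left (mul_pos ht hp) ha0 hab
    exact div_lt_div_of_pos_right (by linarith) hL
  have hinj0 : InjOn (fun s => t * p / s) (Ioo p t) := by
    intro a ha b hb hab
    have ha0 : a ≠ 0 := (hp.trans ha.1).ne'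
    have hb0 : b ≠ 0 := (hp.trans hb.1).ne'
    have h1 : t * p / a = t * p / b := hab
    have h2 : t * p ≠ 0 := (mul_pos ht hp).ne'
    field_simp at h1
    exact h1.symm
  -- The involution `s ↦ tp/s` of `(p, t)` changes `c` to `-c` and has Jacobian `tp/s²`, while `g`
  -- is even.
  have hI : ∫⁻ s in Ioo p t, g (c s) = ∫⁻ s in Ioo p t, ENNReal.ofReal (t * p / s ^ 2) * g (c s) := by
    conv_lhs => rw [← image_div_Ioo hp hpt]
    rw [lintegral_image_eq_lintegral_abs_deriv_mul measurableSet_Ioo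
      (fun s hs => (hderiv0 s hs).hasDerivWithinAt) hinj0]
    refine setLIntegral_congr_fun measurableSet_Ioo fun s hs => ?_
    have hs0 : 0 < s := hp.trans hs.1
    have e : c (t * p / s) = - c s := by
      simp only [hc]; field_simp; ring
    simp only [e, hg, neg_sq, abs_neg]
    rw [abs_of_pos (by positivity)]
  have hB : ENNReal.ofReal (t - p) * sliceMeas n univ = 2 * ∫⁻ s in Ioo p t, g (c s) := by
    rw [sliceMeas_univ, ← image_sub_div_Ioo hp hpt,
      lintegral_image_eq_lintegral_abs_deriv_mul measurableSet_Ioo hderiv hinj,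
      ← lintegral_const_mul' _ _ ENNReal.ofReal_ne_top, two_mul]
    nth_rw 2 [hI]
    rw [← lintegral_add_left (hgm.fun_comp hcm)]
    refine setLIntegral_congr_fun measurableSet_Ioo fun s hs => ?_
    have hs0 : 0 < s := hp.trans hs.1
    have h1 : 0 < (1 + t * p / s ^ 2) / (t - p) := by positivity
    change ENNReal.ofReal (t - p) * (ENNReal.ofReal |(1 + t * p / s ^ 2) / (t - p)| * g (c s)) =
      g (c s) + _
    rw [← mul_assoc, ← ENNReal.ofReal_mul hL.le, abs_of_pos h1, mul_div_cancel₀ _ hL.ne',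
      ENNReal.ofReal_add zero_le_one (by positivity), ENNReal.ofReal_one, add_mul, one_mul]
  have hK : ∀ s ∈ Ioo p t,
      ENNReal.ofReal (((t ^ 2 - s ^ 2) * (s ^ 2 - p ^ 2) / s ^ 2) ^ α) =
        ENNReal.ofReal (((t - p) ^ 2) ^ α) * g (c s) := fun s hs => by
    have hs0 : 0 < s := hp.trans hs.1
    have e : (t ^ 2 - s ^ 2) * (s ^ 2 - p ^ 2) / s ^ 2 = (t - p) ^ 2 * (1 - c s ^ 2) := by
      simp only [hc]; field_simp; ring
    have h1 : 0 < 1 - c s ^ 2 := one_sub_sq_pos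
      (image_sub_div_Ioo hp hpt ▸ mem_image_of_mem c hs)
    rw [e, Real.mul_rpow (by positivity) h1.le, ENNReal.ofReal_mul (by positivity)]
  rw [setLIntegral_congr_fun measurableSet_Ioo hK, lintegral_const_mul' _ _ ENNReal.ofReal_ne_top,
    mul_left_comm, ← hB, ← mul_assoc, ← ENNReal.ofReal_mul (by positivity)]
  congr 2
  rw [← Real.rpow_natCast (t - p) 2, ← Real.rpow_mul hL.le, ← Real.rpow_add_one hL.ne',
    ← Real.rpow_natCast, Nat.cast_sub hn, hα]
  congr 1
  push_cast
  ring

/-- The zonal function whose Funk transform is `zonalDual`. -/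
def zonalWeight (n : ℕ) (t u : ℝ) : ℝ :=
  if √(1 - t ^ 2) < u ∧ u < 1 then
    (t ^ 2 - (1 - u ^ 2)) ^ (((n : ℝ) - 3) / 2) * u * ((1 - u ^ 2) ^ (((n : ℝ) - 2) / 2))⁻¹
  else 0

/-- The Funk transform of `zonalWeight`. -/
def zonalDual (n : ℕ) (t p : ℝ) : ℝ :=
  if |p| < t then (t - |p|) ^ (n - 2) / 2 * ((1 - p ^ 2) ^ (((n : ℝ) - 2) / 2))⁻¹ else 0

lemma measurable_zonalWeight (n : ℕ) (t : ℝ) : Measurable (zonalWeight n t) := by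
  unfold zonalWeight
  refine Measurable.ite ?_ (by fun_prop) measurable_const
  exact measurableSet_Ioo (a := √(1 - t ^ 2)) (b := (1 : ℝ))

lemma measurable_zonalDual (n : ℕ) (t : ℝ) : Measurable (zonalDual n t) := by
  unfold zonalDual
  refine Measurable.ite ?_ (by fun_prop) measurable_const
  exact measurableSet_lt (by fun_prop) measurable_const

lemma zonalWeight_nonneg (n : ℕ) {t : ℝ} (u : ℝ) : 0 ≤ zonalWeight n t u := by
  unfold zonalWeight
  split_ifs with h
  · have hu : 0 ≤ u := (Real.sqrt_nonneg _).trans h.1.le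
    have h1 : 0 ≤ 1 - u ^ 2 := by nlinarith [h.2]
    have h2 : 0 ≤ t ^ 2 - (1 - u ^ 2) := by
      have := Real.lt_sq_of_sqrt_lt h.1
      linarith
    positivity
  · exact le_rfl

lemma image_sqrt_div_Ioo {q : ℝ} (hp : 0 < p) (hpt : p < t) (ht : t < 1) (hq : q = √(1 - p ^ 2)) :
    (fun s => √(1 - s ^ 2) / q) '' Ioo p t = Ioo (√(1 - t ^ 2) / q) 1 := by
  have hp1 : 0 < 1 - p ^ 2 := by nlinarith
  have hq0 : 0 < q := hq ▸ Real.sqrt_pos.2 hp1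
  have ht0 : 0 < t := hp.trans hpt
  apply Subset.antisymm
  · rintro _ ⟨s, hs, rfl⟩
    have hs0 : 0 < s := hp.trans hs.1
    constructor
    · refine div_lt_div_of_pos_right (Real.sqrt_lt_sqrt (by nlinarith) (by nlinarith [hs.2])) hq0
    · rw [div_lt_one hq0, hq]
      exact Real.sqrt_lt_sqrt (by nlinarith [hs.2]) (by nlinarith [hs.1])
  · intro c hc
    have hc0 : 0 < c := lt_of_le_of_lt (by positivity) hc.1
    have h1 : √(1 - t ^ 2) < c * q := (div_lt_iff₀ hq0).1 hc.1
    have h2 : 1 - t ^ 2 < (c * q) ^ 2 := Real.lt_sq_of_sqrt_lt h1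
    have h3 : c * q < q := by nlinarith [hc.2]
    have h4 : (c * q) ^ 2 < 1 - p ^ 2 := by
      rw [← Real.sq_sqrt hp1.le, ← hq]
      exact pow_lt_pow_left₀ h3 (by positivity) two_ne_zero
    refine ⟨√(1 - (c * q) ^ 2), ⟨?_, ?_⟩, ?_⟩
    · exact Real.lt_sqrt_of_sq_lt (by linarith)
    · exact (Real.sqrt_lt' ht0).2 (by linarith)
    · simp only
      rw [Real.sq_sqrt (by nlinarith), sub_sub_cancel, Real.sqrt_sq (by positivity)]
      field_simp

/-- With `√(1 - p²) c = √(1 - s²)` the integrand becomes the kernel of `lintegral_kernel`, up to the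
factor `(1 - p²)^{-(n-2)/2}`. For `p ≥ t` the argument never reaches the support of the weight. -/
lemma lintegral_zonalWeight {n : ℕ} (hn : 2 ≤ n) (ht : t ∈ Ioo (0 : ℝ) 1)
    (hp : p ∈ Ioo (0 : ℝ) 1) :
    ∫⁻ c, ENNReal.ofReal (zonalWeight n t (√(1 - p ^ 2) * c)) ∂sliceProb n =
      ENNReal.ofReal (zonalDual n t p) := by
  have hp1 : 0 < 1 - p ^ 2 := by nlinarith [hp.1, hp.2]
  set q := √(1 - p ^ 2) with hq
  have hq0 : 0 < q := Real.sqrt_pos.2 hp1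
  have hq1 : q < 1 := by
    rw [hq, Real.sqrt_lt' one_pos]; nlinarith [hp.1]
  have hm : Measurable fun c => ENNReal.ofReal (zonalWeight n t (q * c)) :=
    ((measurable_zonalWeight n t).comp (measurable_const_mul q)).ennreal_ofReal
  rw [sliceProb, lintegral_smul_measure, lintegral_sliceMeas n hm, zonalDual, abs_of_pos hp.1]
  split_ifs with hpt
  · have hsub : Ioo (√(1 - t ^ 2) / q) 1 ⊆ Ioo (-1) 1 := Ioo_subset_Ioo_left
      (le_trans (by norm_num) (div_nonneg (Real.sqrt_nonneg _) hq0.le))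
    have hzero : ∀ c ∈ Ioo (-1 : ℝ) 1 \ Ioo (√(1 - t ^ 2) / q) 1,
        ENNReal.ofReal ((1 - c ^ 2) ^ (((n : ℝ) - 3) / 2)) *
          ENNReal.ofReal (zonalWeight n t (q * c)) = 0 := fun c hc => by
      have : ¬ √(1 - t ^ 2) < q * c := fun h =>
        hc.2 ⟨(div_lt_iff₀' hq0).2 h, hc.1.2⟩
      simp [zonalWeight, this]
    -- The range of `c` is restricted to the support of the weight, which is the image of `(p, t)`
    -- under `s ↦ √(1 - s²) / q`.
    rw [← setLIntegral_eq_of_subset measurableSet_Ioo measurableSet_Ioo hsub hzero,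
      ← image_sqrt_div_Ioo hp.1 hpt ht.2 hq]
    have hderiv : ∀ s ∈ Ioo p t, HasDerivWithinAt (fun s => √(1 - s ^ 2) / q)
        (-(s / (√(1 - s ^ 2) * q))) (Ioo p t) s := fun s hs => by
      have h : 0 < 1 - s ^ 2 := by nlinarith [hs.1, hs.2, hp.1, ht.2]
      have hs := Real.sqrt_pos.2 h
      have h1 : HasDerivAt (fun u : ℝ => 1 - u ^ 2) (-(2 * s)) s := by
        simpa using ((hasDerivAt_id s).pow 2).const_sub 1
      refine ((h1.sqrt h.ne').div_const q).hasDerivWithinAt.congr_deriv ?_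
      field_simp
    have hinj : InjOn (fun s => √(1 - s ^ 2) / q) (Ioo p t) := by
      refine StrictAntiOn.injOn fun a ha b hb hab => ?_
      have ha0 : 0 < a := hp.1.trans ha.1
      exact div_lt_div_of_pos_right (Real.sqrt_lt_sqrt
        (by nlinarith [hb.2, ht.2, hb.1, hp.1]) (by nlinarith)) hq0
    rw [lintegral_image_eq_lintegral_abs_deriv_mul measurableSet_Ioo hderiv hinj]
    have hK : ∀ s ∈ Ioo p t, ENNReal.ofReal |(-(s / (√(1 - s ^ 2) * q)))| *
        (ENNReal.ofReal ((1 - (√(1 - s ^ 2) / q) ^ 2) ^ (((n : ℝ) - 3) / 2)) *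
          ENNReal.ofReal (zonalWeight n t (q * (√(1 - s ^ 2) / q)))) =
        ENNReal.ofReal (((1 - p ^ 2) ^ (((n : ℝ) - 2) / 2))⁻¹) *
        ENNReal.ofReal (((t ^ 2 - s ^ 2) * (s ^ 2 - p ^ 2) / s ^ 2) ^ (((n : ℝ) - 3) / 2)) :=
        fun s hs => by
      have hs0 : 0 < s := hp.1.trans hs.1
      have h : 0 < 1 - s ^ 2 := by nlinarith [hs.1, hs.2, hp.1, ht.2]
      have hr := Real.sqrt_pos.2 h
      have hr1 : √(1 - s ^ 2) < 1 := by
        rw [Real.sqrt_lt' one_pos]; nlinarith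
      have hrt : √(1 - t ^ 2) < √(1 - s ^ 2) :=
        Real.sqrt_lt_sqrt (by nlinarith [ht.2, ht.1]) (by nlinarith [hs.2])
      have e1 : 1 - (√(1 - s ^ 2) / q) ^ 2 = (s ^ 2 - p ^ 2) / q ^ 2 := by
        rw [div_pow, Real.sq_sqrt h.le, eq_div_iff (by positivity), sub_mul,
          div_mul_cancel₀ _ (by positivity), hq, Real.sq_sqrt hp1.le]
        ring
      have hA : 0 < s ^ 2 - p ^ 2 := by nlinarith [hs.1, hp.1]
      have hB : 0 < t ^ 2 - s ^ 2 := by nlinarith [hs.2, ht.1]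
      rw [mul_div_cancel₀ _ hq0.ne', zonalWeight, if_pos ⟨hrt, hr1⟩, e1,
        Real.sq_sqrt h.le, sub_sub_cancel, abs_neg, abs_of_pos (by positivity),
        ← ENNReal.ofReal_mul (by positivity), ← ENNReal.ofReal_mul (by positivity),
        ← ENNReal.ofReal_mul (by positivity)]
      congr 1
      have e2 : (s ^ 2) ^ (((n : ℝ) - 2) / 2) = (s ^ 2) ^ (((n : ℝ) - 3) / 2) * s := by
        rw [← Real.rpow_natCast, ← Real.rpow_mul hs0.le, ← Real.rpow_mul hs0.le,
          ← Real.rpow_add_one hs0.ne']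
        congr 1; push_cast; ring
      have e3 : (1 - p ^ 2) ^ (((n : ℝ) - 2) / 2) = (q ^ 2) ^ (((n : ℝ) - 3) / 2) * q := by
        rw [hq, ← Real.sq_sqrt hp1.le, ← hq, Real.sqrt_sq hq0.le,
          ← Real.rpow_natCast, ← Real.rpow_mul hq0.le, ← Real.rpow_mul hq0.le,
          ← Real.rpow_add_one hq0.ne']
        congr 1; push_cast; ring
      rw [e2, e3, Real.div_rpow hA.le (by positivity), Real.div_rpow (by positivity)
        (by positivity), Real.mul_rpow hB.le hA.le]
      have f1 : 0 < (q ^ 2) ^ (((n : ℝ) - 3) / 2) := by positivity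
      have f2 : 0 < (s ^ 2) ^ (((n : ℝ) - 3) / 2) := by positivity
      field_simp
    rw [setLIntegral_congr_fun measurableSet_Ioo hK, lintegral_const_mul' _ _ ENNReal.ofReal_ne_top]
    have hk := lintegral_kernel hn hp.1 hpt
    have h0 := sliceMeas_univ_ne_zero n
    have htop := sliceMeas_univ_ne_top hn
    have hk' : ∫⁻ s in Ioo p t,
        ENNReal.ofReal (((t ^ 2 - s ^ 2) * (s ^ 2 - p ^ 2) / s ^ 2) ^ (((n : ℝ) - 3) / 2)) =
        ENNReal.ofReal ((t - p) ^ (n - 2) / 2) * sliceMeas n univ := by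
      rw [← ENNReal.mul_right_inj (two_ne_zero) ENNReal.ofNat_ne_top, hk, ← mul_assoc]
      congr 1
      rw [← ENNReal.ofReal_ofNat 2, ← ENNReal.ofReal_mul two_pos.le]
      congr 1; ring
    rw [hk', smul_eq_mul, ENNReal.ofReal_mul (by have := sub_pos.2 hpt; positivity), mul_comm,
      mul_comm (ENNReal.ofReal (_ / 2)), mul_assoc, mul_assoc, mul_left_comm (sliceMeas n univ),
      ENNReal.mul_inv_cancel h0 htop, mul_one, mul_comm]
  · rw [ENNReal.ofReal_zero, smul_eq_mul, setLIntegral_congr_fun (g := 0) measurableSet_Ioo]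
    · simp
    · intro c hc
      have : ¬ √(1 - t ^ 2) < q * c := fun h => by
        have h1 : q * c < q := by nlinarith [hc.2]
        have h2 : q ≤ √(1 - t ^ 2) := Real.sqrt_le_sqrt (by nlinarith [ht.1, not_lt.1 hpt])
        linarith
      simp [zonalWeight, this]

end Kernel

/-! ### Self-adjointness of the Funk transform -/

section FunkDuality

variable {V : Type*} [NormedAddCommGroup V] [InnerProductSpace ℝ V] [FiniteDimensional ℝ V]
  [MeasurableSpace V] [BorelSpace V] {F : Type*} [NormedAddCommGroup F] [NormedSpace ℝ F]

variable (V) in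
/-- The measures `perpMeas θ`, as a kernel. -/
def perpKernel : ProbabilityTheory.Kernel V V where
  toFun := perpMeas
  measurable' := by
    refine Measure.measurable_of_measurable_coe _ fun s hs => ?_
    simp_rw [perpMeas, Measure.map_apply (measurable_perpProj_right _) hs]
    exact measurable_measure_prodMk_left (measurable_perpProj hs)

lemma perpKernel_apply (θ : V) : perpKernel V θ = perpMeas θ := rfl

instance [Nontrivial V] : ProbabilityTheory.IsMarkovKernel (perpKernel V) :=
  ⟨fun θ => by rw [perpKernel_apply]; infer_instance⟩

lemma joint_eq_compProd [Nontrivial V] : joint V = (usph V).compProd (perpKernel V) := by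
  refine Measure.ext_of_lintegral _ fun G hG => ?_
  rw [lintegral_joint hG, Measure.lintegral_compProd hG]
  rfl

/-- The case `u = 0` of the invariance under `pairRot`. This symmetry is what makes the Funk
transform self-adjoint. -/
lemma map_swap_joint (hV : 2 ≤ finrank ℝ V) : (joint V).map Prod.swap = joint V := by
  conv_rhs => rw [← map_pairRot hV (u := 0) (by norm_num)]
  congr 1
  ext1 p
  simp [pairRot, Prod.swap]

lemma map_fst_joint [Nontrivial V] : (joint V).map Prod.fst = usph V := by
  rw [joint_eq_compProd]
  exact Measure.fst_compProd _ _

lemma map_snd_joint (hV : 2 ≤ finrank ℝ V) : (joint V).map Prod.snd = usph V := by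
  have : Nontrivial V := Module.nontrivial_of_finrank_pos (R := ℝ) (by omega)
  rw [← map_fst_joint]
  conv_lhs => rw [← map_swap_joint hV, Measure.map_map measurable_snd measurable_swap]
  rfl

/-- The mean value of `f` over the unit sphere of `θ^⊥`. -/
def perpMean (f : V → F) (θ : V) : F := ∫ y, f y ∂perpMeas θ

/-- The mean value of `f` over the vectors `v` of the unit sphere with `v · θ = u`. -/
def sliceMean (f : V → F) (θ : V) (u : ℝ) : F :=
  ∫ y, f (u • θ + √(1 - u ^ 2) • y) ∂perpMeas θ

lemma integrable_snd_joint (hV : 2 ≤ finrank ℝ V) {f : V → F} (hf : Integrable f (usph V)) :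
    Integrable (fun p : V × V => f p.2) (joint V) :=
  (map_snd_joint hV ▸ hf : Integrable f ((joint V).map Prod.snd)).comp_measurable measurable_snd

lemma ae_integrable_perpMeas (hV : 2 ≤ finrank ℝ V) {f : V → F} (hf : Integrable f (usph V)) :
    ∀ᵐ θ ∂usph V, Integrable f (perpMeas θ) := by
  have : Nontrivial V := Module.nontrivial_of_finrank_pos (R := ℝ) (by omega)
  have h := integrable_snd_joint hV hf
  rw [joint_eq_compProd] at h
  exact ((Measure.integrable_compProd_iff h.1).1 h).1

lemma integrable_perpMean (hV : 2 ≤ finrank ℝ V) {f : V → F} (hf : Integrable f (usph V)) :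
    Integrable (perpMean f) (usph V) := by
  have : Nontrivial V := Module.nontrivial_of_finrank_pos (R := ℝ) (by omega)
  have h := integrable_snd_joint hV hf
  rw [joint_eq_compProd] at h
  have h2 := h.integral_compProd
  simp only [ProbabilityTheory.Kernel.const_apply, ProbabilityTheory.Kernel.prodMkLeft_apply] at h2
  exact h2

lemma perpMean_congr (hV : 2 ≤ finrank ℝ V) {f g : V → F} (hfg : f =ᵐ[usph V] g) :
    perpMean f =ᵐ[usph V] perpMean g := by
  have : Nontrivial V := Module.nontrivial_of_finrank_pos (R := ℝ) (by omega)
  have h : ∀ᵐ p ∂joint V, f p.2 = g p.2 := by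
    rw [← map_snd_joint hV] at hfg
    exact ae_of_ae_map measurable_snd.aemeasurable hfg
  rw [joint_eq_compProd] at h
  filter_upwards [Measure.ae_ae_of_ae_compProd h] with θ hθ
  exact integral_congr_ae hθ

/-- Fubini on orthonormal pairs in the two orders. The weight `a` may be unbounded (as `zonalWeight`
is for `n = 2`); integrability on pairs comes from the bound on its mean `b`, since integrating
`a(v) ‖f(w)‖` over `v` leaves `b(w) ‖f(w)‖`. -/
lemma integral_smul_perpMean [CompleteSpace F] (hV : 2 ≤ finrank ℝ V) {f : V → F} (hf : Integrable f (usph V))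
    {a b : V → ℝ} (ha : Measurable a) (ha0 : ∀ v, 0 ≤ a v)
    (hab : ∀ᵐ w ∂usph V, ∫⁻ v, ENNReal.ofReal (a v) ∂perpMeas w = ENNReal.ofReal (b w))
    (hb : Measurable b) (hb0 : ∀ v, 0 ≤ b v) {C : ℝ} (hbC : ∀ v, b v ≤ C) :
    Integrable (fun v => a v • perpMean f v) (usph V) ∧
      ∫ v, a v • perpMean f v ∂usph V = ∫ w, b w • f w ∂usph V := by
  have : Nontrivial V := Module.nontrivial_of_finrank_pos (R := ℝ) (by omega)
  have hae : AEStronglyMeasurable (fun p : V × V => a p.2 • f p.1) (joint V) := by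
    refine (ha.comp measurable_snd).aestronglyMeasurable.smul ?_
    have h1 : AEStronglyMeasurable f ((joint V).map Prod.fst) := map_fst_joint (V := V) ▸ hf.1
    exact h1.comp_measurable measurable_fst
  have hnorm : ∀ᵐ w ∂usph V, ∫⁻ v, ‖a v • f w‖ₑ ∂perpMeas w = ‖b w • f w‖ₑ := by
    filter_upwards [hab] with w hw
    simp_rw [enorm_smul, Real.enorm_of_nonneg (ha0 _), Real.enorm_of_nonneg (hb0 _)]
    rw [lintegral_mul_const _ ha.ennreal_ofReal, hw]
  have hbf : Integrable (fun w => b w • f w) (usph V) :=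
    hf.bdd_smul C hb.aestronglyMeasurable (Eventually.of_forall fun v => by
      rw [Real.norm_of_nonneg (hb0 v)]; exact hbC v)
  have hint : Integrable (fun p : V × V => a p.2 • f p.1) (joint V) := by
    rw [joint_eq_compProd] at hae ⊢
    rw [Measure.integrable_compProd_iff hae]
    have hfin : ∀ᵐ w ∂usph V, Integrable (fun v => a v • f w) (perpMeas w) := by
      filter_upwards [hnorm] with w hw
      refine ⟨ha.aestronglyMeasurable.smul_const _, ?_⟩
      rw [HasFiniteIntegral, hw]
      exact enorm_lt_top
    refine ⟨hfin, hbf.norm.congr ?_⟩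
    filter_upwards [hnorm, hfin] with w hw hw2
    rw [perpKernel_apply, integral_norm_eq_lintegral_enorm hw2.1, hw, toReal_enorm]
  have hint2 : Integrable (fun p : V × V => a p.1 • f p.2) (joint V) := by
    rw [← map_swap_joint hV] at hint
    exact hint.comp_measurable measurable_swap
  have e1 : ∫ p, a p.1 • f p.2 ∂joint V = ∫ v, a v • perpMean f v ∂usph V := by
    rw [joint_eq_compProd] at hint2 ⊢
    rw [Measure.integral_compProd hint2]
    simp_rw [integral_smul]
    rfl
  have e2 : ∫ p, a p.2 • f p.1 ∂joint V = ∫ w, b w • f w ∂usph V := by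
    rw [joint_eq_compProd] at hint ⊢
    rw [Measure.integral_compProd hint]
    refine integral_congr_ae ?_
    filter_upwards [hab] with w hw
    rw [integral_smul_const, perpKernel_apply,
      integral_eq_lintegral_of_nonneg_ae (Eventually.of_forall ha0) ha.aestronglyMeasurable, hw,
      ENNReal.toReal_ofReal (hb0 w)]
  have e3 : ∫ p, a p.1 • f p.2 ∂joint V = ∫ p, a p.2 • f p.1 ∂joint V := by
    conv_rhs => rw [← map_swap_joint hV]
    rw [integral_map measurable_swap.aemeasurable (by rw [map_swap_joint hV]; exact hae)]
    rfl
  refine ⟨?_, by rw [← e1, e3, e2]⟩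
  rw [joint_eq_compProd] at hint2
  have := hint2.integral_compProd
  simpa [integral_smul, perpMean, perpKernel_apply] using this

lemma ae_inner_mem (hV : 2 ≤ finrank ℝ V) {θ : V} (hθ : ‖θ‖ = 1) :
    ∀ᵐ w ∂usph V, inner ℝ w θ ∈ Ioo (-1 : ℝ) 1 ∧ inner ℝ w θ ≠ 0 := by
  have h : ∀ᵐ u ∂sliceProb (finrank ℝ V), u ∈ Ioo (-1 : ℝ) 1 ∧ u ≠ 0 := by
    have h0 : ∀ᵐ u : ℝ ∂sliceProb (finrank ℝ V), u ≠ 0 := by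
      refine Measure.ae_smul_measure ?_ _
      refine (withDensity_absolutelyContinuous _ _).ae_le (ae_restrict_of_ae ?_)
      exact Measure.ae_ne volume 0
    filter_upwards [ae_mem_sliceProb (finrank ℝ V), h0] with u h1 h2 using ⟨h1, h2⟩
  rw [← map_inner_usph hθ hV] at h
  exact ae_of_ae_map (by fun_prop) h

lemma zonalDual_nonneg {n : ℕ} {t : ℝ} (ht : t < 1) (p : ℝ) : 0 ≤ zonalDual n t p := by
  unfold zonalDual
  split_ifs with h
  · have h1 : 0 < 1 - p ^ 2 := by
      have := sq_abs p
      nlinarith [abs_nonneg p]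
    have h2 := sub_pos.2 h
    positivity
  · exact le_rfl

lemma zonalDual_le {n : ℕ} (hn : 2 ≤ n) {t : ℝ} (ht : t ∈ Ioo (0 : ℝ) 1) (p : ℝ) :
    zonalDual n t p ≤ ((1 - t ^ 2) ^ (((n : ℝ) - 2) / 2))⁻¹ := by
  have ht2 : 0 < 1 - t ^ 2 := by nlinarith [ht.1, ht.2]
  have hn' : (2 : ℝ) ≤ n := by exact_mod_cast hn
  unfold zonalDual
  split_ifs with h
  · have h1 : 1 - t ^ 2 ≤ 1 - p ^ 2 := by
      have := sq_abs p
      nlinarith [abs_nonneg p]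
    have h2 : (t - |p|) ^ (n - 2) ≤ 1 :=
      pow_le_one₀ (sub_nonneg.2 h.le) (by linarith [abs_nonneg p, ht.2])
    have h3 : ((1 - p ^ 2) ^ (((n : ℝ) - 2) / 2))⁻¹ ≤ ((1 - t ^ 2) ^ (((n : ℝ) - 2) / 2))⁻¹ := by
      refine inv_anti₀ (by positivity) ?_
      exact Real.rpow_le_rpow ht2.le h1 (by linarith)
    have h4 : 0 ≤ ((1 - p ^ 2) ^ (((n : ℝ) - 2) / 2))⁻¹ :=
      inv_nonneg.2 (Real.rpow_nonneg (by linarith) _)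
    nlinarith
  · positivity

lemma zonalDual_abs (n : ℕ) (t p : ℝ) : zonalDual n t |p| = zonalDual n t p := by
  simp [zonalDual]

lemma lintegral_perpMeas_zonalWeight {n : ℕ} (hn : 2 ≤ n) (hV : finrank ℝ V = n + 1) {t : ℝ}
    (ht : t ∈ Ioo (0 : ℝ) 1) {θ : V} (hθ : ‖θ‖ = 1) :
    ∀ᵐ w ∂usph V, ∫⁻ v, ENNReal.ofReal (zonalWeight n t (inner ℝ v θ)) ∂perpMeas w =
      ENNReal.ofReal (zonalDual n t (inner ℝ w θ)) := by
  filter_upwards [ae_norm_usph (V := V), ae_inner_mem (by omega) hθ] with w hw hwθ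
  have hm := (measurable_zonalWeight n t).ennreal_ofReal
  have h1 := lintegral_map (μ := perpMeas w) hm
    (by fun_prop : Measurable fun v : V => (inner ℝ v θ : ℝ))
  rw [← h1, map_inner_perpMeas hw hθ (by omega) hwθ.1, lintegral_map hm (by fun_prop),
    show finrank ℝ V - 1 = n by omega, ← zonalDual_abs, ← sq_abs]
  exact lintegral_zonalWeight hn ht ⟨abs_pos.2 hwθ.2, abs_lt.2 hwθ.1⟩

/-- The Funk transform is self-adjoint: the case of zonal functions. -/
lemma integral_zonalWeight_smul [CompleteSpace F] {n : ℕ} (hn : 2 ≤ n) (hV : finrank ℝ V = n + 1) {t : ℝ}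
    (ht : t ∈ Ioo (0 : ℝ) 1) {θ : V} (hθ : ‖θ‖ = 1) {f φ : V → F} (hf : Integrable f (usph V))
    (hφ : φ =ᵐ[usph V] perpMean f) :
    Integrable (fun v => zonalWeight n t (inner ℝ v θ) • φ v) (usph V) ∧
      Integrable (fun v => zonalDual n t (inner ℝ v θ) • f v) (usph V) ∧
      ∫ v, zonalWeight n t (inner ℝ v θ) • φ v ∂usph V =
        ∫ w, zonalDual n t (inner ℝ w θ) • f w ∂usph V := by
  have hb : Measurable fun w : V => zonalDual n t (inner ℝ w θ) :=
    (measurable_zonalDual n t).fun_comp (by fun_prop)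
  have h := integral_smul_perpMean (by omega) hf
    (a := fun v => zonalWeight n t (inner ℝ v θ)) (b := fun w => zonalDual n t (inner ℝ w θ))
    ((measurable_zonalWeight n t).fun_comp (by fun_prop)) (fun v => zonalWeight_nonneg n _)
    (lintegral_perpMeas_zonalWeight hn hV ht hθ) hb
    (fun v => zonalDual_nonneg ht.2 _) (fun v => zonalDual_le hn ht _)
  have hc : (fun v => zonalWeight n t (inner ℝ v θ) • φ v) =ᵐ[usph V]
      fun v => zonalWeight n t (inner ℝ v θ) • perpMean f v := by
    filter_upwards [hφ] with v hv
    rw [hv]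
  refine ⟨h.1.congr hc.symm, ?_, (integral_congr_ae hc).trans h.2⟩
  exact hf.bdd_smul _ hb.aestronglyMeasurable (Eventually.of_forall fun v => by
      rw [Real.norm_of_nonneg (zonalDual_nonneg ht.2 _)]; exact zonalDual_le hn ht _)

end FunkDuality

/-! ### Integration over the sphere by slices -/

section Slices

variable {V : Type*} [NormedAddCommGroup V] [InnerProductSpace ℝ V] [FiniteDimensional ℝ V]
  [MeasurableSpace V] [BorelSpace V] {F : Type*} [NormedAddCommGroup F] [NormedSpace ℝ F]

lemma volume_absolutelyContinuous_sliceProb {d : ℕ} (hd : 2 ≤ d) :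
    volume.restrict (Ioo (-1 : ℝ) 1) ≪ sliceProb d := by
  refine Measure.AbsolutelyContinuous.smul_right ?_ ?_
  · refine withDensity_absolutelyContinuous' (measurable_sliceDensity _).aemeasurable ?_
    filter_upwards [ae_restrict_mem measurableSet_Ioo] with u hu
    simpa using Real.rpow_pos_of_pos (one_sub_sq_pos hu) _
  · exact ENNReal.inv_ne_zero.2 (sliceMeas_univ_ne_top hd)

lemma integrable_sliceMeas_iff (d : ℕ) (g : ℝ → F) :
    Integrable g (sliceMeas d) ↔
      IntegrableOn (fun u => (1 - u ^ 2) ^ (((d : ℝ) - 3) / 2) • g u) (Ioo (-1) 1) := by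
  have hm : AEMeasurable (fun u : ℝ => ((1 - u ^ 2) ^ (((d : ℝ) - 3) / 2)).toNNReal)
    (volume.restrict (Ioo (-1 : ℝ) 1)) := by fun_prop
  have := integrable_withDensity_iff_integrable_smul₀ hm (g := g)
  rw [sliceMeas]
  refine this.trans (integrable_congr ?_)
  filter_upwards [ae_restrict_mem measurableSet_Ioo] with u hu
  rw [NNReal.smul_def, Real.coe_toNNReal _ (Real.rpow_nonneg (one_sub_sq_pos hu).le _)]

lemma integral_sliceMeas (d : ℕ) (g : ℝ → F) :
    ∫ u, g u ∂sliceMeas d =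
      ∫ u in Ioo (-1 : ℝ) 1, (1 - u ^ 2) ^ (((d : ℝ) - 3) / 2) • g u := by
  have hm : AEMeasurable (fun u : ℝ => ((1 - u ^ 2) ^ (((d : ℝ) - 3) / 2)).toNNReal)
    (volume.restrict (Ioo (-1 : ℝ) 1)) := by fun_prop
  have := integral_withDensity_eq_integral_smul₀ hm g
  rw [sliceMeas]
  refine this.trans (integral_congr_ae ?_)
  filter_upwards [ae_restrict_mem measurableSet_Ioo] with u hu
  rw [NNReal.smul_def, Real.coe_toNNReal _ (Real.rpow_nonneg (one_sub_sq_pos hu).le _)]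

lemma measurable_smul_add (θ : V) :
    Measurable fun p : V × ℝ => p.2 • θ + √(1 - p.2 ^ 2) • p.1 := by fun_prop

lemma integrable_slices {θ : V} (hθ : ‖θ‖ = 1) (hV : 2 ≤ finrank ℝ V) {g : V → F}
    (hg : Integrable g (usph V)) :
    Integrable (fun p : V × ℝ => g (p.2 • θ + √(1 - p.2 ^ 2) • p.1))
      ((perpMeas θ).prod (sliceProb (finrank ℝ V))) := by
  rw [usph_eq_map_perpMeas hθ hV] at hg
  exact hg.comp_measurable (measurable_smul_add θ)

lemma ae_integrable_slice {θ : V} (hθ : ‖θ‖ = 1) (hV : 2 ≤ finrank ℝ V) {g : V → F}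
    (hg : Integrable g (usph V)) : ∀ᵐ u : ℝ, u ∈ Ioo (-1 : ℝ) 1 →
      Integrable (fun y => g (u • θ + √(1 - u ^ 2) • y)) (perpMeas θ) := by
  have h := (integrable_slices hθ hV hg).prod_left_ae
  rw [← ae_restrict_iff' measurableSet_Ioo]
  exact (volume_absolutelyContinuous_sliceProb hV).ae_le h

lemma integral_usph_eq_slices {θ : V} (hθ : ‖θ‖ = 1) (hV : 2 ≤ finrank ℝ V) {g : V → F}
    (hg : Integrable g (usph V)) :
    IntegrableOn (fun u => (1 - u ^ 2) ^ (((finrank ℝ V : ℝ) - 3) / 2) • sliceMean g θ u)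
      (Ioo (-1) 1) ∧
    ∫ v, g v ∂usph V = ((sliceMeas (finrank ℝ V) univ)⁻¹).toReal •
      ∫ u in Ioo (-1 : ℝ) 1, (1 - u ^ 2) ^ (((finrank ℝ V : ℝ) - 3) / 2) • sliceMean g θ u := by
  have h := integrable_slices hθ hV hg
  constructor
  · rw [← integrable_sliceMeas_iff]
    have h1 := h.integral_prod_right
    rw [sliceProb] at h1
    exact (integrable_smul_measure (ENNReal.inv_ne_zero.2 (sliceMeas_univ_ne_top hV))
      (ENNReal.inv_ne_top.2 (sliceMeas_univ_ne_zero _))).1 h1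
  · rw [← integral_sliceMeas, ← integral_smul_measure]
    have hg' := hg.1
    rw [usph_eq_map_perpMeas hθ hV] at hg'
    conv_lhs => rw [usph_eq_map_perpMeas hθ hV]
    rw [integral_map (measurable_smul_add θ).aemeasurable hg', integral_prod_symm _ h]
    rfl

end Slices

/-! ### From the mean values of `F f` to those of `f` -/

section Inversion

variable {V : Type*} [NormedAddCommGroup V] [InnerProductSpace ℝ V] [FiniteDimensional ℝ V]
  [MeasurableSpace V] [BorelSpace V] {F : Type*} [NormedAddCommGroup F] [NormedSpace ℝ F]

lemma map_neg_sph [Nontrivial V] : (sph V).map Neg.neg = sph V := by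
  refine Measure.ext_of_lintegral _ fun g hg => ?_
  rw [lintegral_map hg measurable_neg, ← ENNReal.mul_left_inj
    (radialConst_ne_zero (finrank ℝ V - 1)) (radialConst_ne_top (finrank ℝ V - 1)),
    lintegral_sph_mul_radialConst (hg.fun_comp measurable_neg), lintegral_sph_mul_radialConst hg,
    ← lintegral_neg_eq_self]
  simp

lemma map_neg_usph [Nontrivial V] : (usph V).map Neg.neg = usph V := by
  rw [usph, Measure.map_smul, map_neg_sph]

lemma perpProj_neg (θ w : V) : perpProj θ (-w) = -perpProj θ w := by
  have h : -w - inner ℝ (-w) θ • θ = -(w - inner ℝ w θ • θ) := by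
    rw [inner_neg_left, neg_smul]; abel
  rw [perpProj, h, norm_neg, smul_neg, perpProj]

lemma map_neg_perpMeas [Nontrivial V] (θ : V) : (perpMeas θ).map Neg.neg = perpMeas θ := by
  rw [perpMeas, Measure.map_map measurable_neg (measurable_perpProj_right θ)]
  conv_rhs => rw [← map_neg_usph, Measure.map_map (measurable_perpProj_right θ) measurable_neg]
  congr 1
  ext1 w
  simp [perpProj_neg]

lemma sliceMean_neg [Nontrivial V] {f : V → F} (hf : ∀ v, f (-v) = f v) (θ : V) (u : ℝ) :
    sliceMean f θ (-u) = sliceMean f θ u := by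
  unfold sliceMean
  conv_rhs => rw [← map_neg_perpMeas]
  rw [show (Neg.neg : V → V) = Homeomorph.neg V from rfl,
    (Homeomorph.neg V).measurableEmbedding.integral_map]
  refine integral_congr_ae (Eventually.of_forall fun y => ?_)
  change f (-u • θ + √(1 - (-u) ^ 2) • y) = f (u • θ + √(1 - u ^ 2) • -y)
  rw [← hf, neg_sq]
  congr 1
  module

lemma image_sqrt_Ioo {t : ℝ} (ht : t ∈ Ioo (0 : ℝ) 1) :
    (fun s => √(1 - s ^ 2)) '' Ioo 0 t = Ioo (√(1 - t ^ 2)) 1 := by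
  apply Subset.antisymm
  · rintro _ ⟨s, hs, rfl⟩
    have hs0 : 0 < s := hs.1
    have := hs.2
    have := ht.2
    constructor
    · exact Real.sqrt_lt_sqrt (by nlinarith) (by nlinarith)
    · exact (Real.sqrt_lt' one_pos).2 (by nlinarith)
  · intro c hc
    have hc0 : 0 < c := lt_of_le_of_lt (Real.sqrt_nonneg _) hc.1
    have h2 : 1 - t ^ 2 < c ^ 2 := Real.lt_sq_of_sqrt_lt hc.1
    have h3 : c ^ 2 < 1 := by nlinarith [hc.2]
    refine ⟨√(1 - c ^ 2), ⟨Real.sqrt_pos.2 (by linarith), (Real.sqrt_lt' ht.1).2 (by linarith)⟩, ?_⟩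
    simp only
    rw [Real.sq_sqrt (by linarith), sub_sub_cancel, Real.sqrt_sq hc0.le]

lemma hasDerivAt_sqrt_one_sub_sq {s : ℝ} (hs : s ∈ Ioo (0 : ℝ) 1) :
    HasDerivAt (fun s : ℝ => √(1 - s ^ 2)) (-(s / √(1 - s ^ 2))) s := by
  have h : 0 < 1 - s ^ 2 := by nlinarith [hs.1, hs.2]
  have h1 : HasDerivAt (fun u : ℝ => 1 - u ^ 2) (-(2 * s)) s := by
    simpa using ((hasDerivAt_id s).pow 2).const_sub 1
  refine (h1.sqrt h.ne').congr_deriv ?_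
  field_simp

lemma injOn_sqrt_one_sub_sq : InjOn (fun s : ℝ => √(1 - s ^ 2)) (Ioo 0 1) := by
  refine StrictAntiOn.injOn fun a ha b hb hab => ?_
  exact Real.sqrt_lt_sqrt (by nlinarith [hb.1, hb.2]) (by nlinarith [ha.1])

/-- Substitution `u = √(1 - s²)`, for which `u du = -s ds`. It passes from the height `u` of a slice
to its radius `s`, the variable of the inversion formula. -/
lemma integral_comp_sqrt {t : ℝ} (ht : t ∈ Ioo (0 : ℝ) 1) (α : ℝ) (Ψ : ℝ → F) :
    (IntegrableOn (fun u => ((t ^ 2 - (1 - u ^ 2)) ^ α * u) • Ψ u) (Ioo (√(1 - t ^ 2)) 1) ↔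
      IntegrableOn (fun s => ((t ^ 2 - s ^ 2) ^ α * s) • Ψ (√(1 - s ^ 2))) (Ioo 0 t)) ∧
    ∫ u in Ioo (√(1 - t ^ 2)) 1, ((t ^ 2 - (1 - u ^ 2)) ^ α * u) • Ψ u =
      ∫ s in Ioo 0 t, ((t ^ 2 - s ^ 2) ^ α * s) • Ψ (√(1 - s ^ 2)) := by
  have hsub : Ioo 0 t ⊆ Ioo (0 : ℝ) 1 := Ioo_subset_Ioo_right ht.2.le
  have hderiv : ∀ s ∈ Ioo 0 t, HasDerivWithinAt (fun s : ℝ => √(1 - s ^ 2))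
      (-(s / √(1 - s ^ 2))) (Ioo 0 t) s := fun s hs =>
    (hasDerivAt_sqrt_one_sub_sq (hsub hs)).hasDerivWithinAt
  have hinj := injOn_sqrt_one_sub_sq.mono hsub
  have hK : ∀ s ∈ Ioo 0 t, |(-(s / √(1 - s ^ 2)))| •
      ((t ^ 2 - (1 - √(1 - s ^ 2) ^ 2)) ^ α * √(1 - s ^ 2)) • Ψ (√(1 - s ^ 2)) =
      ((t ^ 2 - s ^ 2) ^ α * s) • Ψ (√(1 - s ^ 2)) := fun s hs => by
    have hs0 : 0 < s := hs.1
    have h : 0 < 1 - s ^ 2 := by nlinarith [(hsub hs).2]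
    have hr := Real.sqrt_pos.2 h
    rw [Real.sq_sqrt h.le, sub_sub_cancel, abs_neg, abs_of_pos (by positivity), smul_smul]
    congr 1
    field_simp
  rw [← image_sqrt_Ioo ht, integrableOn_image_iff_integrableOn_abs_deriv_smul measurableSet_Ioo
    hderiv hinj, integral_image_eq_integral_abs_deriv_smul measurableSet_Ioo hderiv hinj]
  exact ⟨integrableOn_congr_fun hK measurableSet_Ioo, setIntegral_congr_fun measurableSet_Ioo hK⟩

lemma sliceMean_smul (hV : 2 ≤ finrank ℝ V) {θ : V} (hθ : ‖θ‖ = 1) (a : ℝ → ℝ) (φ : V → F)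
    (u : ℝ) :
    sliceMean (fun v => a (inner ℝ v θ) • φ v) θ u = a u • sliceMean φ θ u := by
  unfold sliceMean
  rw [← integral_smul]
  refine integral_congr_ae ?_
  filter_upwards [ae_perpMeas hθ hV] with y hy
  rw [inner_smul_add_left hθ hy.2]

lemma setIntegral_Ioo_even {t : ℝ} (ht : 0 ≤ t) {G : ℝ → F} (hG : ∀ p, G (-p) = G p)
    (hi : IntegrableOn G (Ioo (-t) t)) :
    ∫ p in Ioo (-t) t, G p = (2 : ℝ) • ∫ p in Ioo 0 t, G p := by
  have h1 : IntervalIntegrable G volume (-t) t := by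
    rw [intervalIntegrable_iff_integrableOn_Ioo_of_le (by linarith)]; exact hi
  have h2 : IntervalIntegrable G volume (-t) 0 :=
    h1.mono_set (by rw [uIcc_of_le (by linarith), uIcc_of_le (by linarith)]
                    exact Icc_subset_Icc_right ht)
  have h3 : IntervalIntegrable G volume 0 t :=
    h1.mono_set (by rw [uIcc_of_le (by linarith), uIcc_of_le (by linarith)]
                    exact Icc_subset_Icc_left (by linarith))
  rw [← integral_Ioc_eq_integral_Ioo, ← integral_Ioc_eq_integral_Ioo,
    ← intervalIntegral.integral_of_le (by linarith), ← intervalIntegral.integral_of_le ht,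
    ← intervalIntegral.integral_add_adjacent_intervals h2 h3, two_smul]
  congr 1
  have := intervalIntegral.integral_comp_neg (a := 0) (b := t) G
  simp only [hG, neg_zero] at this
  exact this.symm

/-- The duality for `zonalWeight`, with both sides cut into slices around `θ`. The slice density
cancels the powers of `1 - u²` in `zonalWeight` and in `zonalDual`. As `f` is even, the integral
over `(-t, t)` is twice that over `(0, t)`, which removes the factor `1/2` of `zonalDual`. Since `φ`
enters only through integrals over the whole sphere, a null set does not matter and every `θ` is
allowed. -/
lemma integral_funkIntegrand [CompleteSpace F] {n : ℕ} (hn : 2 ≤ n) (hV : finrank ℝ V = n + 1)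
    {t : ℝ} (ht : t ∈ Ioo (0 : ℝ) 1) {θ : V} (hθ : ‖θ‖ = 1) {f φ : V → F}
    (hf : Integrable f (usph V)) (heven : ∀ v, f (-v) = f v) (hφ : φ =ᵐ[usph V] perpMean f) :
    IntegrableOn (fun s => ((t ^ 2 - s ^ 2) ^ (((n : ℝ) - 3) / 2) * s) •
      sliceMean φ θ (√(1 - s ^ 2))) (Ioo 0 t) ∧
    ∫ s in Ioo 0 t, ((t ^ 2 - s ^ 2) ^ (((n : ℝ) - 3) / 2) * s) • sliceMean φ θ (√(1 - s ^ 2)) =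
      ∫ p in Ioo 0 t, (t - p) ^ (n - 2) • sliceMean f θ p := by
  have hV2 : 2 ≤ finrank ℝ V := by omega
  have : Nontrivial V := Module.nontrivial_of_finrank_pos (R := ℝ) (by omega)
  obtain ⟨hi1, hi2, heq⟩ := integral_zonalWeight_smul hn hV ht hθ hf hφ
  obtain ⟨hs1, he1⟩ := integral_usph_eq_slices hθ hV2 hi1
  obtain ⟨hs2, he2⟩ := integral_usph_eq_slices hθ hV2 hi2
  -- The same normalizing constant occurs on both sides and is cancelled.
  have hc : ((sliceMeas (finrank ℝ V) univ)⁻¹).toReal ≠ 0 := by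
    rw [ENNReal.toReal_ne_zero]
    exact ⟨ENNReal.inv_ne_zero.2 (sliceMeas_univ_ne_top hV2),
      ENNReal.inv_ne_top.2 (sliceMeas_univ_ne_zero _)⟩
  rw [he1, he2, smul_right_inj hc] at heq
  -- The ambient dimension is `n + 1`, which turns the slice exponent `(d-3)/2` into `(n-2)/2`.
  have hexp : ((finrank ℝ V : ℝ) - 3) / 2 = ((n : ℝ) - 2) / 2 := by rw [hV]; push_cast; ring
  simp only [sliceMean_smul hV2 hθ (zonalWeight n t), sliceMean_smul hV2 hθ (zonalDual n t), hexp]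
    at hs1 hs2 heq
  have hr : Ioo (√(1 - t ^ 2)) 1 ⊆ Ioo (-1 : ℝ) 1 :=
    Ioo_subset_Ioo_left (le_trans (by norm_num) (Real.sqrt_nonneg _))
  have ht' : Ioo (-t) t ⊆ Ioo (-1 : ℝ) 1 := Ioo_subset_Ioo (by linarith [ht.2]) ht.2.le
  have k1 : EqOn (fun u => (1 - u ^ 2) ^ (((n : ℝ) - 2) / 2) • zonalWeight n t u • sliceMean φ θ u)
      ((Ioo (√(1 - t ^ 2)) 1).indicator fun u =>
        ((t ^ 2 - (1 - u ^ 2)) ^ (((n : ℝ) - 3) / 2) * u) • sliceMean φ θ u) (Ioo (-1) 1) := by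
    intro u hu
    have h := one_sub_sq_pos hu
    by_cases hu' : u ∈ Ioo (√(1 - t ^ 2)) 1
    · simp only [indicator_of_mem hu', zonalWeight, if_pos (mem_Ioo.1 hu'), smul_smul]
      congr 1
      have : 0 < (1 - u ^ 2) ^ (((n : ℝ) - 2) / 2) := by positivity
      field_simp
    · simp only [indicator_of_notMem hu', zonalWeight, if_neg (fun h => hu' (mem_Ioo.2 h)),
        zero_smul, smul_zero]
  have k2 : EqOn (fun u => (1 - u ^ 2) ^ (((n : ℝ) - 2) / 2) • zonalDual n t u • sliceMean f θ u)
      ((Ioo (-t) t).indicator fun u => ((t - |u|) ^ (n - 2) / 2) • sliceMean f θ u)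
      (Ioo (-1) 1) := by
    intro u hu
    have h := one_sub_sq_pos hu
    by_cases hu' : u ∈ Ioo (-t) t
    · simp only [indicator_of_mem hu', zonalDual, if_pos (abs_lt.2 hu'), smul_smul]
      congr 1
      have : 0 < (1 - u ^ 2) ^ (((n : ℝ) - 2) / 2) := by positivity
      field_simp
    · simp only [indicator_of_notMem hu', zonalDual, if_neg (fun h => hu' (abs_lt.1 h)),
        zero_smul, smul_zero]
  rw [setIntegral_congr_fun measurableSet_Ioo k1, setIntegral_congr_fun measurableSet_Ioo k2,
    setIntegral_indicator measurableSet_Ioo, setIntegral_indicator measurableSet_Ioo,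
    inter_eq_self_of_subset_right hr, inter_eq_self_of_subset_right ht'] at heq
  rw [integrableOn_congr_fun k1 measurableSet_Ioo, IntegrableOn,
    integrable_indicator_iff measurableSet_Ioo, IntegrableOn,
    Measure.restrict_restrict measurableSet_Ioo, inter_eq_self_of_subset_left hr] at hs1
  rw [integrableOn_congr_fun k2 measurableSet_Ioo, IntegrableOn,
    integrable_indicator_iff measurableSet_Ioo, IntegrableOn,
    Measure.restrict_restrict measurableSet_Ioo, inter_eq_self_of_subset_left ht'] at hs2
  obtain ⟨c1, c2⟩ := integral_comp_sqrt ht (((n : ℝ) - 3) / 2) (sliceMean φ θ)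
  refine ⟨c1.1 hs1, ?_⟩
  rw [← c2, heq, setIntegral_Ioo_even ht.1.le (fun p => ?_) hs2, ← integral_smul]
  · refine setIntegral_congr_fun measurableSet_Ioo fun p hp => ?_
    rw [smul_smul, abs_of_pos hp.1, mul_div_cancel₀ _ two_ne_zero]
  · rw [abs_neg, sliceMean_neg heven]

/-- The slice density is continuous and positive on `[0, b]`, so it can be divided out. It may
vanish at 1, hence the restriction `b < 1`. -/
lemma integrableOn_sliceMean {θ : V} (hθ : ‖θ‖ = 1) (hV : 2 ≤ finrank ℝ V) {f : V → F}
    (hf : Integrable f (usph V)) {b : ℝ} (hb : b < 1) :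
    IntegrableOn (sliceMean f θ) (Icc 0 b) := by
  have hsub : Icc 0 b ⊆ Ioo (-1 : ℝ) 1 := fun x hx => ⟨by linarith [hx.1], by linarith [hx.2]⟩
  have h := (integral_usph_eq_slices hθ hV hf).1.mono_set hsub
  have hc : ContinuousOn (fun u : ℝ => ((1 - u ^ 2) ^ (((finrank ℝ V : ℝ) - 3) / 2))⁻¹)
      (Icc 0 b) := by
    intro u hu
    have h1 := one_sub_sq_pos (hsub hu)
    have h2 := (Real.rpow_pos_of_pos h1 (((finrank ℝ V : ℝ) - 3) / 2)).ne'
    refine ContinuousAt.continuousWithinAt (ContinuousAt.inv₀ ?_ h2)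
    exact ContinuousAt.rpow_const (by fun_prop) (Or.inl h1.ne')
  refine (h.continuousOn_smul hc isCompact_Icc).congr_fun (fun u hu => ?_) measurableSet_Icc
  have h1 := Real.rpow_pos_of_pos (one_sub_sq_pos (hsub hu)) (((finrank ℝ V : ℝ) - 3) / 2)
  simp only [smul_smul, inv_mul_cancel₀ h1.ne', one_smul]

end Inversion

/-! ### Derivatives of repeated integrals -/

section RepeatedIntegral

variable {F : Type*} [NormedAddCommGroup F] [NormedSpace ℝ F]

/-- The repeated integral of `M` of order `k + 1`, up to the factor `k!`. -/
def repInt (M : ℝ → F) (k : ℕ) (t : ℝ) : F := ∫ p in Ioo 0 t, (t - p) ^ k • M p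

/-- Replacing `t - p` by its positive part makes the domain independent of `t`, as needed to
differentiate under the integral sign. -/
lemma repInt_eq_integral_max {M : ℝ → F} {k : ℕ} {t b : ℝ} (htb : t ≤ b) :
    repInt M (k + 1) t = ∫ p in Ioo 0 b, (max (t - p) 0) ^ (k + 1) • M p := by
  have h : EqOn (fun p => (max (t - p) 0) ^ (k + 1) • M p)
      ((Ioo 0 t).indicator fun p => (t - p) ^ (k + 1) • M p) (Ioo 0 b) := fun p hp => by
    by_cases hpt : p < t
    · rw [indicator_of_mem (mem_Ioo.2 ⟨hp.1, hpt⟩)]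
      simp only [max_eq_left (sub_nonneg.2 hpt.le)]
    · rw [indicator_of_notMem (fun h => hpt h.2)]
      simp only [max_eq_right (sub_nonpos.2 (not_lt.1 hpt))]
      simp
  rw [setIntegral_congr_fun measurableSet_Ioo h, setIntegral_indicator measurableSet_Ioo,
    inter_eq_self_of_subset_right (Ioo_subset_Ioo_right htb), repInt]

/-- Since `M` is merely integrable, the fundamental theorem of calculus is not available at every
point. But `(t - p)_+^{k+1}` is Lipschitz in `t`, and differentiable except possibly at the single
value `p = t`, so dominated differentiation applies at every `t`. -/
lemma hasDerivAt_repInt_succ {M : ℝ → F} {b : ℝ} (hM : IntegrableOn M (Ioo 0 b)) (k : ℕ) {t : ℝ}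
    (ht : t ∈ Ioo 0 b) :
    HasDerivAt (repInt M (k + 1)) (((k + 1 : ℕ) : ℝ) • repInt M k t) t := by
  have hev : repInt M (k + 1) =ᶠ[𝓝 t] fun t => ∫ p in Ioo 0 b, (max (t - p) 0) ^ (k + 1) • M p := by
    filter_upwards [Iio_mem_nhds ht.2] with s hs
    exact repInt_eq_integral_max (le_of_lt hs)
  refine HasDerivAt.congr_of_eventuallyEq ?_ hev
  have hval : ((k + 1 : ℕ) : ℝ) • repInt M k t = ∫ p in Ioo 0 b,
      (Ioo 0 t).indicator (fun p => (((k + 1 : ℕ) : ℝ) * (t - p) ^ k) • M p) p := by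
    rw [setIntegral_indicator measurableSet_Ioo,
      inter_eq_self_of_subset_right (Ioo_subset_Ioo_right ht.2.le), repInt, ← integral_smul]
    simp_rw [smul_smul]
  rw [hval]
  have hmeas : ∀ s : ℝ, AEStronglyMeasurable (fun p => (max (s - p) 0) ^ (k + 1) • M p)
      (volume.restrict (Ioo 0 b)) := fun s =>
    (by fun_prop : Continuous fun p : ℝ => (max (s - p) 0) ^ (k + 1)).aestronglyMeasurable.smul hM.1
  refine (hasDerivAt_integral_of_dominated_loc_of_lip (bound := fun p => (k + 1 : ℕ) * b ^ k * ‖M p‖)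
    (F := fun s p => (max (s - p) 0) ^ (k + 1) • M p)
    (Ioo_mem_nhds ht.1 ht.2) (Eventually.of_forall hmeas) ?_ ?_ ?_ ?_ ?_).2
  · refine hM.bdd_smul (b ^ (k + 1)) (by fun_prop) ?_
    filter_upwards [ae_restrict_mem measurableSet_Ioo] with p hp
    have h0 : 0 ≤ max (t - p) 0 := le_max_right _ _
    rw [Real.norm_of_nonneg (by positivity)]
    exact pow_le_pow_left₀ h0 (max_le (by linarith [hp.1, ht.2]) (hp.1.trans hp.2).le) _
  · exact ((by fun_prop : Continuous fun p : ℝ => ((k + 1 : ℕ) : ℝ) *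
      (t - p) ^ k).aestronglyMeasurable.smul hM.1).indicator measurableSet_Ioo
  · filter_upwards [ae_restrict_mem measurableSet_Ioo] with p hp
    refine LipschitzOnWith.of_dist_le_mul fun x hx y hy => ?_
    have hb0 : 0 < b := hp.1.trans hp.2
    rw [dist_eq_norm, ← sub_smul, norm_smul, dist_eq_norm, Real.coe_nnabs,
      abs_of_nonneg (by positivity), Real.norm_eq_abs, Real.norm_eq_abs]
    have h1 := abs_pow_sub_pow_le (max (x - p) 0) (max (y - p) 0) (k + 1)
    have hx0 : |max (x - p) 0| ≤ b := by
      rw [abs_of_nonneg (le_max_right _ _)]; exact max_le (by linarith [hp.1, hx.2]) hb0.le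
    have hy0 : |max (y - p) 0| ≤ b := by
      rw [abs_of_nonneg (le_max_right _ _)]; exact max_le (by linarith [hp.1, hy.2]) hb0.le
    have h2 : |max (x - p) 0 - max (y - p) 0| ≤ |x - y| := by
      have := abs_max_sub_max_le_abs (x - p) (y - p) 0
      simpa using this
    have h3 : (max |max (x - p) 0| |max (y - p) 0|) ^ (k + 1 - 1) ≤ b ^ k := by
      rw [Nat.add_sub_cancel]
      exact pow_le_pow_left₀ (le_max_of_le_left (abs_nonneg _)) (max_le hx0 hy0) _
    calc _ ≤ (|x - y| * (k + 1 : ℕ) * b ^ k) * ‖M p‖ := by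
          refine mul_le_mul_of_nonneg_right (h1.trans ?_) (norm_nonneg _)
          gcongr
      _ = _ := by ring
  · exact hM.norm.const_mul _
  · have hne : ∀ᵐ p : ℝ ∂volume.restrict (Ioo 0 b), p ≠ t :=
      ae_restrict_of_ae (Measure.ae_ne volume t)
    filter_upwards [ae_restrict_mem measurableSet_Ioo, hne] with p hp hpt
    rcases lt_or_gt_of_ne hpt with h | h
    · rw [indicator_of_mem (mem_Ioo.2 ⟨hp.1, h⟩)]
      have hd : HasDerivAt (fun s : ℝ => (s - p) ^ (k + 1)) (((k + 1 : ℕ) : ℝ) * (t - p) ^ k) t := by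
        simpa using ((hasDerivAt_id t).sub_const p).fun_pow (k + 1)
      refine (hd.congr_of_eventuallyEq ?_).smul_const (M p)
      filter_upwards [Ioi_mem_nhds h] with s hs
      rw [max_eq_left (sub_nonneg.2 (le_of_lt hs))]
    · rw [indicator_of_notMem (fun h' => lt_asymm h h'.2)]
      refine (hasDerivAt_const t (0 : F)).congr_of_eventuallyEq ?_
      filter_upwards [Iio_mem_nhds h] with s hs
      rw [max_eq_right (sub_nonpos.2 (le_of_lt hs))]
      simp

lemma repInt_zero_eq {M : ℝ → F} {t : ℝ} (ht : 0 ≤ t) : repInt M 0 t = ∫ p in (0 : ℝ)..t, M p := by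
  rw [intervalIntegral.integral_of_le ht, integral_Ioc_eq_integral_Ioo, repInt]
  simp

lemma hasDerivAt_repInt {M : ℝ → F} (hM : ∀ b < 1, IntegrableOn M (Icc 0 b)) (k : ℕ) {t : ℝ}
    (ht : t ∈ Ioo (0 : ℝ) 1) :
    HasDerivAt (repInt M (k + 1)) (((k + 1 : ℕ) : ℝ) • repInt M k t) t := by
  obtain ⟨b, hb1, hb2⟩ := exists_between ht.2
  exact hasDerivAt_repInt_succ ((hM b hb2).mono_set Ioo_subset_Icc_self) k ⟨ht.1, hb1⟩

lemma continuousOn_repInt_zero {M : ℝ → F} (hM : ∀ b < 1, IntegrableOn M (Icc 0 b)) :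
    ContinuousOn (repInt M 0) (Ioo 0 1) := by
  intro t ht
  obtain ⟨b, hb1, hb2⟩ := exists_between ht.2
  have h := intervalIntegral.continuousOn_primitive_interval (μ := volume) (f := M) (a := 0) (b := b)
    (by rw [uIcc_of_le (ht.1.trans hb1).le]; exact hM b hb2)
  rw [uIcc_of_le (ht.1.trans hb1).le] at h
  have h2 : ContinuousAt (fun x => ∫ p in (0 : ℝ)..x, M p) t :=
    h.continuousAt (Icc_mem_nhds ht.1 hb1)
  refine (h2.congr ?_).continuousWithinAt
  filter_upwards [Ioi_mem_nhds ht.1] with s hs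
  exact (repInt_zero_eq (le_of_lt hs)).symm

lemma contDiffOn_repInt {M : ℝ → F} (hM : ∀ b < 1, IntegrableOn M (Icc 0 b)) (k : ℕ) :
    ContDiffOn ℝ (k : WithTop ℕ∞) (repInt M k) (Ioo 0 1) := by
  induction k with
  | zero => simpa using continuousOn_repInt_zero hM
  | succ k ih =>
    have hd := fun t ht => hasDerivAt_repInt hM k (t := t) ht
    rw [Nat.cast_succ, contDiffOn_succ_iff_deriv_of_isOpen isOpen_Ioo]
    refine ⟨fun t ht => (hd t ht).differentiableAt.differentiableWithinAt, by simp, ?_⟩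
    exact (ih.const_smul ((k + 1 : ℕ) : ℝ)).congr fun t ht => (hd t ht).deriv

lemma iteratedDeriv_repInt {M : ℝ → F} (hM : ∀ b < 1, IntegrableOn M (Icc 0 b)) {m : ℕ}
    {P : ℝ → F} (hP : EqOn P (fun t => ((m.factorial : ℝ))⁻¹ • repInt M m t) (Ioo 0 1)) {k : ℕ}
    (hk : k ≤ m) : EqOn (iteratedDeriv k P)
      (fun t => (((m - k).factorial : ℝ))⁻¹ • repInt M (m - k) t) (Ioo 0 1) := by
  induction k with
  | zero => simpa using hP
  | succ k ih =>
    intro t ht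
    have hev := (ih (by omega)).eventuallyEq_of_mem (isOpen_Ioo.mem_nhds ht)
    rw [iteratedDeriv_succ, hev.deriv_eq]
    obtain ⟨j, hj⟩ : ∃ j, m - k = j + 1 := ⟨m - k - 1, by omega⟩
    have hj' : m - (k + 1) = j := by omega
    rw [hj, hj']
    refine (((hasDerivAt_repInt hM j ht).const_smul _).congr_deriv ?_).deriv
    rw [smul_smul, Nat.factorial_succ]
    congr 1
    have : (j.factorial : ℝ) ≠ 0 := by positivity
    push_cast
    field_simp

/-- Lebesgue differentiation on the intervals `[0, 1 - 1/(k+1)]`, which exhaust `[0, 1)`; `M` need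
not be integrable up to 1. -/
lemma ae_hasDerivAt_repInt_zero [CompleteSpace F] {M : ℝ → F}
    (hM : ∀ b < 1, IntegrableOn M (Icc 0 b)) :
    ∀ᵐ t : ℝ, t ∈ Ioo (0 : ℝ) 1 → HasDerivAt (repInt M 0) (M t) t := by
  have h : ∀ k : ℕ, ∀ᵐ t : ℝ, t ∈ Ioo (0 : ℝ) (1 - 1 / (k + 1)) →
      HasDerivAt (repInt M 0) (M t) t := fun k => by
    have hb : (0 : ℝ) ≤ 1 - 1 / ((k : ℝ) + 1) := by
      rw [sub_nonneg, div_le_one (by positivity)]; linarith [(Nat.cast_nonneg k : (0 : ℝ) ≤ k)]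
    have hi : IntervalIntegrable M volume 0 (1 - 1 / ((k : ℝ) + 1)) := by
      rw [intervalIntegrable_iff_integrableOn_Icc_of_le hb]
      exact hM _ (by have : (0 : ℝ) < 1 / ((k : ℝ) + 1) := by positivity
                     linarith)
    filter_upwards [hi.ae_hasDerivAt_integral] with t ht ht'
    have h1 := ht (by rw [uIcc_of_le hb]; exact Ioo_subset_Icc_self ht') 0
      (by simp)
    refine h1.congr_of_eventuallyEq ?_
    filter_upwards [Ioi_mem_nhds ht'.1] with s hs
    exact repInt_zero_eq (le_of_lt hs)
  filter_upwards [ae_all_iff.2 h] with t ht ht'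
  obtain ⟨k, hk⟩ := exists_nat_one_div_lt (sub_pos.2 ht'.2)
  exact ht k ⟨ht'.1, by linarith⟩

end RepeatedIntegral

/-! ### Lebesgue differentiation with a parameter -/

section Swap

variable {F : Type*} [NormedAddCommGroup F] [NormedSpace ℝ F]

/-- The derivative of `Q` at `t` along rational increments is `m`. -/
def HasRatDeriv (Q : ℝ → F) (m : F) (t : ℝ) : Prop :=
  ∀ k : ℕ, ∃ j : ℕ, ∀ r : ℚ, |(r : ℝ)| < 1 / (j + 1) →
    ‖Q (t + r) - Q t - (r : ℝ) • m‖ ≤ |(r : ℝ)| * (1 / (k + 1))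

lemma hasRatDeriv_of_hasDerivAt {Q : ℝ → F} {m : F} {t : ℝ} (h : HasDerivAt Q m t) :
    HasRatDeriv Q m t := by
  intro k
  have h1 := (hasDerivAt_iff_isLittleO_nhds_zero.1 h).def (c := 1 / ((k : ℝ) + 1)) (by positivity)
  obtain ⟨ε, hε, hball⟩ := Metric.eventually_nhds_iff.1 h1
  obtain ⟨j, hj⟩ := exists_nat_one_div_lt hε
  refine ⟨j, fun r hr => ?_⟩
  have := hball (y := (r : ℝ)) (by rw [dist_zero_right]; exact hr.trans hj)
  rw [mul_comm]
  exact this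

/-- For continuous `Q` the difference estimate passes from the dense set of rational increments to
all small increments. -/
lemma hasDerivAt_of_hasRatDeriv {Q : ℝ → F} {m : F} {t : ℝ} {U : Set ℝ} (hU : IsOpen U)
    (ht : t ∈ U) (hQ : ContinuousOn Q U) (h : HasRatDeriv Q m t) : HasDerivAt Q m t := by
  rw [hasDerivAt_iff_isLittleO_nhds_zero, Asymptotics.isLittleO_iff]
  intro c hc
  obtain ⟨k, hk⟩ := exists_nat_one_div_lt hc
  obtain ⟨j, hj⟩ := h k
  have hV : ∀ᶠ r : ℝ in 𝓝 0, t + r ∈ U ∧ |r| < 1 / (j + 1) := by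
    refine Filter.Eventually.and ?_ ?_
    · have : Tendsto (fun r : ℝ => t + r) (𝓝 0) (𝓝 t) := by
        simpa using (continuous_const.add continuous_id).tendsto (0 : ℝ) (f := fun r : ℝ => t + r)
      exact this (hU.mem_nhds ht)
    · have : Tendsto (fun r : ℝ => |r|) (𝓝 0) (𝓝 0) := by
        simpa using continuous_abs.tendsto (0 : ℝ)
      exact this.eventually_lt_const (by positivity)
  have hO : IsOpen {r : ℝ | t + r ∈ U ∧ |r| < 1 / (j + 1)} :=
    (hU.preimage (by fun_prop : Continuous fun r : ℝ => t + r)).inter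
      (isOpen_lt continuous_abs continuous_const)
  filter_upwards [hV] with r hr
  have hcont : ContinuousAt (fun r : ℝ => ‖Q (t + r) - Q t - r • m‖) r := by
    have h1 : ContinuousAt Q (t + r) := hQ.continuousAt (hU.mem_nhds hr.1)
    have h2 : ContinuousAt (fun r : ℝ => Q (t + r)) r :=
      ContinuousAt.comp (g := Q) h1 (by fun_prop)
    exact ((h2.sub continuousAt_const).sub (by fun_prop)).norm
  have hne : (𝓝[range ((↑) : ℚ → ℝ)] r).NeBot :=
    mem_closure_iff_nhdsWithin_neBot.1 (Rat.denseRange_cast r)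
  have hle : ‖Q (t + r) - Q t - r • m‖ ≤ |r| * (1 / (k + 1)) := by
    refine le_of_tendsto_of_tendsto (b := 𝓝[range ((↑) : ℚ → ℝ)] r)
      (hcont.tendsto.mono_left nhdsWithin_le_nhds)
      (g := fun r => |r| * (1 / ((k : ℝ) + 1)))
      (((by fun_prop : Continuous fun r : ℝ => |r| * (1 / ((k : ℝ) + 1))).tendsto r).mono_left
        nhdsWithin_le_nhds) ?_
    filter_upwards [self_mem_nhdsWithin, nhdsWithin_le_nhds (hO.mem_nhds hr)]
    rintro _ ⟨x, rfl⟩ hx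
    exact hj x hx.2
  rw [Real.norm_eq_abs, mul_comm]
  exact hle.trans (mul_le_mul_of_nonneg_left hk.le (abs_nonneg _))

variable {α : Type*} [MeasurableSpace α]

lemma stronglyMeasurable_repInt_zero {M : α × ℝ → F} (hM : StronglyMeasurable M) :
    StronglyMeasurable fun x : α × ℝ => repInt (fun p => M (x.1, p)) 0 x.2 := by
  have h : StronglyMeasurable fun y : (α × ℝ) × ℝ =>
      {y : (α × ℝ) × ℝ | y.2 ∈ Ioo 0 y.1.2}.indicator (fun y => M (y.1.1, y.2)) y := by
    refine (hM.comp_measurable (by fun_prop)).indicator ?_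
    exact (measurableSet_lt measurable_const measurable_snd).inter
      (measurableSet_lt measurable_snd (by fun_prop))
  convert h.integral_prod_right' (ν := volume) using 2 with x
  rw [repInt, ← integral_indicator measurableSet_Ioo]
  refine integral_congr_ae (Eventually.of_forall fun p => ?_)
  simp [indicator]

/-- Differentiability is known for each `x` at almost every `t`, but is needed for almost every `t`
at almost every `x`. Fubini for null sets requires a measurable set of pairs; rational increments
make the condition countable and so measurable. -/
lemma ae_ae_hasDerivAt [CompleteSpace F] {μ : Measure α} [SFinite μ] {M : α × ℝ → F}
    (hM : StronglyMeasurable M)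
    (hint : ∀ᵐ x ∂μ, ∀ b < 1, IntegrableOn (fun p => M (x, p)) (Icc 0 b)) :
    ∀ᵐ t : ℝ, t ∈ Ioo (0 : ℝ) 1 →
      ∀ᵐ x ∂μ, HasDerivAt (repInt (fun p => M (x, p)) 0) (M (x, t)) t := by
  have hQ := stronglyMeasurable_repInt_zero hM
  have hms : MeasurableSet {y : α × ℝ | HasRatDeriv (repInt (fun p => M (y.1, p)) 0)
      (M (y.1, y.2)) y.2} := by
    unfold HasRatDeriv
    simp only [ofPred_forall, ofPred_exists]
    refine MeasurableSet.iInter fun k => MeasurableSet.iUnion fun j => MeasurableSet.iInter fun r =>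
      MeasurableSet.iInter fun _ => ?_
    have h1 : StronglyMeasurable fun y : α × ℝ =>
        repInt (fun p => M (y.1, p)) 0 (y.2 + r) - repInt (fun p => M (y.1, p)) 0 y.2 -
          (r : ℝ) • M (y.1, y.2) := by
      refine StronglyMeasurable.sub (StronglyMeasurable.sub ?_ hQ) (hM.const_smul _)
      exact hQ.comp_measurable (g := fun y : α × ℝ => (y.1, y.2 + (r : ℝ))) (by fun_prop)
    exact measurableSet_le h1.norm.measurable measurable_const
  have h1 : ∀ᵐ x ∂μ, ∀ᵐ t ∂volume.restrict (Ioo (0 : ℝ) 1),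
      HasRatDeriv (repInt (fun p => M (x, p)) 0) (M (x, t)) t := by
    filter_upwards [hint] with x hx
    rw [ae_restrict_iff' measurableSet_Ioo]
    filter_upwards [ae_hasDerivAt_repInt_zero hx] with t ht ht'
    exact hasRatDeriv_of_hasDerivAt (ht ht')
  rw [Measure.ae_ae_comm hms, ae_restrict_iff' measurableSet_Ioo] at h1
  filter_upwards [h1] with t ht ht'
  filter_upwards [ht ht', hint] with x hx hx'
  exact hasDerivAt_of_hasRatDeriv isOpen_Ioo ht' (continuousOn_repInt_zero hx') hx

end Swap

/-! ### Convergence of slice means in `L^1` -/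

section Limit

variable {V : Type*} [NormedAddCommGroup V] [InnerProductSpace ℝ V] [FiniteDimensional ℝ V]
  [MeasurableSpace V] [BorelSpace V] {F : Type*} [NormedAddCommGroup F] [NormedSpace ℝ F]

/-- Written with a measure that does not depend on `θ`, the mean becomes a parameter integral, and
joint measurability in `(θ, u)` follows. -/
lemma sliceMean_eq_integral_usph {f : V → F} (hf : StronglyMeasurable f) (θ : V) (u : ℝ) :
    sliceMean f θ u = ∫ w, f (u • θ + √(1 - u ^ 2) • perpProj θ w) ∂usph V := by
  rw [sliceMean, perpMeas, integral_map (measurable_perpProj_right θ).aemeasurable]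
  exact (hf.comp_measurable (by fun_prop)).aestronglyMeasurable

lemma stronglyMeasurable_sliceMean {f : V → F} (hf : StronglyMeasurable f) :
    StronglyMeasurable fun q : V × ℝ => sliceMean f q.1 q.2 := by
  simp_rw [sliceMean_eq_integral_usph hf]
  have hm : Measurable fun z : (V × ℝ) × V =>
      z.1.2 • z.1.1 + √(1 - z.1.2 ^ 2) • perpProj z.1.1 z.2 := by
    have := measurable_perpProj.comp (by fun_prop : Measurable fun z : (V × ℝ) × V => (z.1.1, z.2))
    have h2 : Measurable fun z : (V × ℝ) × V => perpProj z.1.1 z.2 := this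
    fun_prop
  exact (hf.comp_measurable hm).integral_prod_right'

lemma map_fst_pairRot_joint (hV : 2 ≤ finrank ℝ V) {u : ℝ} (hu : u ∈ Ioo (-1 : ℝ) 1) :
    (joint V).map (fun p => u • p.1 + √(1 - u ^ 2) • p.2) = usph V := by
  have : Nontrivial V := Module.nontrivial_of_finrank_pos (R := ℝ) (by omega)
  rw [← map_fst_joint]
  conv_rhs => rw [← map_pairRot hV hu, Measure.map_map measurable_fst
    (continuous_pairRot u).measurable]
  rfl

lemma ae_integrable_slice_of_mem (hV : 2 ≤ finrank ℝ V) {u : ℝ} (hu : u ∈ Ioo (-1 : ℝ) 1)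
    {f : V → F} (hf : Integrable f (usph V)) :
    ∀ᵐ θ ∂usph V, Integrable (fun y => f (u • θ + √(1 - u ^ 2) • y)) (perpMeas θ) := by
  have : Nontrivial V := Module.nontrivial_of_finrank_pos (R := ℝ) (by omega)
  rw [← map_fst_pairRot_joint hV hu] at hf
  have h := hf.comp_measurable (by fun_prop)
  rw [joint_eq_compProd] at h
  exact ((Measure.integrable_compProd_iff h.1).1 h).1

/-- If `(θ, y)` is a random orthonormal pair, then `u θ + √(1 - u²) y` is again uniform on the
sphere. Averaging is therefore a contraction of `L^1` for each fixed `u`. -/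
lemma lintegral_enorm_sliceMean_le (hV : 2 ≤ finrank ℝ V) {u : ℝ} (hu : u ∈ Ioo (-1 : ℝ) 1)
    {f : V → F} (hf : StronglyMeasurable f) :
    ∫⁻ θ, ‖sliceMean f θ u‖ₑ ∂usph V ≤ ∫⁻ θ, ‖f θ‖ₑ ∂usph V := by
  have hm : Measurable fun p : V × V => u • p.1 + √(1 - u ^ 2) • p.2 := by fun_prop
  conv_rhs => rw [← map_fst_pairRot_joint hV hu]
  rw [lintegral_map hf.enorm hm, lintegral_joint (hf.enorm.fun_comp hm)]
  exact lintegral_mono fun θ => enorm_integral_le_lintegral_enorm _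

lemma tendsto_sliceMean_of_uniformContinuous (hV : 2 ≤ finrank ℝ V) [CompleteSpace F] {g : V → F}
    (hg : UniformContinuous g) {ε : ℝ} (hε : 0 < ε) : ∀ᶠ u in 𝓝[<] (1 : ℝ),
      ∀ θ : V, ‖θ‖ = 1 → ‖sliceMean g θ u - g θ‖ ≤ ε := by
  have : Nontrivial V := Module.nontrivial_of_finrank_pos (R := ℝ) (by omega)
  obtain ⟨δ, hδ, hgδ⟩ := Metric.uniformContinuous_iff.1 hg ε hε
  have h1 : Tendsto (fun u : ℝ => |u - 1| + √(1 - u ^ 2)) (𝓝[<] 1) (𝓝 0) := by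
    have : Continuous fun u : ℝ => |u - 1| + √(1 - u ^ 2) := by fun_prop
    simpa using (this.tendsto 1).mono_left nhdsWithin_le_nhds
  filter_upwards [h1.eventually_lt_const hδ] with u hu θ hθ
  have h2 : ∀ᵐ y ∂perpMeas θ, ‖g (u • θ + √(1 - u ^ 2) • y) - g θ‖ ≤ ε := by
    filter_upwards [ae_perpMeas hθ hV] with y hy
    rw [← dist_eq_norm]
    refine (hgδ ?_).le
    have e : u • θ + √(1 - u ^ 2) • y - θ = (u - 1) • θ + √(1 - u ^ 2) • y := by module
    rw [dist_eq_norm, e]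
    refine (norm_add_le _ _).trans_lt ?_
    rw [norm_smul, norm_smul, hθ, hy.1, mul_one, mul_one, Real.norm_eq_abs,
      Real.norm_of_nonneg (Real.sqrt_nonneg _)]
    exact hu
  have h3 : Integrable (fun y => g (u • θ + √(1 - u ^ 2) • y)) (perpMeas θ) := by
    refine Integrable.of_bound (hg.continuous.comp (by fun_prop)).aestronglyMeasurable (‖g θ‖ + ε) ?_
    filter_upwards [h2] with y hy
    have := norm_add_le (g θ) (g (u • θ + √(1 - u ^ 2) • y) - g θ)
    rw [add_sub_cancel] at this
    linarith
  have h4 : sliceMean g θ u - g θ = ∫ y, (g (u • θ + √(1 - u ^ 2) • y) - g θ) ∂perpMeas θ := by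
    rw [integral_sub h3 (integrable_const _), sliceMean]
    simp
  rw [h4]
  simpa using norm_integral_le_of_norm_le_const h2

/-- Approximation in `L^1` by a compactly supported continuous `g`: one third of `ε` for the means
of `f - g` (contraction), one for the uniform convergence for `g`, one for `f - g` itself. -/
lemma tendsto_sliceMean [CompleteSpace F] (hV : 2 ≤ finrank ℝ V) {f : V → F}
    (hf : Integrable f (usph V)) (hfm : StronglyMeasurable f) :
    Tendsto (fun u => ∫⁻ θ, ‖sliceMean f θ u - f θ‖ₑ ∂usph V) (𝓝[<] 1) (𝓝 0) := by
  have : Nontrivial V := Module.nontrivial_of_finrank_pos (R := ℝ) (by omega)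
  rw [ENNReal.tendsto_nhds_zero]
  intro ε hε
  have hε3 : ε / 3 ≠ 0 := (ENNReal.div_pos hε.ne' (by norm_num)).ne'
  obtain ⟨g, hgs, hgl, hgc, hgi⟩ := hf.exists_hasCompactSupport_lintegral_sub_le hε3
  obtain ⟨e, he0, heε⟩ : ∃ e : ℝ, 0 < e ∧ ENNReal.ofReal e ≤ ε / 3 := by
    obtain ⟨r, hr0, hr⟩ := ENNReal.lt_iff_exists_nnreal_btwn.1 (pos_iff_ne_zero.2 hε3)
    exact ⟨r, by exact_mod_cast hr0, by simpa using hr.le⟩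
  have hgm : StronglyMeasurable g := hgc.stronglyMeasurable
  filter_upwards [tendsto_sliceMean_of_uniformContinuous hV
      (hgs.uniformContinuous_of_continuous hgc) he0,
      Ioo_mem_nhdsLT (show (-1 : ℝ) < 1 by norm_num)] with u hu hu1
  have hsub : ∀ᵐ θ ∂usph V, ‖sliceMean f θ u - f θ‖ₑ ≤
      ‖sliceMean (f - g) θ u‖ₑ + ENNReal.ofReal e + ‖f θ - g θ‖ₑ := by
    filter_upwards [ae_integrable_slice_of_mem hV hu1 hf, ae_integrable_slice_of_mem hV hu1 hgi,
      ae_norm_usph (V := V)] with θ h1 h2 h3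
    have h4 : sliceMean (f - g) θ u = sliceMean f θ u - sliceMean g θ u := integral_sub h1 h2
    have h5 : sliceMean f θ u - f θ = sliceMean (f - g) θ u + (sliceMean g θ u - g θ) +
        (g θ - f θ) := by rw [h4]; abel
    rw [h5]
    refine (enorm_add_le _ _).trans (add_le_add ((enorm_add_le _ _).trans (add_le_add le_rfl ?_)) ?_)
    · rw [← ofReal_norm]
      exact ENNReal.ofReal_le_ofReal (hu θ h3)
    · rw [enorm_sub_rev]
  have hm1 : Measurable fun θ => ‖sliceMean (f - g) θ u‖ₑ :=
    ((stronglyMeasurable_sliceMean (hfm.sub hgm)).comp_measurable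
      (by fun_prop : Measurable fun θ : V => (θ, u))).enorm
  refine (lintegral_mono_ae hsub).trans ?_
  rw [lintegral_add_left (hm1.fun_add measurable_const), lintegral_add_left hm1, lintegral_const,
    measure_univ, mul_one]
  calc _ ≤ ε / 3 + ε / 3 + ε / 3 := by
        refine add_le_add (add_le_add ?_ heε) hgl
        exact (lintegral_enorm_sliceMean_le hV hu1 (hfm.sub hgm)).trans hgl
    _ = ε := ENNReal.add_thirds ε

end Limit

/-! ### The inversion formula for the Funk transform on `S^n` -/

section Bridge

lemma valAt_coe {𝕜 : Type*} [RCLike 𝕜] {m : ℕ} (f : USphere m → 𝕜)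
    (θ : USphere m) : valAt f (θ : E m) = f θ := by
  rw [valAt, dif_pos θ.2]

end Bridge

section Bridge

variable {𝕜 : Type*} [RCLike 𝕜] {n : ℕ}

lemma finrank_E (m : ℕ) : finrank ℝ (E m) = m := by simp

instance : Nontrivial (E (n + 1)) :=
  Module.nontrivial_of_finrank_pos (R := ℝ) (by rw [finrank_E]; omega)

lemma norm_coe_sphere {m : ℕ} (θ : USphere m) : ‖(θ : E m)‖ = 1 := by simp

lemma measurableEmbedding_coe_sphere (m : ℕ) :
    MeasurableEmbedding (Subtype.val : USphere m → E m) :=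
  MeasurableEmbedding.subtype_coe Metric.isClosed_sphere.measurableSet

lemma sph_eq_smul_usph : sph (E (n + 1)) = sph (E (n + 1)) univ • usph (E (n + 1)) := by
  rw [usph, smul_smul, ENNReal.mul_inv_cancel sph_univ_ne_zero (measure_ne_top _ _), one_smul]

lemma ae_usph_iff {p : E (n + 1) → Prop} :
    (∀ᵐ v ∂usph (E (n + 1)), p v) ↔ ∀ᵐ θ : USphere (n + 1) ∂surf (n + 1), p θ := by
  rw [usph, Measure.ae_ennreal_smul_measure_iff (ENNReal.inv_ne_zero.2 (measure_ne_top _ _)), sph,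
    (measurableEmbedding_coe_sphere (n + 1)).ae_map_iff]
  rfl

lemma integrable_usph_iff {F : Type*} [NormedAddCommGroup F] {g : E (n + 1) → F} :
    Integrable g (usph (E (n + 1))) ↔
      Integrable (fun θ : USphere (n + 1) => g θ) (surf (n + 1)) := by
  rw [usph, integrable_smul_measure (ENNReal.inv_ne_zero.2 (measure_ne_top _ _))
    (ENNReal.inv_ne_top.2 sph_univ_ne_zero), sph,
    (measurableEmbedding_coe_sphere (n + 1)).integrable_map_iff]
  rfl

lemma lintegral_surf (g : E (n + 1) → ℝ≥0∞) :
    ∫⁻ θ : USphere (n + 1), g θ ∂surf (n + 1) =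
      sph (E (n + 1)) univ * ∫⁻ v, g v ∂usph (E (n + 1)) := by
  rw [← smul_eq_mul, ← lintegral_smul_measure, ← sph_eq_smul_usph, sph,
    (measurableEmbedding_coe_sphere (n + 1)).lintegral_map]
  rfl

lemma measurableEmbedding_perpVec (θ : E (n + 1)) :
    MeasurableEmbedding (perpVec : PerpSphere θ → E (n + 1)) :=
  (MeasurableEmbedding.subtype_coe
    (Submodule.closed_of_finiteDimensional (ℝ ∙ θ)ᗮ).measurableSet).comp
    (MeasurableEmbedding.subtype_coe Metric.isClosed_sphere.measurableSet)

lemma perpMeas_eq_map_perpSurf (hn : 1 ≤ n) {θ : E (n + 1)} (hθ : ‖θ‖ = 1) :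
    perpMeas θ = (ENNReal.ofReal (area n))⁻¹ • (perpSurf θ).map perpVec := by
  have hdim := finrank_orthogonal_span hθ
  rw [finrank_E] at hdim
  have := nontrivial_orthogonal_span hθ (by rw [finrank_E]; omega)
  rw [perpMeas_eq hθ (by rw [finrank_E]; omega), usph, sph_univ_eq_area, Measure.map_smul, sph,
    Measure.map_map measurable_subtype_coe measurable_subtype_coe,
    show finrank ℝ (ℝ ∙ θ)ᗮ = n by omega]
  rfl

lemma ofReal_area_ne_zero (hn : 1 ≤ n) : ENNReal.ofReal (area n) ≠ 0 :=
  (ENNReal.ofReal_pos.2 (area_pos hn)).ne'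

lemma integrable_perpMeas_iff {F : Type*} [NormedAddCommGroup F] (hn : 1 ≤ n) {θ : E (n + 1)}
    (hθ : ‖θ‖ = 1) {g : E (n + 1) → F} :
    Integrable g (perpMeas θ) ↔ Integrable (fun y : PerpSphere θ => g (perpVec y)) (perpSurf θ) := by
  rw [perpMeas_eq_map_perpSurf hn hθ, integrable_smul_measure
    (ENNReal.inv_ne_zero.2 ENNReal.ofReal_ne_top) (ENNReal.inv_ne_top.2 (ofReal_area_ne_zero hn)),
    (measurableEmbedding_perpVec θ).integrable_map_iff]
  rfl

lemma integral_perpMeas {F : Type*} [NormedAddCommGroup F] [NormedSpace ℝ F] (hn : 1 ≤ n)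
    {θ : E (n + 1)} (hθ : ‖θ‖ = 1) (g : E (n + 1) → F) :
    ∫ y, g y ∂perpMeas θ = (area n)⁻¹ • ∫ y : PerpSphere θ, g (perpVec y) ∂perpSurf θ := by
  rw [perpMeas_eq_map_perpSurf hn hθ, integral_smul_measure,
    (measurableEmbedding_perpVec θ).integral_map, ENNReal.toReal_inv,
    ENNReal.toReal_ofReal (area_pos hn).le]

lemma perpSurf_univ (hn : 1 ≤ n) {θ : E (n + 1)} (hθ : ‖θ‖ = 1) :
    perpSurf θ univ = ENNReal.ofReal (area n) := by
  have hdim := finrank_orthogonal_span hθ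
  rw [finrank_E] at hdim
  have := nontrivial_orthogonal_span hθ (by rw [finrank_E]; omega)
  rw [show perpSurf θ = (volume : Measure (ℝ ∙ θ)ᗮ).toSphere from rfl, toSphere_univ_eq_area,
    show finrank ℝ (ℝ ∙ θ)ᗮ = n by omega]

lemma funk_eq_perpMean (hn : 1 ≤ n) (f : USphere (n + 1) → 𝕜) (θ : USphere (n + 1)) :
    funk f θ = perpMean (valAt f) (θ : E (n + 1)) := by
  rw [funk, perpMean, integral_perpMeas hn (norm_coe_sphere θ), average_eq, Measure.real,
    perpSurf_univ hn (norm_coe_sphere θ), ENNReal.toReal_ofReal (area_pos hn).le]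

/-- `Φ_θ` is parametrized by the radius `s` of the slice, `sliceMean` by its height `√(1 - s²)`. -/
lemma funkMean_eq_sliceMean (hn : 1 ≤ n) (φ : USphere (n + 1) → 𝕜) (θ : USphere (n + 1)) {s : ℝ}
    (hs : s ∈ Ioo (0 : ℝ) 1) :
    funkMean φ θ s = sliceMean (valAt φ) (θ : E (n + 1)) (√(1 - s ^ 2)) := by
  rw [funkMean, sliceMean, integral_perpMeas hn (norm_coe_sphere θ), Real.sq_sqrt
    (by nlinarith [hs.1, hs.2]), sub_sub_cancel, Real.sqrt_sq hs.1.le]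
  simp_rw [add_comm]

/-- On `(0, 1)` the map `s ↦ √(1 - s²)` is its own inverse, so preimages of null sets are images
under a differentiable map, hence null. -/
lemma ae_comp_sqrt {p : ℝ → Prop} (h : ∀ᵐ u : ℝ, u ∈ Ioo (-1 : ℝ) 1 → p u) :
    ∀ᵐ s : ℝ, s ∈ Ioo (0 : ℝ) 1 → p (√(1 - s ^ 2)) := by
  rw [ae_iff] at h ⊢
  have h1 : volume ((fun s : ℝ => √(1 - s ^ 2)) ''
      ({u | ¬(u ∈ Ioo (-1 : ℝ) 1 → p u)} ∩ Ioo 0 1)) = 0 := by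
    refine addHaar_image_eq_zero_of_differentiableOn_of_addHaar_eq_zero _ (fun s hs => ?_)
      (measure_mono_null inter_subset_left h)
    exact (hasDerivAt_sqrt_one_sub_sq hs.2).differentiableAt.differentiableWithinAt
  refine measure_mono_null (fun s hs => ?_) h1
  obtain ⟨hs1, hs2⟩ := Classical.not_imp.1 hs
  have hs0 : 0 < s := hs1.1
  have hs' := hs1.2
  have h2 : 0 < 1 - s ^ 2 := by nlinarith
  have h3 : √(1 - s ^ 2) < 1 := (Real.sqrt_lt' one_pos).2 (by nlinarith)
  have h4 := Real.sqrt_pos.2 h2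
  refine ⟨√(1 - s ^ 2), ⟨fun h => hs2 (h ⟨by linarith, h3⟩), h4, h3⟩, ?_⟩
  simp only
  rw [Real.sq_sqrt h2.le, sub_sub_cancel, Real.sqrt_sq hs0.le]

/-- An integrable even function has a measurable representative that is even everywhere. -/
lemma exists_even_representative {f : USphere (n + 1) → 𝕜} (hf : MemL1Even f) :
    ∃ g : E (n + 1) → 𝕜, StronglyMeasurable g ∧ Integrable g (usph (E (n + 1))) ∧
      (∀ v, g (-v) = g v) ∧ valAt f =ᵐ[usph (E (n + 1))] g := by
  have hi : Integrable (valAt f) (usph (E (n + 1))) := by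
    rw [integrable_usph_iff]
    exact hf.1.congr (Eventually.of_forall fun θ => (valAt_coe f θ).symm)
  have heven : ∀ᵐ v ∂usph (E (n + 1)), valAt f (-v) = valAt f v := by
    rw [ae_usph_iff]
    filter_upwards [hf.2] with θ hθ
    rw [valAt_coe, ← hθ, ← valAt_coe f (-θ)]
    rfl
  set g₁ := hi.1.mk with hg₁
  have h1 : valAt f =ᵐ[usph (E (n + 1))] g₁ := hi.1.ae_eq_mk
  have h2 : ∀ᵐ v ∂usph (E (n + 1)), valAt f (-v) = g₁ (-v) := by
    have h3 := h1
    rw [← map_neg_usph] at h3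
    exact ae_of_ae_map measurable_neg.aemeasurable h3
  have hm : StronglyMeasurable g₁ := hi.1.stronglyMeasurable_mk
  -- A representative `g₁` need only be even almost everywhere; its average with its reflection is
  -- even at every point.
  have h4 : valAt f =ᵐ[usph (E (n + 1))] fun v => (2 : ℝ)⁻¹ • (g₁ v + g₁ (-v)) := by
    filter_upwards [h1, h2, heven] with v a b c
    rw [← a, ← b, c, ← two_smul ℝ, smul_smul]
    norm_num
  refine ⟨fun v => (2 : ℝ)⁻¹ • (g₁ v + g₁ (-v)), ?_, hi.congr h4, fun v => ?_, h4⟩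
  · exact (hm.add (hm.comp_measurable measurable_neg)).const_smul _
  · change (2 : ℝ)⁻¹ • (g₁ (-v) + g₁ (- -v)) = (2 : ℝ)⁻¹ • (g₁ v + g₁ (-v))
    rw [neg_neg, add_comm (g₁ v)]

lemma valAt_ae_eq_perpMean (hn : 2 ≤ n) {φ f : USphere (n + 1) → 𝕜} {g : E (n + 1) → 𝕜}
    (hfg : valAt f =ᵐ[usph (E (n + 1))] g) (hφ : φ =ᵐ[surf (n + 1)] funk f) :
    valAt φ =ᵐ[usph (E (n + 1))] perpMean g := by
  have hV2 : 2 ≤ finrank ℝ (E (n + 1)) := by rw [finrank_E]; omega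
  refine EventuallyEq.trans (g := perpMean (valAt f)) ?_ (perpMean_congr hV2 hfg)
  refine ae_usph_iff.2 ?_
  filter_upwards [hφ] with θ hθ
  rw [valAt_coe, hθ, funk_eq_perpMean (by omega)]

lemma funkPrim_eq_repInt (hn : 2 ≤ n) {φ : USphere (n + 1) → 𝕜} {g : E (n + 1) → 𝕜}
    (hgi : Integrable g (usph (E (n + 1)))) (hge : ∀ v, g (-v) = g v)
    (hφ : valAt φ =ᵐ[usph (E (n + 1))] perpMean g) (θ : USphere (n + 1)) {t : ℝ}
    (ht : t ∈ Ioo (0 : ℝ) 1) :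
    IntervalIntegrable (funkIntegrand φ θ t) volume 0 t ∧
      funkPrim φ θ t = (((n - 2).factorial : ℝ))⁻¹ •
        repInt (sliceMean g (θ : E (n + 1))) (n - 2) t := by
  have hV : finrank ℝ (E (n + 1)) = n + 1 := finrank_E _
  have hn1 : 1 ≤ n := by omega
  obtain ⟨h1, h2⟩ := integral_funkIntegrand hn hV ht (norm_coe_sphere θ) hgi hge hφ
  have hE : EqOn (funkIntegrand φ θ t) (fun s => ((t ^ 2 - s ^ 2) ^ (((n : ℝ) - 3) / 2) * s) •
      sliceMean (valAt φ) (θ : E (n + 1)) (√(1 - s ^ 2))) (Ioo 0 t) := fun s hs => by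
    rw [funkIntegrand, funkMean_eq_sliceMean hn1 φ θ ⟨hs.1, hs.2.trans ht.2⟩]
  constructor
  · rw [intervalIntegrable_iff_integrableOn_Ioo_of_le ht.1.le]
    exact (integrableOn_congr_fun hE measurableSet_Ioo).2 h1
  · rw [funkPrim, intervalIntegral.integral_of_le ht.1.le, integral_Ioc_eq_integral_Ioo,
      setIntegral_congr_fun measurableSet_Ioo hE, h2, repInt]

lemma integrableOn_sliceMean_sphere (hn : 2 ≤ n) {g : E (n + 1) → 𝕜}
    (hgi : Integrable g (usph (E (n + 1)))) (θ : USphere (n + 1)) :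
    ∀ b < 1, IntegrableOn (sliceMean g (θ : E (n + 1))) (Icc 0 b) := fun _ hb =>
  integrableOn_sliceMean (norm_coe_sphere θ) (by rw [finrank_E]; omega) hgi hb

lemma iteratedDeriv_funkPrim (hn : 2 ≤ n) {φ : USphere (n + 1) → 𝕜} {g : E (n + 1) → 𝕜}
    (hgi : Integrable g (usph (E (n + 1)))) (hge : ∀ v, g (-v) = g v)
    (hφ : valAt φ =ᵐ[usph (E (n + 1))] perpMean g) (θ : USphere (n + 1)) {t : ℝ}
    (ht : t ∈ Ioo (0 : ℝ) 1) :
    iteratedDeriv (n - 2) (funkPrim φ θ) =ᶠ[𝓝 t] repInt (sliceMean g (θ : E (n + 1))) 0 := by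
  refine EqOn.eventuallyEq_of_mem (s := Ioo 0 1) (fun t ht => ?_) (isOpen_Ioo.mem_nhds ht)
  have := iteratedDeriv_repInt (integrableOn_sliceMean_sphere hn hgi θ)
    (fun t ht => (funkPrim_eq_repInt hn hgi hge hφ θ ht).2) (le_refl (n - 2)) ht
  simpa using this

lemma funkApprox_ae_eq_sliceMean (hn : 2 ≤ n) {φ : USphere (n + 1) → 𝕜} {g : E (n + 1) → 𝕜}
    (hgm : StronglyMeasurable g) (hgi : Integrable g (usph (E (n + 1)))) (hge : ∀ v, g (-v) = g v)
    (hφ : valAt φ =ᵐ[usph (E (n + 1))] perpMean g) :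
    ∀ᵐ t : ℝ, t ∈ Ioo (0 : ℝ) 1 → ∀ᵐ θ : USphere (n + 1) ∂surf (n + 1),
      funkApprox φ t θ = sliceMean g (θ : E (n + 1)) t := by
  have h1 := ae_ae_hasDerivAt (μ := usph (E (n + 1))) (stronglyMeasurable_sliceMean hgm) (by
    rw [ae_usph_iff]
    exact Eventually.of_forall (integrableOn_sliceMean_sphere hn hgi))
  filter_upwards [h1] with t ht ht'
  filter_upwards [ae_usph_iff.1 (ht ht')] with θ hθ
  -- The first `n - 2` derivatives exist throughout `(0, 1)`; only the last one requires Lebesgue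
  -- differentiation.
  rw [funkApprox, show n - 1 = n - 2 + 1 by omega, iteratedDeriv_succ,
    (iteratedDeriv_funkPrim hn hgi hge hφ θ ht').deriv_eq]
  exact hθ.deriv

lemma ae_integrable_funkMean (hn : 2 ≤ n) {φ : USphere (n + 1) → 𝕜}
    (hφi : Integrable (valAt φ) (usph (E (n + 1)))) (θ : USphere (n + 1)) :
    ∀ᵐ s : ℝ, s ∈ Ioo (0 : ℝ) 1 →
      Integrable (fun y : PerpSphere (θ : E (n + 1)) =>
        valAt φ (s • perpVec y + √(1 - s ^ 2) • (θ : E (n + 1)))) (perpSurf (θ : E (n + 1))) := by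
  filter_upwards [ae_comp_sqrt (ae_integrable_slice (norm_coe_sphere θ)
    (by rw [finrank_E]; omega) hφi)] with s hs hs'
  have h1 := (integrable_perpMeas_iff (by omega) (norm_coe_sphere θ)).1 (hs hs')
  rw [Real.sq_sqrt (by nlinarith [hs'.1, hs'.2]), sub_sub_cancel, Real.sqrt_sq hs'.1.le] at h1
  simpa only [add_comm] using h1

lemma stronglyMeasurable_sliceMean_left {g : E (n + 1) → 𝕜} (hgm : StronglyMeasurable g) (t : ℝ) :
    StronglyMeasurable fun θ : E (n + 1) => sliceMean g θ t :=
  StronglyMeasurable.of_uncurry_right (stronglyMeasurable_sliceMean hgm)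

lemma tendsto_funkApprox (hn : 2 ≤ n) {φ f : USphere (n + 1) → 𝕜} {g : E (n + 1) → 𝕜}
    (hgm : StronglyMeasurable g) (hgi : Integrable g (usph (E (n + 1)))) (hge : ∀ v, g (-v) = g v)
    (hfg : valAt f =ᵐ[usph (E (n + 1))] g) (hφ : valAt φ =ᵐ[usph (E (n + 1))] perpMean g) :
    Tendsto (fun t => eLpNorm (fun θ => funkApprox φ t θ - f θ) 1 (surf (n + 1)))
      (𝓝[<] (1 : ℝ) ⊓ ae volume) (𝓝 0) := by
  have hV2 : 2 ≤ finrank ℝ (E (n + 1)) := by rw [finrank_E]; omega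
  have h1 : Tendsto (fun t => sph (E (n + 1)) univ *
      ∫⁻ θ, ‖sliceMean g θ t - g θ‖ₑ ∂usph (E (n + 1))) (𝓝[<] (1 : ℝ) ⊓ ae volume) (𝓝 0) := by
    have := ENNReal.Tendsto.const_mul ((tendsto_sliceMean hV2 hgi hgm).mono_left
      (inf_le_left (b := ae volume))) (Or.inr (measure_ne_top (sph (E (n + 1))) univ))
    simpa using this
  refine h1.congr' ?_
  have h01 : ∀ᶠ t in 𝓝[<] (1 : ℝ) ⊓ ae volume, t ∈ Ioo (0 : ℝ) 1 :=
    mem_inf_of_left (Ioo_mem_nhdsLT one_pos)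
  have h02 : ∀ᶠ t in 𝓝[<] (1 : ℝ) ⊓ ae volume, t ∈ Ioo (0 : ℝ) 1 →
      ∀ᵐ θ : USphere (n + 1) ∂surf (n + 1), funkApprox φ t θ = sliceMean g (θ : E (n + 1)) t :=
    mem_inf_of_right (funkApprox_ae_eq_sliceMean hn hgm hgi hge hφ)
  filter_upwards [h01, h02] with t ht ht'
  rw [eLpNorm_one_eq_lintegral_enorm, ← lintegral_surf fun θ => ‖sliceMean g θ t - g θ‖ₑ]
  refine lintegral_congr_ae ?_
  filter_upwards [ht' ht, ae_usph_iff.1 hfg] with θ h3 h4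
  rw [h3, ← h4, valAt_coe]

/-- Stated for an arbitrary even solution of `F f = φ`, so that it yields both the inversion formula
and, with the uniqueness of limits, the injectivity of `F` on even functions. -/
theorem isFunkInverse_of_ae_eq_funk (hn : 2 ≤ n) {φ f : USphere (n + 1) → 𝕜} (hf : MemL1Even f)
    (hφ : φ =ᵐ[surf (n + 1)] funk f) : IsFunkInverse φ f := by
  have hV2 : 2 ≤ finrank ℝ (E (n + 1)) := by rw [finrank_E]; omega
  obtain ⟨g, hgm, hgi, hge, hfg⟩ := exists_even_representative hf
  have hφ' := valAt_ae_eq_perpMean hn hfg hφ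
  have hφi : Integrable (valAt φ) (usph (E (n + 1))) :=
    (integrable_perpMean hV2 hgi).congr hφ'.symm
  have hM := fun θ : USphere (n + 1) => integrableOn_sliceMean_sphere hn hgi θ
  refine ⟨hf, Eventually.of_forall (ae_integrable_funkMean hn hφi), Eventually.of_forall
    fun θ t ht => (funkPrim_eq_repInt hn hgi hge hφ' θ ht).1, Eventually.of_forall fun θ => ?_,
    Eventually.of_forall fun θ => ?_, ?_, tendsto_funkApprox hn hgm hgi hge hfg hφ'⟩
  · exact ((contDiffOn_repInt (hM θ) (n - 2)).const_smul (((n - 2).factorial : ℝ))⁻¹).congr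
      fun t ht => (funkPrim_eq_repInt hn hgi hge hφ' θ ht).2
  · filter_upwards [ae_hasDerivAt_repInt_zero (hM θ)] with t ht ht'
    exact (iteratedDeriv_funkPrim hn hgi hge hφ' θ ht').differentiableAt_iff.2
      (ht ht').differentiableAt
  · filter_upwards [funkApprox_ae_eq_sliceMean hn hgm hgi hge hφ'] with t ht ht'
    have h1 : Integrable (fun θ : E (n + 1) => sliceMean g θ t) (usph (E (n + 1))) :=
      ⟨(stronglyMeasurable_sliceMean_left hgm t).aestronglyMeasurable,
        (lintegral_enorm_sliceMean_le hV2 ⟨by linarith [ht'.1], ht'.2⟩ hgm).trans_lt hgi.2⟩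
    exact (integrable_usph_iff.1 h1).congr ((ht ht').mono fun θ hθ => hθ.symm)

/-- Every left neighbourhood of 1 has positive measure and so meets each set of full measure; limits
along this filter are therefore unique. -/
instance : (𝓝[<] (1 : ℝ) ⊓ ae volume).NeBot := by
  rw [inf_neBot_iff]
  intro s hs t ht
  obtain ⟨a, ha, has⟩ := (mem_nhdsLT_iff_exists_Ioo_subset).1 hs
  by_contra hempty
  rw [not_nonempty_iff_eq_empty] at hempty
  have h1 : Ioo a 1 ⊆ tᶜ := fun x hx hxt =>
    (hempty ▸ (⟨has hx, hxt⟩ : x ∈ s ∩ t) : x ∈ (∅ : Set ℝ))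
  have h2 : volume (Ioo a 1) = 0 := measure_mono_null h1 ht
  rw [Real.volume_Ioo, ENNReal.ofReal_eq_zero] at h2
  have : a < 1 := ha
  linarith

/-- Triangle inequality through the common approximation `funkApprox φ t`, with `t → 1`. -/
lemma IsFunkInverse.ae_unique {φ f g : USphere (n + 1) → 𝕜} (hf : IsFunkInverse φ f)
    (hg : IsFunkInverse φ g) : f =ᵐ[surf (n + 1)] g := by
  have h1 := hf.limit.add hg.limit
  rw [add_zero] at h1
  have h2 : eLpNorm (f - g) 1 (surf (n + 1)) ≤ 0 := by
    refine ge_of_tendsto h1 ?_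
    have h01 : ∀ᶠ t in 𝓝[<] (1 : ℝ) ⊓ ae volume, t ∈ Ioo (0 : ℝ) 1 :=
      mem_inf_of_left (Ioo_mem_nhdsLT one_pos)
    have h02 : ∀ᶠ t in 𝓝[<] (1 : ℝ) ⊓ ae volume, t ∈ Ioo (0 : ℝ) 1 →
      Integrable (funkApprox φ t) (surf (n + 1)) := mem_inf_of_right hf.approx_integrable
    filter_upwards [h01, h02] with t ht ht'
    have e : f - g = (fun θ => funkApprox φ t θ - g θ) - fun θ => funkApprox φ t θ - f θ := by
      ext θ; simp
    rw [e]
    exact (eLpNorm_sub_le ((ht' ht).1.sub hg.memL1Even.1.1) ((ht' ht).1.sub hf.memL1Even.1.1)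
      le_rfl).trans_eq (add_comm _ _)
  have h3 := (eLpNorm_eq_zero_iff (hf.memL1Even.1.1.sub hg.memL1Even.1.1) one_ne_zero).1
    (le_antisymm h2 bot_le)
  filter_upwards [h3] with θ hθ
  exact sub_eq_zero.1 hθ

end Bridge

/-! ### Splitting off the last coordinate -/

section Coordinates

variable {n : ℕ}

lemma headPt_joinPt (x : E n) (a : ℝ) : headPt (joinPt x a) = x := by
  ext i
  simp [headPt, joinPt]

lemma lastCoord_joinPt (x : E n) (a : ℝ) : lastCoord (joinPt x a) = a := by
  simp [lastCoord, joinPt]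

lemma joinPt_headPt_lastCoord (v : E (n + 1)) : joinPt (headPt v) (lastCoord v) = v := by
  ext i
  refine Fin.lastCases ?_ (fun i => ?_) i <;> simp [headPt, joinPt, lastCoord]

lemma joinPt_add (x y : E n) (a b : ℝ) : joinPt (x + y) (a + b) = joinPt x a + joinPt y b := by
  ext i
  refine Fin.lastCases ?_ (fun i => ?_) i <;> simp [joinPt]

lemma joinPt_smul (c : ℝ) (x : E n) (a : ℝ) : joinPt (c • x) (c * a) = c • joinPt x a := by
  ext i
  refine Fin.lastCases ?_ (fun i => ?_) i <;> simp [joinPt]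

lemma inner_joinPt (x y : E n) (a b : ℝ) :
    inner ℝ (joinPt x a) (joinPt y b) = inner ℝ x y + a * b := by
  simp [PiLp.inner_apply, Fin.sum_univ_castSucc, joinPt, mul_comm]

lemma norm_joinPt_sq (x : E n) (a : ℝ) : ‖joinPt x a‖ ^ 2 = ‖x‖ ^ 2 + a ^ 2 := by
  rw [← real_inner_self_eq_norm_sq, ← real_inner_self_eq_norm_sq, inner_joinPt, sq]

lemma norm_joinPt (x : E n) (a : ℝ) : ‖joinPt x a‖ = √(‖x‖ ^ 2 + a ^ 2) := by
  rw [← norm_joinPt_sq, Real.sqrt_sq (norm_nonneg _)]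

/-- The last basis vector of `E (n + 1)`. -/
def pole (n : ℕ) : E (n + 1) := joinPt 0 1

/-- The embedding of `E n` as a coordinate hyperplane. -/
def joinZero (n : ℕ) : E n →ₗᵢ[ℝ] E (n + 1) where
  toFun x := joinPt x 0
  map_add' x y := by rw [← joinPt_add, add_zero]
  map_smul' c x := by rw [RingHom.id_apply, ← joinPt_smul, mul_zero]
  norm_map' x := by
    change ‖joinPt x 0‖ = _
    rw [norm_joinPt, zero_pow two_ne_zero, add_zero, Real.sqrt_sq (norm_nonneg _)]

lemma joinZero_apply (x : E n) : joinZero n x = joinPt x 0 := rfl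

lemma joinPt_eq (x : E n) (a : ℝ) : joinPt x a = a • pole n + joinZero n x := by
  rw [pole, ← joinPt_smul, joinZero_apply, ← joinPt_add]
  simp

lemma continuous_joinPt : Continuous fun p : E n × ℝ => joinPt p.1 p.2 := by
  simp_rw [joinPt_eq]
  have := (joinZero n).continuous
  fun_prop

lemma norm_pole : ‖pole n‖ = 1 := by simp [pole, norm_joinPt]

lemma inner_pole_joinZero (x : E n) : inner ℝ (pole n) (joinZero n x) = 0 := by
  rw [pole, joinZero_apply, inner_joinPt]; simp

lemma headPt_smul (c : ℝ) (v : E (n + 1)) : headPt (c • v) = c • headPt v := by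
  ext i; simp [headPt]

lemma lastCoord_smul (c : ℝ) (v : E (n + 1)) : lastCoord (c • v) = c * lastCoord v := by
  simp [lastCoord]

lemma headPt_neg (v : E (n + 1)) : headPt (-v) = -headPt v := by
  ext i; simp [headPt]

lemma lastCoord_neg (v : E (n + 1)) : lastCoord (-v) = -lastCoord v := by
  simp [lastCoord]

lemma inner_pole_right (v : E (n + 1)) : inner ℝ v (pole n) = lastCoord v := by
  rw [← joinPt_headPt_lastCoord v, pole, inner_joinPt, lastCoord_joinPt]; simp

end Coordinates

/-! ### Central projection to a great subsphere, and `R^* = A_* F B_*` -/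

section Graph

variable {n : ℕ}

lemma one_add_norm_sq_pos (x : E n) : 0 < 1 + ‖x‖ ^ 2 := by positivity

lemma sqrt_one_add_norm_sq_pos (x : E n) : 0 < √(1 + ‖x‖ ^ 2) :=
  Real.sqrt_pos.2 (one_add_norm_sq_pos x)

lemma norm_omegaPt (x : E n) : ‖omegaPt x‖ = 1 := by
  have h := sqrt_one_add_norm_sq_pos x
  rw [omegaPt, norm_smul, norm_joinPt, norm_neg, one_pow, add_comm (‖x‖ ^ 2), norm_inv,
    Real.norm_of_nonneg h.le, inv_mul_cancel₀ h.ne']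

lemma inner_joinPt_omegaPt (x y : E n) (a : ℝ) :
    inner ℝ (joinPt y a) (omegaPt x) = (√(1 + ‖x‖ ^ 2))⁻¹ * (a - inner ℝ x y) := by
  rw [omegaPt, inner_smul_right, inner_joinPt, inner_neg_right, real_inner_comm]
  ring

/-- The point over `y` of the hyperplane through the origin orthogonal to `omegaPt x`. -/
def graphPt (x y : E n) : E (n + 1) := joinPt y (inner ℝ x y)

lemma continuous_graphPt (x : E n) : Continuous (graphPt x) :=
  continuous_joinPt.comp (by fun_prop : Continuous fun y : E n => (y, (inner ℝ x y : ℝ)))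

lemma graphPt_smul (x y : E n) (c : ℝ) : graphPt x (c • y) = c • graphPt x y := by
  rw [graphPt, inner_smul_right, joinPt_smul, graphPt]

lemma graphPt_eq_zero_iff {x y : E n} : graphPt x y = 0 ↔ y = 0 := by
  constructor
  · intro h
    rw [← headPt_joinPt y (inner ℝ x y), ← graphPt, h]
    ext i; simp [headPt]
  · rintro rfl
    have := graphPt_smul x 0 0
    simpa using this

lemma lintegral_indicator_inv_mul {s : ℝ} (hs : 0 < s) :
    ∫⁻ a : ℝ, (Ioo (0 : ℝ) 1).indicator 1 (s⁻¹ * a) = ENNReal.ofReal s := by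
  rw [lintegral_comp_mul_left _ hs]
  have : ∀ a : ℝ, s⁻¹ * (s * a) = a := fun a => by field_simp
  simp_rw [this]
  rw [lintegral_indicator_one measurableSet_Ioo, Real.volume_Ioo]
  simp

/-- The Jacobian of the graph map, found without determinants: one function supported in the slab `0
< p · ω < 1` is integrated in two ways, along vertical lines and along translates of `ω^⊥`. A
vertical line meets the slab in length `√(1 + |x|²)`, the slab itself has thickness one. -/
lemma lintegral_graphPt (x : E n) {g : E (n + 1) → ℝ≥0∞} (hg : Measurable g) :
    ∫⁻ w : (ℝ ∙ omegaPt x)ᗮ, g w =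
      ENNReal.ofReal (√(1 + ‖x‖ ^ 2)) * ∫⁻ y : E n, g (graphPt x y) := by
  set s := √(1 + ‖x‖ ^ 2) with hs
  have hs0 : 0 < s := sqrt_one_add_norm_sq_pos x
  set ω := omegaPt x with hω
  have hω1 : ‖ω‖ = 1 := norm_omegaPt x
  have hi : Measurable ((Ioo (0 : ℝ) 1).indicator (1 : ℝ → ℝ≥0∞)) :=
    measurable_one.indicator measurableSet_Ioo
  -- As `pole · ω = s⁻¹`, the argument of `g` is the projection of `p` to `ω^⊥` along the vertical
  -- direction.
  set G : E (n + 1) → ℝ≥0∞ := fun p =>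
    g (p - (inner ℝ p ω * s) • pole n) * (Ioo (0 : ℝ) 1).indicator 1 (inner ℝ p ω) with hG
  have hGm : Measurable G :=
    (hg.fun_comp (by fun_prop)).mul (hi.comp (by fun_prop : Measurable fun p => inner ℝ p ω))
  have h1 : ∫⁻ p, G p = ENNReal.ofReal s * ∫⁻ y : E n, g (graphPt x y) := by
    have hmp := measurePreserving_smul_add (pole n) (joinZero n) norm_pole inner_pole_joinZero
      (by simp)
    rw [← hmp.lintegral_comp hGm, Measure.volume_eq_prod,
      lintegral_prod_symm _ (hGm.fun_comp hmp.measurable).aemeasurable,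
      ← lintegral_const_mul _ (hg.fun_comp (continuous_graphPt x).measurable)]
    refine lintegral_congr fun y => ?_
    -- The height is now measured from the graph of `y ↦ x · y`.
    rw [← lintegral_add_right_eq_self _ (inner ℝ x y)]
    have : ∀ a : ℝ, G ((a + inner ℝ x y) • pole n + joinZero n y) =
        g (graphPt x y) * (Ioo (0 : ℝ) 1).indicator 1 (s⁻¹ * a) := fun a => by
      rw [← joinPt_eq, hG]
      simp only
      rw [hω, inner_joinPt_omegaPt, add_sub_cancel_right, ← hs]
      congr 2
      rw [show s⁻¹ * a * s = a by field_simp, joinPt_eq, graphPt, joinPt_eq, add_smul]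
      abel
    simp only [this]
    rw [lintegral_const_mul _ (hi.fun_comp (measurable_const_mul _)), lintegral_indicator_inv_mul hs0,
      mul_comm]
  have h2 : ∫⁻ p, G p = ∫⁻ w : (ℝ ∙ ω)ᗮ, g w := by
    have hmp := measurePreserving_smul_add ω (ℝ ∙ ω)ᗮ.subtypeₗᵢ hω1 (inner_orthogonal_span ω)
      (finrank_orthogonal_span hω1)
    -- On the translate of `ω^⊥` by `c ω` the vertical projection is the translation by `c` times
    -- this vector of `ω^⊥`, which leaves the integral unchanged.
    have hv : ω - s • pole n ∈ (ℝ ∙ ω)ᗮ := by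
      rw [Submodule.mem_orthogonal_singleton_iff_inner_right, inner_sub_right, inner_smul_right,
        real_inner_self_eq_norm_sq, hω1, real_inner_comm, pole, hω, inner_joinPt_omegaPt, ← hs]
      simp [hs0.ne']
    have hgs : Measurable fun w : (ℝ ∙ ω)ᗮ => g w := hg.fun_comp measurable_subtype_coe
    rw [← hmp.lintegral_comp hGm, Measure.volume_eq_prod,
      lintegral_prod _ (hGm.fun_comp hmp.measurable).aemeasurable]
    have : ∀ c : ℝ, ∀ w : (ℝ ∙ ω)ᗮ, G (c • ω + (ℝ ∙ ω)ᗮ.subtypeₗᵢ w) =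
        g ((w + c • (⟨ω - s • pole n, hv⟩ : (ℝ ∙ ω)ᗮ) : (ℝ ∙ ω)ᗮ) : E (n + 1)) *
          (Ioo (0 : ℝ) 1).indicator 1 c := fun c w => by
      have h3 : inner ℝ (c • ω + (w : E (n + 1))) ω = c := by
        rw [inner_add_left, inner_smul_left, real_inner_self_eq_norm_sq, hω1,
          real_inner_comm, inner_orthogonal_span]
        simp
      change g (c • ω + (w : E (n + 1)) - (inner ℝ (c • ω + (w : E (n + 1))) ω * s) • pole n) *
        (Ioo (0 : ℝ) 1).indicator 1 (inner ℝ (c • ω + (w : E (n + 1))) ω) = _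
      rw [h3]
      simp only [Submodule.coe_add, Submodule.coe_smul, smul_sub, smul_smul]
      congr 2
      abel
    simp only [this]
    have h4 : ∀ c : ℝ, ∫⁻ w : (ℝ ∙ ω)ᗮ,
        g ((w + c • (⟨ω - s • pole n, hv⟩ : (ℝ ∙ ω)ᗮ) : (ℝ ∙ ω)ᗮ) : E (n + 1)) *
          (Ioo (0 : ℝ) 1).indicator 1 c =
        (∫⁻ w : (ℝ ∙ ω)ᗮ, g w) * (Ioo (0 : ℝ) 1).indicator 1 c := fun c => by
      rw [lintegral_mul_const _ (hgs.fun_comp (measurable_add_const _)),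
        lintegral_add_right_eq_self (fun w : (ℝ ∙ ω)ᗮ => g w)]
    simp only [h4]
    rw [lintegral_const_mul _ hi, lintegral_indicator_one measurableSet_Ioo, Real.volume_Ioo]
    simp
  rw [← h2, h1]

/-- Both spheres are compared with their linear spans by the radial cut-off. The graph map gives the
factor `√(1 + |x|²)`, the radial projection the factor `‖graphPt x y‖^{-n}`. -/
lemma lintegral_sph_orthogonal (hn : 2 ≤ n) (x : E n) {g : E (n + 1) → ℝ≥0∞}
    (hg : Measurable g) :
    ∫⁻ w : (ℝ ∙ omegaPt x)ᗮ, g w ∂sph (ℝ ∙ omegaPt x)ᗮ =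
      ∫⁻ y : E n, ENNReal.ofReal (√(1 + ‖x‖ ^ 2) * (‖graphPt x y‖ ^ n)⁻¹) *
        g (‖graphPt x y‖⁻¹ • graphPt x y) ∂sph (E n) := by
  have hs := sqrt_one_add_norm_sq_pos x
  have hω := norm_omegaPt x
  have hdim := finrank_orthogonal_span hω
  rw [finrank_E] at hdim
  have hW : finrank ℝ (ℝ ∙ omegaPt x)ᗮ = n := by omega
  have := nontrivial_orthogonal_span hω (by rw [finrank_E]; omega)
  have : Nontrivial (E n) := Module.nontrivial_of_finrank_pos (R := ℝ) (by rw [finrank_E]; omega)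
  have hc := measurable_cutoff
  have hL := (continuous_graphPt x).measurable
  have hg1 : Measurable fun v : E (n + 1) => g (‖v‖⁻¹ • v) * cutoff ‖v‖ :=
    (hg.fun_comp (by fun_prop)).mul (hc.fun_comp measurable_norm)
  have hg2 : Measurable fun y : E n => g (‖graphPt x y‖⁻¹ • graphPt x y) :=
    hg.fun_comp (by fun_prop)
  refine (ENNReal.mul_left_inj (radialConst_ne_zero (n - 1)) (radialConst_ne_top (n - 1))).1 ?_
  have h1 := lintegral_sph_mul_radialConst (V := (ℝ ∙ omegaPt x)ᗮ)
    (hg.fun_comp measurable_subtype_coe)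
  rw [hW] at h1
  have h2 := lintegral_graphPt x hg1
  simp only [Submodule.coe_smul, Submodule.coe_norm] at h1 h2
  rw [h1, h2, lintegral_polar (hg1.fun_comp hL), finrank_E, ← lintegral_const_mul' _ _
    ENNReal.ofReal_ne_top, ← lintegral_mul_const _ (by fun_prop)]
  refine lintegral_congr_ae ?_
  filter_upwards [ae_norm_sph (V := E n)] with y hy
  have hy0 : 0 < ‖graphPt x y‖ := norm_pos_iff.2 fun h => by
    rw [graphPt_eq_zero_iff] at h
    simp [h] at hy
  have h3 : ∫⁻ r in Ioi (0 : ℝ), ENNReal.ofReal (r ^ (n - 1)) *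
      (g (‖graphPt x (r • y)‖⁻¹ • graphPt x (r • y)) * cutoff ‖graphPt x (r • y)‖) =
      ∫⁻ r in Ioi (0 : ℝ), g (‖graphPt x y‖⁻¹ • graphPt x y) *
        (ENNReal.ofReal (r ^ (n - 1)) * cutoff (r * ‖graphPt x y‖)) := by
    refine setLIntegral_congr_fun measurableSet_Ioi fun r hr => ?_
    have hr' : 0 < r := hr
    rw [graphPt_smul, norm_smul, Real.norm_of_nonneg hr'.le, smul_smul, mul_inv, mul_comm r⁻¹,
      mul_assoc, inv_mul_cancel₀ hr'.ne', mul_one]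
    ring
  have h4 : Measurable fun r : ℝ =>
      ENNReal.ofReal (r ^ (n - 1)) * cutoff (r * ‖graphPt x y‖) := by fun_prop
  rw [h3, lintegral_const_mul _ h4,
    lintegral_pow_mul_cutoff _ hy0, Nat.sub_add_cancel (by omega : 1 ≤ n),
    ENNReal.ofReal_mul hs.le]
  ring

/-- The central projection of the unit sphere of `E n` to the great subsphere orthogonal to
`omegaPt x`. -/
def graphDir (x : E n) (η : USphere n) : E (n + 1) := ‖graphPt x η‖⁻¹ • graphPt x η

lemma norm_graphPt_pos (x : E n) (η : USphere n) : 0 < ‖graphPt x η‖ := by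
  refine norm_pos_iff.2 fun h => ?_
  rw [graphPt_eq_zero_iff] at h
  simpa [h] using norm_coe_sphere η

lemma norm_graphDir (x : E n) (η : USphere n) : ‖graphDir x η‖ = 1 := by
  rw [graphDir, norm_smul, norm_inv, norm_norm, inv_mul_cancel₀ (norm_graphPt_pos x η).ne']

lemma headPt_graphDir (x : E n) (η : USphere n) :
    headPt (graphDir x η) = ‖graphPt x η‖⁻¹ • (η : E n) := by
  rw [graphDir, headPt_smul, graphPt, headPt_joinPt]

lemma norm_headPt_graphDir (x : E n) (η : USphere n) :
    ‖headPt (graphDir x η)‖ = ‖graphPt x η‖⁻¹ := by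
  rw [headPt_graphDir, norm_smul, norm_coe_sphere, mul_one, norm_inv, norm_norm]

lemma lastCoord_graphDir (x : E n) (η : USphere n) :
    lastCoord (graphDir x η) = ‖graphPt x η‖⁻¹ * inner ℝ x (η : E n) := by
  rw [graphDir, lastCoord_smul, graphPt, lastCoord_joinPt]

lemma continuous_graphDir (x : E n) : Continuous (graphDir x) := by
  have h : Continuous fun η : USphere n => graphPt x η :=
    (continuous_graphPt x).comp continuous_subtype_val
  exact (h.norm.inv₀ fun η => (norm_graphPt_pos x η).ne').smul h

lemma injective_graphDir (x : E n) : Function.Injective (graphDir x) := fun η ζ h => by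
  have h1 := norm_headPt_graphDir x η
  rw [h, norm_headPt_graphDir] at h1
  have h2 := headPt_graphDir x η
  rw [h, headPt_graphDir, h1] at h2
  exact Subtype.ext (smul_right_injective _ (inv_pos.2 (norm_graphPt_pos x η)).ne' h2).symm

lemma measurableEmbedding_graphDir (x : E n) : MeasurableEmbedding (graphDir x) :=
  (continuous_graphDir x).measurableEmbedding (injective_graphDir x)

lemma map_perpSurf_omegaPt (hn : 2 ≤ n) (x : E n) :
    (perpSurf (omegaPt x)).map perpVec = ((surf n).withDensity fun η =>
      ENNReal.ofReal (√(1 + ‖x‖ ^ 2) * (‖graphPt x η‖ ^ n)⁻¹)).map (graphDir x) := by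
  have hL := (continuous_graphPt x).measurable
  refine Measure.ext_of_lintegral _ fun g hg => ?_
  have h1 := lintegral_sph_orthogonal hn x hg
  rw [sph, lintegral_map (hg.fun_comp measurable_subtype_coe) measurable_subtype_coe, sph,
    (measurableEmbedding_coe_sphere n).lintegral_map] at h1
  rw [(measurableEmbedding_perpVec _).lintegral_map, (measurableEmbedding_graphDir x).lintegral_map,
    lintegral_withDensity_eq_lintegral_mul₀ (by fun_prop)
      (hg.fun_comp (continuous_graphDir x).measurable).aemeasurable]
  exact h1

lemma valAt_of_norm {𝕜 : Type*} [RCLike 𝕜] {m : ℕ} (f : USphere m → 𝕜) {v : E m} (hv : ‖v‖ = 1) :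
    valAt f v = f ⟨v, mem_sphere_zero_iff_norm.2 hv⟩ :=
  valAt_coe f ⟨v, mem_sphere_zero_iff_norm.2 hv⟩

variable {𝕜 : Type*} [RCLike 𝕜]

lemma valAt_Bstar (h : Hyperplane n → 𝕜) {v : E (n + 1)} (hv : ‖v‖ = 1) (η : USphere n) {r : ℝ}
    (hr : 0 < r) (hvη : headPt v = r • (η : E n)) :
    valAt (Bstar h) v = (r ^ n)⁻¹ • h (hplane η (lastCoord v / r)) := by
  have h1 : ‖headPt v‖ = r := by
    rw [hvη, norm_smul, norm_coe_sphere, mul_one, Real.norm_of_nonneg hr.le]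
  rw [valAt_of_norm _ hv, Bstar, hVal]
  simp only
  rw [h1, hvη, smul_smul, inv_mul_cancel₀ hr.ne', one_smul, valAt_coe]

/-- At `graphDir x η` one has `|θ'| = ‖graphPt x η‖⁻¹` and `θ_{n+1} / |θ'| = x · η`; the weight
`|θ'|^{-n}` of `B_*` is exactly what cancels the Jacobian of the central projection. -/
lemma smul_valAt_Bstar_graphDir (h : Hyperplane n → 𝕜) (x : E n) (η : USphere n) :
    (√(1 + ‖x‖ ^ 2) * (‖graphPt x η‖ ^ n)⁻¹) • valAt (Bstar h) (graphDir x η) =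
      √(1 + ‖x‖ ^ 2) • h (hplane η (inner ℝ x (η : E n))) := by
  have hp := norm_graphPt_pos x η
  rw [valAt_Bstar h (norm_graphDir x η) η (inv_pos.2 hp) (headPt_graphDir x η),
    lastCoord_graphDir, mul_div_cancel_left₀ _ (inv_pos.2 hp).ne', smul_smul, inv_pow, inv_inv,
    inv_mul_cancel_right₀ (pow_pos hp n).ne']

lemma aemeasurable_graphDensity (x : E n) : AEMeasurable (fun η : USphere n =>
    ENNReal.ofReal (√(1 + ‖x‖ ^ 2) * (‖graphPt x η‖ ^ n)⁻¹)) (surf n) := by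
  have hL := (continuous_graphPt x).measurable
  fun_prop

lemma toReal_graphDensity (x : E n) (η : USphere n) :
    (ENNReal.ofReal (√(1 + ‖x‖ ^ 2) * (‖graphPt x η‖ ^ n)⁻¹)).toReal =
      √(1 + ‖x‖ ^ 2) * (‖graphPt x η‖ ^ n)⁻¹ :=
  ENNReal.toReal_ofReal (by positivity)

/-- The Funk integral of `Bstar h` at `omegaPt x` and the integral defining `Rstar h x` exist
simultaneously. -/
theorem integrable_iff_funkExistsAt (hn : 2 ≤ n) (h : Hyperplane n → 𝕜) (x : E n) :
    Integrable (fun η : USphere n => h (hplane η (inner ℝ x (η : E n)))) (surf n) ↔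
      FunkExistsAt (Bstar h) (omegaPt x) := by
  have hs := sqrt_one_add_norm_sq_pos x
  have h1 := (measurableEmbedding_perpVec (omegaPt x)).integrable_map_iff
    (μ := perpSurf (omegaPt x)) (g := valAt (Bstar h))
  rw [map_perpSurf_omegaPt hn, (measurableEmbedding_graphDir x).integrable_map_iff,
    integrable_withDensity_iff_integrable_smul₀' (aemeasurable_graphDensity x)
      (Eventually.of_forall fun η => ENNReal.ofReal_lt_top)] at h1
  simp only [Function.comp, toReal_graphDensity, smul_valAt_Bstar_graphDir] at h1
  exact (integrable_smul_iff hs.ne' _).symm.trans h1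

/-- The change of variables is by a measurable embedding and a density, so it transports the
integrals for every `x`, whether or not they exist; when they do not, both are zero by convention.
-/
theorem Rstar_eq_Astar (hn : 2 ≤ n) (h : Hyperplane n → 𝕜) (x : E n) :
    Rstar h x = Astar (funk (Bstar h)) x := by
  have hs := sqrt_one_add_norm_sq_pos x
  have hω := norm_omegaPt x
  have hn1 : 1 ≤ n := by omega
  rw [Astar, valAt_of_norm _ hω, funk, average_eq, Measure.real, perpSurf_univ hn1 hω,
    ENNReal.toReal_ofReal (area_pos hn1).le, Rstar]
  have h1 := (measurableEmbedding_perpVec (omegaPt x)).integral_map (μ := perpSurf (omegaPt x))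
    (valAt (Bstar h))
  rw [map_perpSurf_omegaPt hn, (measurableEmbedding_graphDir x).integral_map,
    integral_withDensity_eq_integral_toReal_smul₀ (aemeasurable_graphDensity x)
      (Eventually.of_forall fun η => ENNReal.ofReal_lt_top)] at h1
  simp only [toReal_graphDensity, smul_valAt_Bstar_graphDir] at h1
  rw [integral_smul] at h1
  simp only
  rw [← h1, smul_comm, inv_smul_smul₀ hs.ne']

end Graph

/-! ### Parameters and null sets of hyperplanes -/

section Hyperplanes

variable {n : ℕ}

instance (m : ℕ) : IsFiniteMeasure (surf m) := by unfold surf; infer_instance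

lemma eq_or_eq_neg_of_hplane_eq {η ζ : USphere n} {t u : ℝ} (h : hplane η t = hplane ζ u) :
    (ζ = η ∧ u = t) ∨ (ζ = -η ∧ u = -t) := by
  have hη := norm_coe_sphere η
  have hζ := norm_coe_sphere ζ
  have hmem : ∀ x : E n, inner ℝ x (η : E n) = t → inner ℝ x (ζ : E n) = u := fun x hx => by
    have h1 : x ∈ (hplane η t).1 := hx
    rw [h] at h1
    exact h1
  have h1 := hmem (t • (η : E n)) (by
    rw [inner_smul_left, real_inner_self_eq_norm_sq, hη]; simp)
  -- The foot `t η` of the hyperplane, displaced inside it by the component of `ζ` orthogonal to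
  -- `η`. Comparison with `h1` shows that this component has length zero, that is `(η · ζ)² = 1`.
  have h2 := hmem (t • (η : E n) + ((ζ : E n) - inner ℝ (ζ : E n) (η : E n) • (η : E n))) (by
    rw [inner_add_left, inner_sub_left, inner_smul_left, inner_smul_left,
      real_inner_self_eq_norm_sq, hη]; simp)
  rw [inner_add_left, h1, inner_sub_left, inner_smul_left, real_inner_self_eq_norm_sq, hζ,
    ← real_inner_comm (ζ : E n) (η : E n)] at h2
  rw [inner_smul_left] at h1
  simp only [conj_trivial] at h1 h2
  have h3 : (inner ℝ (η : E n) (ζ : E n) - 1) * (inner ℝ (η : E n) (ζ : E n) + 1) = 0 := by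
    linear_combination -h2
  rcases mul_eq_zero.1 h3 with h4 | h4
  · have h5 : inner ℝ (η : E n) (ζ : E n) = 1 := by linarith
    rw [h5] at h1
    exact Or.inl ⟨Subtype.ext ((inner_eq_one_iff_of_norm_eq_one hη hζ).1 h5).symm, by linarith⟩
  · have h5 : inner ℝ (η : E n) (ζ : E n) = -1 := by linarith
    rw [h5] at h1
    refine Or.inr ⟨Subtype.ext ?_, by linarith⟩
    have h6 := (inner_eq_one_iff_of_norm_eq_one (𝕜 := ℝ) (x := -(η : E n)) (by rwa [norm_neg])
      hζ).1 (by rw [inner_neg_left, h5, neg_neg])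
    exact h6.symm

lemma hdist_hplane (η : USphere n) (t : ℝ) : hdist (hplane η t) = |t| := by
  have hη := norm_coe_sphere η
  have hmem : t • (η : E n) ∈ (hplane η t).1 := by
    change inner ℝ (t • (η : E n)) (η : E n) = t
    rw [inner_smul_left, real_inner_self_eq_norm_sq, hη]; simp
  refine le_antisymm ?_ ((Metric.le_infDist ⟨_, hmem⟩).2 fun x hx => ?_)
  · refine (Metric.infDist_le_dist_of_mem hmem).trans_eq ?_
    rw [dist_zero_left, norm_smul, hη, mul_one, Real.norm_eq_abs]
  · have h1 : inner ℝ x (η : E n) = t := hx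
    rw [← h1, dist_zero_left]
    simpa [hη] using abs_real_inner_le_norm x (η : E n)

lemma hneg_hplane (η : USphere n) (t : ℝ) : hneg (hplane η t) = hplane (-η) t := by
  apply Subtype.ext
  ext x
  simp [hplane, hneg, inner_neg_left, inner_neg_right]

lemma measurable_hplane : Measurable fun p : USphere n × ℝ => hplane p.1 p.2 := fun _ hs => hs

/-- An image of a measurable set of parameters is measurable in the quotient structure when the set
is invariant under `(η, t) ↦ (-η, -t)`, so the exceptional null set is first made symmetric. -/
lemma ae_hplaneMeasure {P : Hyperplane n → Prop}
    (h : ∀ᵐ p : USphere n × ℝ ∂(surf n).prod volume, P (hplane p.1 p.2)) :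
    ∀ᵐ τ ∂hplaneMeasure n, P τ := by
  obtain ⟨M, hNM, hM, hM0⟩ := exists_measurable_superset_of_null (ae_iff.1 h)
  -- Both parameter pairs of an exceptional hyperplane lie in `M`, so the intersection with the
  -- reflected set still covers all of them.
  set M' := M ∩ (fun p => -p) ⁻¹' M with hM'
  have hneg : ∀ p : USphere n × ℝ, hplane (-p).1 (-p).2 = hplane p.1 p.2 := fun p =>
    hplane_neg_neg p.1 p.2
  have hmeas : MeasurableSet M' :=
    hM.inter ((by fun_prop : Measurable fun p : USphere n × ℝ => -p) hM)
  have hpre : (fun p : USphere n × ℝ => hplane p.1 p.2) ⁻¹'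
      ((fun p : USphere n × ℝ => hplane p.1 p.2) '' M') = M' := by
    refine Subset.antisymm (fun p hp => ?_) (subset_preimage_image _ _)
    obtain ⟨r, hr, hrp⟩ := hp
    rcases eq_or_eq_neg_of_hplane_eq hrp with ⟨h1, h2⟩ | ⟨h1, h2⟩
    · rwa [show p = r from Prod.ext h1 h2]
    · rw [show p = -r from Prod.ext h1 h2]
      exact ⟨hr.2, by simpa using hr.1⟩
  have hS : MeasurableSet ((fun p : USphere n × ℝ => hplane p.1 p.2) '' M') := by
    change MeasurableSet ((fun p : USphere n × ℝ => hplane p.1 p.2) ⁻¹' _)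
    rwa [hpre]
  refine measure_mono_null (t := (fun p : USphere n × ℝ => hplane p.1 p.2) '' M') ?_ ?_
  · intro τ hτ
    obtain ⟨p, -, rfl⟩ := exists_param τ
    refine ⟨p, ⟨hNM hτ, hNM ?_⟩, rfl⟩
    change ¬P (hplane (-p).1 (-p).2)
    rwa [hneg]
  · rw [hplaneMeasure, Measure.map_apply measurable_hplane hS, hpre, Measure.prod_smul_left,
      Measure.smul_apply, measure_mono_null inter_subset_left hM0, smul_zero]

end Hyperplanes

/-! ### The operator `B_*` and its inverse in cylinder coordinates -/

section CylinderParam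

variable {n : ℕ}

/-- The parametrization of the unit sphere of `E (n + 1)` without its poles by the tangent
cylinder. -/
def cylPt (p : USphere n × ℝ) : E (n + 1) := (√(1 + p.2 ^ 2))⁻¹ • joinPt (p.1 : E n) p.2

lemma sqrt_one_add_sq_pos (t : ℝ) : 0 < √(1 + t ^ 2) := Real.sqrt_pos.2 (by positivity)

lemma norm_cylPt (p : USphere n × ℝ) : ‖cylPt p‖ = 1 := by
  have h := sqrt_one_add_sq_pos p.2
  rw [cylPt, norm_smul, norm_joinPt, norm_coe_sphere, one_pow, norm_inv,
    Real.norm_of_nonneg h.le, inv_mul_cancel₀ h.ne']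

lemma headPt_cylPt (p : USphere n × ℝ) : headPt (cylPt p) = (√(1 + p.2 ^ 2))⁻¹ • (p.1 : E n) := by
  rw [cylPt, headPt_smul, headPt_joinPt]

lemma lastCoord_cylPt (p : USphere n × ℝ) : lastCoord (cylPt p) = (√(1 + p.2 ^ 2))⁻¹ * p.2 := by
  rw [cylPt, lastCoord_smul, lastCoord_joinPt]

lemma continuous_cylPt : Continuous (cylPt : USphere n × ℝ → E (n + 1)) := by
  refine Continuous.smul (Continuous.inv₀ (by fun_prop : Continuous fun p : USphere n × ℝ =>
    √(1 + p.2 ^ 2)) fun p => (sqrt_one_add_sq_pos p.2).ne') ?_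
  exact continuous_joinPt.comp (by fun_prop : Continuous fun p : USphere n × ℝ => ((p.1 : E n), p.2))

lemma injective_cylPt : Function.Injective (cylPt : USphere n × ℝ → E (n + 1)) := fun p r h => by
  have hp := inv_pos.2 (sqrt_one_add_sq_pos p.2)
  have hr := inv_pos.2 (sqrt_one_add_sq_pos r.2)
  have h1 := headPt_cylPt p
  have h2 := lastCoord_cylPt p
  rw [h, headPt_cylPt] at h1
  rw [h, lastCoord_cylPt] at h2
  have h3 := congrArg norm h1
  rw [norm_smul, norm_smul, norm_coe_sphere, norm_coe_sphere, mul_one, mul_one,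
    Real.norm_of_nonneg hp.le, Real.norm_of_nonneg hr.le] at h3
  rw [h3] at h1 h2
  exact Prod.ext (Subtype.ext (smul_right_injective _ hp.ne' h1).symm)
    (mul_left_cancel₀ hp.ne' h2).symm

lemma measurableEmbedding_cylPt : MeasurableEmbedding (cylPt : USphere n × ℝ → E (n + 1)) :=
  continuous_cylPt.measurableEmbedding injective_cylPt

lemma measurable_cylDensity (n : ℕ) : Measurable fun p : USphere n × ℝ =>
    ENNReal.ofReal ((√(1 + p.2 ^ 2) ^ (n + 1))⁻¹) := by fun_prop

lemma sph_eq_map_cylPt (hn : 1 ≤ n) :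
    sph (E (n + 1)) = (((surf n).prod volume).withDensity fun p : USphere n × ℝ =>
      ENNReal.ofReal ((√(1 + p.2 ^ 2) ^ (n + 1))⁻¹)).map cylPt := by
  have : Nontrivial (E n) := Module.nontrivial_of_finrank_pos (R := ℝ) (by rw [finrank_E]; omega)
  have hj : Measurable (joinZero n) := (joinZero n).continuous.measurable
  have h1 : (surf n).prod (tangentMeas (n + 1)) =
      ((surf n).prod volume).withDensity fun p : USphere n × ℝ =>
        ENNReal.ofReal ((√(1 + p.2 ^ 2) ^ (n + 1))⁻¹) := by
    rw [tangentMeas, prod_withDensity_right (by fun_prop)]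
  have h2 : (sph (E n)).prod (tangentMeas (n + 1)) =
      ((surf n).prod (tangentMeas (n + 1))).map (Prod.map Subtype.val id) := by
    rw [← Measure.map_prod_map _ _ measurable_subtype_coe measurable_id, Measure.map_id]
    rfl
  rw [sph_eq_map_tangent (pole n) (joinZero n) norm_pole inner_pole_joinZero (by simp), finrank_E,
    h2, h1, Measure.map_map (by fun_prop) (by fun_prop)]
  congr 1
  ext1 p
  rw [cylPt, joinPt_eq]
  rfl

lemma ae_cylPt (hn : 1 ≤ n) {P : E (n + 1) → Prop} (h : ∀ᵐ v ∂usph (E (n + 1)), P v) :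
    ∀ᵐ p : USphere n × ℝ ∂(surf n).prod volume, P (cylPt p) := by
  have h1 : ∀ᵐ v ∂sph (E (n + 1)), P v := by
    rw [sph_eq_smul_usph]
    exact Measure.ae_smul_measure h _
  rw [sph_eq_map_cylPt hn, measurableEmbedding_cylPt.ae_map_iff] at h1
  refine (withDensity_absolutelyContinuous' (measurable_cylDensity n).aemeasurable
    (Eventually.of_forall fun p => ?_)).ae_le h1
  have := sqrt_one_add_sq_pos p.2
  exact (ENNReal.ofReal_pos.2 (by positivity)).ne'

variable {𝕜 : Type*} [RCLike 𝕜]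

lemma valAt_Bstar_cylPt (h : Hyperplane n → 𝕜) (p : USphere n × ℝ) :
    valAt (Bstar h) (cylPt p) = (√(1 + p.2 ^ 2) ^ n) • h (hplane p.1 p.2) := by
  have hp := sqrt_one_add_sq_pos p.2
  rw [valAt_Bstar h (norm_cylPt p) p.1 (inv_pos.2 hp) (headPt_cylPt p), lastCoord_cylPt,
    mul_div_cancel_left₀ _ (inv_pos.2 hp).ne', inv_pow, inv_inv]

lemma hVal_neg (h : Hyperplane n → 𝕜) (v : E n) (t : ℝ) : hVal h (-v) (-t) = hVal h v t := by
  by_cases hv : ‖v‖ = 1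
  · have hv' : ‖-v‖ = 1 := by rwa [norm_neg]
    rw [hVal, hVal, valAt_of_norm _ hv, valAt_of_norm _ hv']
    exact congrArg h (hplane_neg_neg ⟨v, mem_sphere_zero_iff_norm.2 hv⟩ t)
  · have h1 : v ∉ Metric.sphere (0 : E n) 1 := by simpa using hv
    have h2 : -v ∉ Metric.sphere (0 : E n) 1 := by simpa using hv
    rw [hVal, hVal, valAt, valAt, dif_neg h1, dif_neg h2]

lemma Bstar_neg (h : Hyperplane n → 𝕜) (θ : USphere (n + 1)) : Bstar h (-θ) = Bstar h θ := by
  have e : ((-θ : USphere (n + 1)) : E (n + 1)) = -(θ : E (n + 1)) := rfl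
  rw [Bstar, Bstar, e, headPt_neg, lastCoord_neg, norm_neg, smul_neg, neg_div, hVal_neg]

/-- On the cylinder `B_* h` carries the factor `(1 + t²)^{n/2}` and the surface measure the density
`(1 + t²)^{-(n+1)/2}`; their product is the weight `(1 + |τ|²)^{-1/2}` of the hypothesis. -/
theorem memL1Even_Bstar (hn : 2 ≤ n) {h : Hyperplane n → 𝕜}
    (hmeas : AEStronglyMeasurable h (hplaneMeasure n))
    (hint : Integrable (fun τ => ‖h τ‖ / √(1 + hdist τ ^ 2)) (hplaneMeasure n)) :
    MemL1Even (Bstar h) := by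
  have hn1 : 1 ≤ n := by omega
  refine ⟨?_, Eventually.of_forall (Bstar_neg h)⟩
  have : Nontrivial (E n) := Module.nontrivial_of_finrank_pos (R := ℝ) (by rw [finrank_E]; omega)
  have hc0 : ((surf n) univ)⁻¹ ≠ 0 := ENNReal.inv_ne_zero.2 (measure_ne_top _ _)
  have hc1 : ((surf n) univ)⁻¹ ≠ ∞ := by
    rw [surf, toSphere_univ_eq_area, finrank_E]
    exact ENNReal.inv_ne_top.2 (ofReal_area_ne_zero hn1)
  have h1 := hmeas.comp_measurable measurable_hplane
  have h2 := hint.comp_measurable measurable_hplane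
  rw [Measure.prod_smul_left] at h1 h2
  replace h1 : AEStronglyMeasurable (fun p : USphere n × ℝ => h (hplane p.1 p.2))
    ((surf n).prod volume) := h1.mono_ac (Measure.AbsolutelyContinuous.smul_right .rfl hc0)
  rw [integrable_smul_measure hc0 hc1] at h2
  have h3 : Integrable (valAt (Bstar h)) (sph (E (n + 1))) := by
    rw [sph_eq_map_cylPt hn1, measurableEmbedding_cylPt.integrable_map_iff,
      integrable_withDensity_iff_integrable_smul' (measurable_cylDensity n)
        (Eventually.of_forall fun p => ENNReal.ofReal_lt_top)]
    have h4 : ∀ p : USphere n × ℝ, (ENNReal.ofReal ((√(1 + p.2 ^ 2) ^ (n + 1))⁻¹)).toReal •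
        (valAt (Bstar h) ∘ cylPt) p = (√(1 + p.2 ^ 2))⁻¹ • h (hplane p.1 p.2) := fun p => by
      have hp := sqrt_one_add_sq_pos p.2
      rw [ENNReal.toReal_ofReal (by positivity), Function.comp, valAt_Bstar_cylPt, smul_smul,
        pow_succ', mul_inv, mul_assoc, inv_mul_cancel₀ (pow_pos hp n).ne', mul_one]
    simp only [h4]
    refine h2.mono' ?_ (Eventually.of_forall fun p => ?_)
    · exact (by fun_prop : Measurable fun p : USphere n × ℝ =>
        (√(1 + p.2 ^ 2))⁻¹).aestronglyMeasurable.smul h1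
    · rw [norm_smul, norm_inv, Real.norm_of_nonneg (Real.sqrt_nonneg _), Function.comp,
        hdist_hplane, sq_abs, div_eq_inv_mul]
  rw [sph, (measurableEmbedding_coe_sphere (n + 1)).integrable_map_iff] at h3
  exact h3.congr (Eventually.of_forall fun θ => valAt_coe _ θ)

/-- The parameters chosen for `-τ` are known only up to a common sign, which changes the point to
its antipode. For an even function this ambiguity is harmless, also at `t = 0`. -/
lemma muTilde_hneg_hplane (p : USphere n × ℝ) :
    muTilde (hneg (hplane p.1 p.2)) = cylPt p ∨ muTilde (hneg (hplane p.1 p.2)) = -cylPt p := by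
  have key : ∀ t : ℝ, ∀ η : E n, joinPt (-(Real.cos (Real.arctan t) • η))
      (Real.sin (Real.arctan t)) = (√(1 + t ^ 2))⁻¹ • joinPt (-η) t := fun t η => by
    rw [Real.cos_arctan, Real.sin_arctan, ← joinPt_smul, smul_neg, one_div, div_eq_inv_mul]
  obtain ⟨-, hr⟩ := Classical.choose_spec (exists_param (hneg (hplane p.1 p.2)))
  rw [muTilde]
  simp only [key]
  set r := Classical.choose (exists_param (hneg (hplane p.1 p.2)))
  rw [hneg_hplane] at hr
  rcases eq_or_eq_neg_of_hplane_eq hr with ⟨h1, h2⟩ | ⟨h1, h2⟩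
  · left
    rw [h1, h2, cylPt]
    simp
  · right
    have h3 := joinPt_smul (-1) (p.1 : E n) p.2
    rw [neg_one_smul, neg_one_mul, neg_one_smul] at h3
    rw [h1, h2, cylPt, ← smul_neg, ← h3, neg_sq, neg_neg]

lemma ae_usph_neg {P : E (n + 1) → Prop} (h : ∀ᵐ v ∂usph (E (n + 1)), P v) :
    ∀ᵐ v ∂usph (E (n + 1)), P (-v) := by
  rw [← map_neg_usph] at h
  exact ae_of_ae_map measurable_neg.aemeasurable h

theorem ae_eq_BstarInv (hn : 1 ≤ n) {h : Hyperplane n → 𝕜} {f : USphere (n + 1) → 𝕜}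
    (hf : f =ᵐ[surf (n + 1)] Bstar h) : h =ᵐ[hplaneMeasure n] BstarInv f := by
  have h1 : ∀ᵐ v ∂usph (E (n + 1)), valAt f v = valAt (Bstar h) v := by
    rw [ae_usph_iff]
    filter_upwards [hf] with θ hθ
    rw [valAt_coe, valAt_coe, hθ]
  refine ae_hplaneMeasure ?_
  -- Since either sign may occur, the point and its antipode must both avoid the null set where `f`
  -- and `B_* h` differ.
  filter_upwards [ae_cylPt hn h1, ae_cylPt hn (ae_usph_neg h1)] with p hp1 hp2
  have hB : valAt (Bstar h) (-cylPt p) = valAt (Bstar h) (cylPt p) := by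
    have h3 : ‖-cylPt p‖ = 1 := by rw [norm_neg, norm_cylPt]
    rw [valAt_of_norm _ (norm_cylPt p), valAt_of_norm _ h3]
    exact Bstar_neg h ⟨cylPt p, mem_sphere_zero_iff_norm.2 (norm_cylPt p)⟩
  have h2 : valAt f (muTilde (hneg (hplane p.1 p.2))) = valAt (Bstar h) (cylPt p) := by
    rcases muTilde_hneg_hplane p with h3 | h3 <;> rw [h3]
    · exact hp1
    · rw [hp2, hB]
  have h0 : (0 : ℝ) < 1 + p.2 ^ 2 := by positivity
  rw [BstarInv, h2, valAt_Bstar_cylPt, smul_smul, hdist_hplane, sq_abs, Real.sqrt_eq_rpow,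
    ← Real.rpow_natCast (_ ^ _) n, ← Real.rpow_mul h0.le, ← Real.rpow_add h0,
    show -(n : ℝ) / 2 + 1 / 2 * n = 0 by ring, Real.rpow_zero, one_smul]

end CylinderParam

/-! ### Null sets under `x ↦ omegaPt x`, and the operator `A_*⁻¹` -/

section Assembly

variable {n : ℕ}

lemma perpMeas_neg (θ : E (n + 1)) : perpMeas (-θ) = perpMeas θ := by
  have : perpProj (-θ) = perpProj θ := by
    ext1 w
    simp [perpProj]
  rw [perpMeas, perpMeas, this]

/-- An almost everywhere property of directions holds for the direction of almost every vector. -/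
lemma ae_of_ae_usph {P : E (n + 1) → Prop} (h : ∀ᵐ v ∂usph (E (n + 1)), P v) :
    ∀ᵐ v : E (n + 1), P (‖v‖⁻¹ • v) := by
  have h1 : ∀ᵐ v ∂sph (E (n + 1)), P v := by
    rw [sph_eq_smul_usph]
    exact Measure.ae_smul_measure h _
  obtain ⟨N, hPN, hN, hN0⟩ := exists_measurable_superset_of_null (ae_iff.1 h1)
  have hm : MeasurableSet ((fun v : E (n + 1) => ‖v‖⁻¹ • v) ⁻¹' N) :=
    (by fun_prop : Measurable fun v : E (n + 1) => ‖v‖⁻¹ • v) hN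
  refine measure_mono_null (t := (fun v : E (n + 1) => ‖v‖⁻¹ • v) ⁻¹' N) (fun v hv => hPN hv) ?_
  rw [← lintegral_indicator_one hm, lintegral_polar (measurable_one.indicator hm),
    ← lintegral_zero (μ := sph (E (n + 1)))]
  refine lintegral_congr_ae ?_
  filter_upwards [ae_norm_sph (V := E (n + 1)), measure_eq_zero_iff_ae_notMem.1 hN0] with y hy hyN
  rw [← lintegral_zero (μ := volume.restrict (Ioi (0 : ℝ)))]
  refine setLIntegral_congr_fun measurableSet_Ioi fun r hr => ?_
  have hr' : 0 < r := hr
  have : r • y ∉ (fun v : E (n + 1) => ‖v‖⁻¹ • v) ⁻¹' N := by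
    change ‖r • y‖⁻¹ • r • y ∉ N
    rwa [norm_smul, hy, Real.norm_of_nonneg hr'.le, mul_one, inv_smul_smul₀ hr'.ne']
  rw [indicator_of_notMem this, mul_zero]

/-- A null set of directions spans a null cone in `E (n + 1)`. By Fubini some horizontal section of
that cone at positive height is null, and a dilation brings this section to the parameter `x`. -/
lemma ae_omegaPt {P : E (n + 1) → Prop} (h : ∀ᵐ v ∂usph (E (n + 1)), P v) :
    ∀ᵐ x : E n, P (omegaPt x) := by
  have hmp := measurePreserving_smul_add (pole n) (joinZero n) norm_pole inner_pole_joinZero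
    (by simp)
  have h1 := hmp.quasiMeasurePreserving.ae (ae_of_ae_usph h)
  rw [Measure.volume_eq_prod] at h1
  have h2 := Measure.ae_ae_of_ae_prod h1
  -- Almost every height is good, and the positive half-line has positive measure.
  obtain ⟨r, hr0, hr⟩ : ∃ r : ℝ, 0 < r ∧ ∀ᵐ y : E n,
      P (‖r • pole n + joinZero n y‖⁻¹ • (r • pole n + joinZero n y)) := by
    by_contra hcon
    have h3 : volume (Ioi (0 : ℝ)) = 0 :=
      measure_mono_null (fun r hr h4 => hcon ⟨r, hr, h4⟩) h2
    simp at h3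
  -- At height `r` the point over `-r x` is `r (-x + e_{n+1})`, whose direction is `omegaPt x`.
  have hq : Measure.QuasiMeasurePreserving (fun x : E n => (-r) • x) volume volume :=
    ⟨by fun_prop, by
      rw [Measure.map_addHaar_smul volume (neg_ne_zero.2 hr0.ne')]
      exact Measure.smul_absolutelyContinuous⟩
  filter_upwards [hq.ae hr] with x hx
  rw [← joinPt_eq] at hx
  have e : joinPt ((-r) • x) r = r • joinPt (-x) 1 := by
    rw [← joinPt_smul, mul_one, neg_smul, smul_neg]
  rwa [e, norm_smul, Real.norm_of_nonneg hr0.le, smul_smul, mul_inv, mul_assoc, mul_comm,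
    mul_assoc, mul_inv_cancel₀ hr0.ne', mul_one, norm_joinPt, norm_neg, one_pow,
    add_comm (‖x‖ ^ 2)] at hx

variable {𝕜 : Type*} [RCLike 𝕜]

lemma ae_funkExistsAt (hn : 2 ≤ n) {f : USphere (n + 1) → 𝕜} (hf : Integrable f (surf (n + 1))) :
    ∀ᵐ x : E n, FunkExistsAt f (omegaPt x) := by
  have h1 : Integrable (valAt f) (usph (E (n + 1))) := by
    rw [integrable_usph_iff]
    exact hf.congr (Eventually.of_forall fun θ => (valAt_coe f θ).symm)
  filter_upwards [ae_omegaPt (ae_integrable_perpMeas (by rw [finrank_E]; omega) h1)] with x hx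
  exact (integrable_perpMeas_iff (by omega) (norm_omegaPt x)).1 hx

lemma funk_neg (hn : 1 ≤ n) (f : USphere (n + 1) → 𝕜) (θ : USphere (n + 1)) :
    funk f (-θ) = funk f θ := by
  rw [funk_eq_perpMean hn, funk_eq_perpMean hn, perpMean, perpMean,
    show ((-θ : USphere (n + 1)) : E (n + 1)) = -(θ : E (n + 1)) from rfl, perpMeas_neg]

/-- The points `omegaPt x` fill only the open upper hemisphere; for `θ` in the lower one the
antipode is reached, which suffices because `F f` is always even. -/
lemma omegaPt_neg_smul_headPt (θ : USphere (n + 1)) (h0 : lastCoord (θ : E (n + 1)) ≠ 0) :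
    1 + ‖-((lastCoord (θ : E (n + 1)))⁻¹ • headPt (θ : E (n + 1)))‖ ^ 2 =
        (|lastCoord (θ : E (n + 1))| ^ 2)⁻¹ ∧
      (omegaPt (-((lastCoord (θ : E (n + 1)))⁻¹ • headPt (θ : E (n + 1)))) = θ ∨
        omegaPt (-((lastCoord (θ : E (n + 1)))⁻¹ • headPt (θ : E (n + 1)))) = -θ) := by
  have h1 : ‖headPt (θ : E (n + 1))‖ ^ 2 + lastCoord (θ : E (n + 1)) ^ 2 = 1 := by
    rw [← norm_joinPt_sq, joinPt_headPt_lastCoord, norm_coe_sphere, one_pow]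
  set c := lastCoord (θ : E (n + 1)) with hc
  have h2 : 1 + ‖-(c⁻¹ • headPt (θ : E (n + 1)))‖ ^ 2 = (|c| ^ 2)⁻¹ := by
    rw [norm_neg, norm_smul, mul_pow, norm_inv, Real.norm_eq_abs, inv_pow, sq_abs]
    field_simp
    linarith
  refine ⟨h2, ?_⟩
  have h3 : joinPt (c⁻¹ • headPt (θ : E (n + 1))) 1 = c⁻¹ • (θ : E (n + 1)) := by
    conv_rhs => rw [← joinPt_headPt_lastCoord (θ : E (n + 1)), ← joinPt_smul, ← hc,
      inv_mul_cancel₀ h0]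
  rw [omegaPt, h2, neg_neg, h3, Real.sqrt_inv, Real.sqrt_sq (abs_nonneg _), inv_inv, smul_smul]
  rcases abs_choice c with h4 | h4 <;> rw [h4]
  · left; rw [mul_inv_cancel₀ h0, one_smul]
  · right; rw [neg_mul, mul_inv_cancel₀ h0, neg_one_smul]

lemma AstarInv_Rstar (hn : 2 ≤ n) (h : Hyperplane n → 𝕜) (θ : USphere (n + 1))
    (h0 : lastCoord (θ : E (n + 1)) ≠ 0) : AstarInv (Rstar h) θ = funk (Bstar h) θ := by
  obtain ⟨h1, h2⟩ := omegaPt_neg_smul_headPt θ h0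
  have h3 : valAt (funk (Bstar h))
      (omegaPt (-((lastCoord (θ : E (n + 1)))⁻¹ • headPt (θ : E (n + 1))))) =
      funk (Bstar h) θ := by
    rcases h2 with h2 | h2 <;> rw [h2]
    · exact valAt_coe _ θ
    · exact (valAt_coe _ (-θ)).trans (funk_neg (by omega) _ θ)
  rw [AstarInv, Rstar_eq_Astar hn, Astar, h1, h3, Real.sqrt_inv, Real.sqrt_sq (abs_nonneg _),
    inv_inv, inv_smul_smul₀ (abs_ne_zero.2 h0)]

lemma AstarInv_Rstar_ae_eq (hn : 2 ≤ n) (h : Hyperplane n → 𝕜) :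
    AstarInv (Rstar h) =ᵐ[surf (n + 1)] funk (Bstar h) := by
  have h1 : ∀ᵐ v ∂usph (E (n + 1)), lastCoord v ≠ 0 := by
    filter_upwards [ae_inner_mem (by rw [finrank_E]; omega) (norm_pole (n := n))] with v hv
    rw [← inner_pole_right]
    exact hv.2
  filter_upwards [ae_usph_iff.1 h1] with θ hθ using AstarInv_Rstar hn h θ hθ

lemma funk_congr_ae (hn : 2 ≤ n) {f g : USphere (n + 1) → 𝕜} (hfg : f =ᵐ[surf (n + 1)] g) :
    funk f =ᵐ[surf (n + 1)] funk g := by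
  have h1 : valAt f =ᵐ[usph (E (n + 1))] valAt g := by
    refine ae_usph_iff.2 ?_
    filter_upwards [hfg] with θ hθ
    rw [valAt_coe, valAt_coe, hθ]
  filter_upwards [ae_usph_iff.1 (perpMean_congr (by rw [finrank_E]; omega) h1)] with θ hθ
  rw [funk_eq_perpMean (by omega), funk_eq_perpMean (by omega), hθ]

lemma isFunkInverse_funkInv {φ f : USphere (n + 1) → 𝕜} (hf : IsFunkInverse φ f) :
    IsFunkInverse φ (funkInv φ) := by
  have h : ∃ f, IsFunkInverse φ f := ⟨f, hf⟩
  rw [funkInv, dif_pos h]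
  exact Classical.choose_spec h

end Assembly

end DualRadon

end

theorem mainTheorem10 {𝕜 : Type*} [RCLike 𝕜] (n : ℕ) (hn : 2 ≤ n) (h : Hyperplane n → 𝕜)
    (hmeas : AEStronglyMeasurable h (hplaneMeasure n))
    (hint : Integrable (fun τ => ‖h τ‖ / √(1 + hdist τ ^ 2)) (hplaneMeasure n)) :
    -- `B_* h ∈ L^1_even(S^n)`
    MemL1Even (Bstar h) ∧
    -- for almost every `x`, both `(R^* h)(x)` and `(A_* F B_* h)(x)` exist in the Lebesgue sense
    (∀ᵐ x : E n,
      Integrable (fun η : USphere n => h (hplane η (inner ℝ x (η : E n)))) (surf n) ∧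
      FunkExistsAt (Bstar h) (omegaPt x)) ∧
    -- for every `x`, one of them exists if and only if the other does, and they are equal
    (∀ x : E n,
      (Integrable (fun η : USphere n => h (hplane η (inner ℝ x (η : E n)))) (surf n) ↔
        FunkExistsAt (Bstar h) (omegaPt x)) ∧
      Rstar h x = Astar (funk (Bstar h)) x) ∧
    -- `B_* h` is the unique solution `f ∈ L^1_even(S^n)` of `F f = A_*⁻¹ R^* h`
    (∀ f : USphere (n + 1) → 𝕜, MemL1Even f →
      (funk f =ᵐ[surf (n + 1)] AstarInv (Rstar h) ↔ f =ᵐ[surf (n + 1)] Bstar h)) ∧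
    -- it is given by the inversion formula for the Funk transform
    IsFunkInverse (AstarInv (Rstar h)) (Bstar h) ∧
    -- `h = B_*⁻¹ F⁻¹ A_*⁻¹ R^* h`
    h =ᵐ[hplaneMeasure n] BstarInv (funkInv (AstarInv (Rstar h))) := by
  have hB := memL1Even_Bstar hn hmeas hint
  have hφ := AstarInv_Rstar_ae_eq hn h
  have hinv := isFunkInverse_of_ae_eq_funk hn hB hφ
  refine ⟨hB, ?_, fun x => ⟨integrable_iff_funkExistsAt hn h x, Rstar_eq_Astar hn h x⟩,
    fun f hf => ⟨fun hfφ => ?_, fun hfB => ?_⟩, hinv, ?_⟩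
  · filter_upwards [ae_funkExistsAt hn hB.1] with x hx
    exact ⟨(integrable_iff_funkExistsAt hn h x).2 hx, hx⟩
  -- Uniqueness: `f` and `B_* h` are both limits of the inversion formula for the same right-hand
  -- side.
  · exact (isFunkInverse_of_ae_eq_funk hn hf hfφ.symm).ae_unique hinv
  · exact (funk_congr_ae hn hfB).trans hφ.symm
  · exact ae_eq_BstarInv (by omega) ((isFunkInverse_funkInv hinv).ae_unique hinv)
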